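/- Let $N,M\ge 1$ be integers. Let $\mathcal A$ be the algebra over $\mathbb C$ of differential polynomials in $u_{N-1},\dots,u_{-M+1}$, $u_{-M}^{1/M}$, $u_{-M}^{-1/M}$, $\log u_{-M}$, with total derivative $\partial_x$, and let $\hat{\mathcal A}=\mathcal A[[\epsilon]]$, on which $\Lambda=e^{\epsilon\partial_x}$ acts, so that $(\Lambda f)(x)=f(x+\epsilon)$. Put $u_N=1$ and $u_n=0$ for $n>N$ or $n<-M$, and consider the Lax operator $$L=\Lambda^N+u_{N-1}\Lambda^{N-1}+\dots+u_{-M}\Lambda^{-M}.$$ For a difference operator $A=\sum_k a_k\Lambda^k$ with coefficients in $\hat{\mathcal A}$ put $A_+=\sum_{k\ge0}a_k\Lambda^k$, $A_-=\sum_{k<0}a_k\Lambda^k$ (similarly $A_{\le0}$, $A_{>0}$), $\operatorname{res}A=a_0$, and $\langle A,B\rangle=\int\operatorname{res}(AB)\,dx$, where $\int f\,dx$ denotes the class of $f$ in the space of local functionals $\hat{\mathcal A}/\partial_x\hat{\mathcal A}$. Tangent vectors to the space of Lax operators are the operators $\dot L=\sum_{n=-M}^{N-1}v_n\Lambda^n$.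 A $1$-form is represented by a difference operator $X$ through $\dot L\mapsto\langle X,\dot L\rangle$, so $X$ is defined up to operators $(\sum_{k<-N+1}+\sum_{k>M})w_k\Lambda^k$. The differential of a local functional $f$ is represented by any difference operator $df$ whose pairing $\langle df,\dot L\rangle$ with every tangent vector is the derivative of $f$ along $\dot L$; for instance $df=\sum_{n=-M}^{N-1}\Lambda^{-n}\circ\frac{\delta f}{\delta u_n}$. A Hamiltonian operator is a $\mathbb C[[\epsilon]]$-linear, skew-symmetric map $P$ from $1$-forms to tangent vectors such that $\{f,g\}=\langle df,P(dg)\rangle$ is a well-defined Poisson bracket on local functionals (bilinear over $\mathbb C[[\epsilon]]$, skew-symmetric, satisfying the Jacobi identity); two Hamiltonian operators are compatible if all their linear combinations with coefficients in $\mathbb C[[\epsilon]]$ are Hamiltonian operators. Proposition. The formulas $$P_1(X)=[X_+,L]_{\le0}-[X_-,L]_{>0},$$ $$P_2(X)=\tfrac12[L,(LX+XL)_-]-\tfrac12L[L,X]_{\le0}-\tfrac12[L,X]_{\le0}L+\tfrac12\big[L,(\Lambda^N+1)(\Lambda^N-1)^{-1}\operatorname{res}[L,X]\big]$$ define two compatible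 Hamiltonian operators. Here $\operatorname{res}[L,X]$ always lies in the image of $\Lambda^N-1$ on $\hat{\mathcal A}$, and $P_2(X)$ does not depend on the choice of the preimage. Equivalently, $\{f,g\}_i=\langle df,P_i(dg)\rangle$, $i=1,2$, are two compatible Poisson brackets. For $-M\le n,m\le N-1$ their explicit form is $$\{u_n(x),u_m(y)\}_1=c_{nm}\big(u_{n+m}(x)\,\delta(x-y+n\epsilon)-u_{n+m}(x-m\epsilon)\,\delta(x-y-m\epsilon)\big),$$ $$\{u_n(x),u_m(y)\}_2=\sum_{l<m}\big[u_{n+m-l}(x)u_l(x+(n-l)\epsilon)\,\delta(x-y+(n-l)\epsilon)-u_l(x)u_{n+m-l}(x+(l-m)\epsilon)\,\delta(x-y+(l-m)\epsilon)\big]$$ $$\qquad+u_n(x)\,\frac{(\Lambda^n-\Lambda^N)(\Lambda^{-m}-1)}{1-\Lambda^N}\,u_m(x)\,\delta(x-y),$$ where $c_{nm}=1$ if $n,m>0$, $c_{nm}=-1$ if $n,m\le0$, $c_{nm}=0$ otherwise, and the fraction is the power series in $\epsilon\partial_x$ obtained by substituting $\Lambda=e^{\epsilon\partial_x}$. This means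 that $P_i(\Lambda^{-m}\circ f)=\sum_{n=-M}^{N-1}\big(\int\{u_n(x),u_m(y)\}_i\,f(y)\,dy\big)\Lambda^n$ for all $f\in\hat{\mathcal A}$, where $\delta(x-y+k\epsilon)$ is the kernel of $\Lambda^k$, and that $$\{f,g\}_i=\sum_{n,m=-M}^{N-1}\iint\frac{\delta f}{\delta u_n(x)}\,\{u_n(x),u_m(y)\}_i\,\frac{\delta g}{\delta u_m(y)}\,dx\,dy.$$ -/

import Mathlib

open scoped PowerSeries LaurentPolynomial

noncomputable section

namespace BigradedToda

/-! ### The differential algebra `𝒜` -/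

/-- The polynomial generators of `𝒜`: `ell` is `log u_{-M}`, `low k` is the jet variable
`∂ₓ^(k+1) u_{-M}`, and `jet n k` is `∂ₓ^k u_n` for `-M < n < N`. -/
inductive Gen (N M : ℕ) : Type
  | ell : Gen N M
  | low (k : ℕ) : Gen N M
  | jet (n : Set.Ioo (-(M : ℤ)) (N : ℤ)) (k : ℕ) : Gen N M

/-- The algebra `𝒜` of differential polynomials in `u_{N-1}, …, u_{-M+1}`, `v = u_{-M}^{1/M}`,
`v⁻¹ = u_{-M}^{-1/M}` and `log u_{-M}`: polynomials in the generators `Gen N M` whose coefficients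
are Laurent polynomials in `v`. -/
abbrev DiffAlg (N M : ℕ) : Type := MvPolynomial (Gen N M) ℂ[T;T⁻¹]

/-- `d/dv` on Laurent polynomials in `v`, as a linear map: `v^k ↦ k v^(k-1)`. -/
def laurentDerivLin : ℂ[T;T⁻¹] →ₗ[ℂ] ℂ[T;T⁻¹] :=
  (AddMonoidAlgebra.basis ℤ ℂ).constr ℂ
    fun k : ℤ => (k : ℂ) • (LaurentPolynomial.T (k - 1) : ℂ[T;T⁻¹])

theorem laurentDerivLin_T (k : ℤ) :
    laurentDerivLin (LaurentPolynomial.T k) =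
      (k : ℂ) • (LaurentPolynomial.T (k - 1) : ℂ[T;T⁻¹]) := by
  have h : (LaurentPolynomial.T k : ℂ[T;T⁻¹]) = AddMonoidAlgebra.basis ℤ ℂ k := rfl
  rw [h, laurentDerivLin, Module.Basis.constr_basis]

/-- `d/dv` on Laurent polynomials in `v`, as a derivation. -/
def laurentDeriv : Derivation ℂ ℂ[T;T⁻¹] ℂ[T;T⁻¹] where
  toLinearMap := laurentDerivLin
  map_one_eq_zero' := by
    rw [← LaurentPolynomial.T_zero, laurentDerivLin_T]; simp
  leibniz' p q := by
    induction p using LaurentPolynomial.induction_on' with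
    | add p p' hp hp' => simp only [add_mul, map_add, hp, hp', smul_eq_mul]; ring
    | C_mul_T m a =>
      induction q using LaurentPolynomial.induction_on' with
      | add q q' hq hq' => simp only [mul_add, map_add, hq, hq', smul_eq_mul]; ring
      | C_mul_T n b =>
        simp only [← LaurentPolynomial.smul_eq_C_mul, smul_eq_mul]
        rw [smul_mul_smul_comm, map_smul, map_smul, map_smul, ← LaurentPolynomial.T_add,
          laurentDerivLin_T, laurentDerivLin_T, laurentDerivLin_T]
        simp only [smul_mul_assoc, mul_smul_comm, ← LaurentPolynomial.T_add, smul_smul]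
        have e1 : m + (n - 1) = m + n - 1 := by ring
        have e2 : n + (m - 1) = m + n - 1 := by ring
        rw [e1, e2, ← add_smul]
        congr 1
        push_cast
        ring

/-- `laurentDeriv` applied to every coefficient of an element of `𝒜`. -/
def derivVFun (N M : ℕ) (p : DiffAlg N M) : DiffAlg N M :=
  AddMonoidAlgebra.map laurentDeriv.toLinearMap.toAddMonoidHom p

theorem derivVFun_add {N M : ℕ} (p q : DiffAlg N M) :
    derivVFun N M (p + q) = derivVFun N M p + derivVFun N M q :=
  AddMonoidAlgebra.map_add _ _ _

theorem derivVFun_monomial {N M : ℕ} (s : Gen N M →₀ ℕ) (a : ℂ[T;T⁻¹]) :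
    derivVFun N M (MvPolynomial.monomial s a) = MvPolynomial.monomial s (laurentDeriv a) :=
  AddMonoidAlgebra.map_single _ _ _

/-- The partial derivative `∂/∂v` on `𝒜`, the generators in `Gen N M` being held fixed. -/
def derivV (N M : ℕ) : Derivation ℂ (DiffAlg N M) (DiffAlg N M) where
  toFun := derivVFun N M
  map_add' := derivVFun_add
  map_smul' c p := by
    induction p using MvPolynomial.induction_on' with
    | monomial s a =>
      simp only [MvPolynomial.smul_monomial, derivVFun_monomial, Derivation.map_smul,
        RingHom.id_apply]
    | add p q hp hq => simp only [smul_add, derivVFun_add, hp, hq]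
  map_one_eq_zero' := by
    change derivVFun N M (MvPolynomial.monomial 0 1) = 0
    rw [derivVFun_monomial, Derivation.map_one_eq_zero, MvPolynomial.monomial_zero]
  leibniz' p q := by
    change derivVFun N M (p * q) = p • derivVFun N M q + q • derivVFun N M p
    induction p using MvPolynomial.induction_on' with
    | add p p' hp hp' => simp only [add_mul, derivVFun_add, hp, hp', smul_eq_mul]; ring
    | monomial s a =>
      induction q using MvPolynomial.induction_on' with
      | add q q' hq hq' => simp only [mul_add, derivVFun_add, hq, hq', smul_eq_mul]; ring
      | monomial t b =>
        simp only [MvPolynomial.monomial_mul, derivVFun_monomial, Derivation.leibniz, smul_eq_mul,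
          map_add, add_comm t s]

/-- The element `v ^ j = u_{-M}^{j/M}` of `𝒜`. -/
def vPow (N M : ℕ) (j : ℤ) : DiffAlg N M := MvPolynomial.C (LaurentPolynomial.T j)

/-- The coefficient `u_n` of the Lax operator: `u_N = 1`, and `u_n = 0` for `n > N` or
`n < -M`. -/
def uVar (N M : ℕ) (n : ℤ) : DiffAlg N M :=
  if n = -(M : ℤ) then vPow N M M
  else if h : n ∈ Set.Ioo (-(M : ℤ)) (N : ℤ) then MvPolynomial.X (Gen.jet ⟨n, h⟩ 0)
  else if n = N then 1
  else 0

/-- The partial derivative `∂/∂u_n^{(k)}` on `𝒜` with respect to `u_n^{(k)} = ∂ₓ^k u_n`,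
for `-M ≤ n ≤ N-1` (and `0` for other `n`). Since `v = u_{-M}^{1/M}` and `ell = log u_{-M}`,
one has `∂/∂u_{-M} = (1/M) v^{1-M} ∂/∂v + v^{-M} ∂/∂ell`. -/
def partialU (N M : ℕ) (n : ℤ) (k : ℕ) : Derivation ℂ (DiffAlg N M) (DiffAlg N M) :=
  if n = -(M : ℤ) then
    match k with
    | 0 => ((1 / (M : ℂ)) • vPow N M (1 - M)) • derivV N M
        + vPow N M (-M) • (MvPolynomial.pderiv Gen.ell).restrictScalars ℂ
    | k + 1 => (MvPolynomial.pderiv (Gen.low k)).restrictScalars ℂ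
  else if h : n ∈ Set.Ioo (-(M : ℤ)) (N : ℤ) then
    (MvPolynomial.pderiv (Gen.jet ⟨n, h⟩ k)).restrictScalars ℂ
  else 0

/-- The total `x`-derivative `∂ₓ` on `𝒜`. -/
def totalD (N M : ℕ) : Derivation ℂ (DiffAlg N M) (DiffAlg N M) :=
  (MvPolynomial.mkDerivation ℂ[T;T⁻¹] fun g : Gen N M =>
      match g with
      | Gen.ell => vPow N M (-M) * MvPolynomial.X (Gen.low 0)
      | Gen.low k => MvPolynomial.X (Gen.low (k + 1))
      | Gen.jet n k => MvPolynomial.X (Gen.jet n (k + 1))).restrictScalars ℂ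
    + ((1 / (M : ℂ)) • (vPow N M (1 - M) * MvPolynomial.X (Gen.low 0))) • derivV N M

/-! ### The completion `𝒜⟦ε⟧`, shifts, and local functionals -/

/-- `𝒜⟦ε⟧`, formal power series in `ε` with coefficients in `𝒜`. -/
abbrev Hat (N M : ℕ) : Type := (DiffAlg N M)⟦X⟧

/-- The coefficient `u_n` as an element of `𝒜⟦ε⟧`. -/
def uHat (N M : ℕ) (n : ℤ) : Hat N M := PowerSeries.C (uVar N M n)

/-- The total `x`-derivative on `𝒜⟦ε⟧`, which is linear over the constants `ℂ⟦ε⟧`. -/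
def hatD (N M : ℕ) : Hat N M →ₗ[ℂ⟦X⟧] Hat N M where
  toFun f := PowerSeries.mk fun j => totalD N M (PowerSeries.coeff j f)
  map_add' f g := by ext1 j; simp
  map_smul' c f := by
    ext1 j
    simp only [Algebra.smul_def, PowerSeries.algebraMap_apply'', PowerSeries.coeff_mk,
      PowerSeries.coeff_mul, PowerSeries.coeff_map, map_sum, RingHom.id_apply]
    refine Finset.sum_congr rfl fun p _ => ?_
    rw [← Algebra.smul_def, Derivation.map_smul, Algebra.smul_def]

/-- For `φ = ∑ φ_k λ^k ∈ ℂ⟦λ⟧`, the operator `φ(ε∂ₓ) f = ∑ φ_k ε^k ∂ₓ^k f` on `𝒜⟦ε⟧`. -/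
def applySymbol {N M : ℕ} (φ : ℂ⟦X⟧) (f : Hat N M) : Hat N M :=
  PowerSeries.mk fun j => ∑ p ∈ Finset.HasAntidiagonal.antidiagonal j,
    PowerSeries.coeff p.1 φ • (totalD N M)^[p.1] (PowerSeries.coeff p.2 f)

/-- The symbol `e^{mλ}`. -/
def expSymbol (m : ℤ) : ℂ⟦X⟧ := PowerSeries.rescale (m : ℂ) (PowerSeries.exp ℂ)

/-- The shift `Λ^m = e^{mε∂ₓ}` on `𝒜⟦ε⟧`, i.e. `(Λ^m f)(x) = f(x + mε)`. -/
def shift {N M : ℕ} (m : ℤ) (f : Hat N M) : Hat N M := applySymbol (expSymbol m) f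

/-- Local functionals `∫ f dx`, `f ∈ 𝒜⟦ε⟧`: densities modulo total `x`-derivatives. -/
abbrev LocalFunctional (N M : ℕ) : Type := Hat N M ⧸ LinearMap.range (hatD N M)

/-- `f ↦ ∫ f dx`. -/
def integral (N M : ℕ) : Hat N M →ₗ[ℂ⟦X⟧] LocalFunctional N M :=
  (LinearMap.range (hatD N M)).mkQ

/-! ### Difference operators -/

/-- Formal difference operators `∑_k a_k Λ^k`, `k ∈ ℤ`, with coefficients in `𝒜⟦ε⟧`. -/
abbrev DiffOp (N M : ℕ) : Type := ℤ → Hat N M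

/-- The product `(∑ a_i Λ^i)(∑ b_j Λ^j) = ∑ a_i (Λ^i b_j) Λ^{i+j}`. It is only used when one of
the factors is a finite sum, so that every coefficient is a finite sum. -/
def opMul {N M : ℕ} (A B : DiffOp N M) : DiffOp N M :=
  fun k => ∑ᶠ i : ℤ, A i * shift i (B (k - i))

/-- The commutator of difference operators. -/
def opComm {N M : ℕ} (A B : DiffOp N M) : DiffOp N M := opMul A B - opMul B A

/-- The part `∑_{k ∈ S} a_k Λ^k` of a difference operator. -/
def part {N M : ℕ} (S : Set ℤ) (A : DiffOp N M) : DiffOp N M := S.indicator A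

/-- The residue `res A = a_0`. -/
def res {N M : ℕ} (A : DiffOp N M) : Hat N M := A 0

/-- The inner product `⟨A, B⟩ = tr AB = ∫ res AB dx`. -/
def pairing {N M : ℕ} (A B : DiffOp N M) : LocalFunctional N M :=
  integral N M (res (opMul A B))

/-- The operator `a Λ^k`. -/
def monomialOp {N M : ℕ} (a : Hat N M) (k : ℤ) : DiffOp N M := Pi.single k a

/-- The Lax operator `L = Λ^N + u_{N-1} Λ^{N-1} + ⋯ + u_{-M} Λ^{-M}`. -/
def lax (N M : ℕ) : DiffOp N M := uHat N M

/-- Tangent vectors `∑_{-M ≤ n ≤ N-1} v_n Λ^n` to the space of Lax operators. -/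
def IsTangent {N M : ℕ} (V : DiffOp N M) : Prop :=
  ∀ k : ℤ, k ∉ Finset.Ico (-(M : ℤ)) N → V k = 0

/-! ### Differentials of local functionals -/

/-- The derivative of the density `f` along `V`, i.e. `d/dt f(L + tV)` at `t = 0`:
`∑_{n,k} (∂f/∂u_n^{(k)}) ∂ₓ^k v_n`. At each order in `ε` only finitely many `k` contribute. -/
def dirDeriv {N M : ℕ} (f : Hat N M) (V : DiffOp N M) : Hat N M :=
  PowerSeries.mk fun j => ∑ p ∈ Finset.HasAntidiagonal.antidiagonal j, ∑ n ∈ Finset.Ico (-(M : ℤ)) N,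
    ∑ᶠ k : ℕ, partialU N M n k (PowerSeries.coeff p.1 f) *
      (totalD N M)^[k] (PowerSeries.coeff p.2 (V n))

/-- The difference operator `W` represents the differential of the local functional `∫ f dx`. -/
def IsDifferential {N M : ℕ} (f : Hat N M) (W : DiffOp N M) : Prop :=
  ∀ V : DiffOp N M, IsTangent V → integral N M (dirDeriv f V) = pairing W V

/-- The variational derivative `δf/δu_n = ∑_k (-∂ₓ)^k ∂f/∂u_n^{(k)}`. -/
def varDeriv {N M : ℕ} (n : ℤ) (f : Hat N M) : Hat N M :=
  PowerSeries.mk fun j => ∑ᶠ k : ℕ,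
    (-1 : ℂ) ^ k • (totalD N M)^[k] (partialU N M n k (PowerSeries.coeff j f))

/-- The difference operator `∑_{-M ≤ n ≤ N-1} Λ^{-n} ∘ δf/δu_n`. -/
def gradOp {N M : ℕ} (f : Hat N M) : DiffOp N M :=
  ∑ n ∈ Finset.Ico (-(M : ℤ)) N, monomialOp (shift (-n) (varDeriv n f)) (-n)

/-! ### Hamiltonian operators -/

/-- A Poisson bracket on the space of local functionals: a `ℂ⟦ε⟧`-bilinear, alternating operation
satisfying the Jacobi identity. -/
structure IsPoissonBracket {N M : ℕ}
    (B : LocalFunctional N M →ₗ[ℂ⟦X⟧] LocalFunctional N M →ₗ[ℂ⟦X⟧] LocalFunctional N M) :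
    Prop where
  alternating : ∀ F, B F F = 0
  jacobi : ∀ F G H, B (B F G) H + B (B G H) F + B (B H F) G = 0

/-- `P` is a Hamiltonian operator on the space of Lax operators: it maps `1`-forms linearly to
tangent vectors, is skew-symmetric, and `{f, g} = ⟨df, P(dg)⟩` is a Poisson bracket. A `1`-form is
a difference operator `X` modulo the operators whose coefficients at `Λ^{-n}`, `-M ≤ n ≤ N-1`,
vanish. -/
structure IsHamiltonianOperator {N M : ℕ} (P : DiffOp N M → DiffOp N M) : Prop where
  map_add : ∀ X Y, P (X + Y) = P X + P Y
  map_smul : ∀ (c : ℂ⟦X⟧) (X), P (c • X) = c • P X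
  map_tangent : ∀ X, IsTangent (P X)
  map_null : ∀ X : DiffOp N M, (∀ n ∈ Finset.Ico (-(M : ℤ)) N, X (-n) = 0) → P X = 0
  skew : ∀ X Y, pairing X (P Y) = -pairing Y (P X)
  poisson : ∃ B : LocalFunctional N M →ₗ[ℂ⟦X⟧] LocalFunctional N M →ₗ[ℂ⟦X⟧] LocalFunctional N M,
    (∀ f g Wf Wg, IsDifferential f Wf → IsDifferential g Wg →
      B (integral N M f) (integral N M g) = pairing Wf (P Wg)) ∧ IsPoissonBracket B

/-- Two Hamiltonian operators are compatible if all their linear combinations with constant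
coefficients are Hamiltonian operators. -/
def Compatible {N M : ℕ} (P Q : DiffOp N M → DiffOp N M) : Prop :=
  ∀ a b : ℂ⟦X⟧, IsHamiltonianOperator (fun X => a • P X + b • Q X)

/-- `P₁(X) = [X_+, L]_{≤0} - [X_-, L]_{>0}`. -/
def P₁ (N M : ℕ) (X : DiffOp N M) : DiffOp N M :=
  part (Set.Iic 0) (opComm (part (Set.Ici 0) X) (lax N M))
    - part (Set.Ioi 0) (opComm (part (Set.Iio 0) X) (lax N M))

/-- The operator `P₂`, in which `g` stands for `(Λ^N - 1)⁻¹ res [L, X]`: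
`½[L, (LX+XL)_-] - ½ L [L,X]_{≤0} - ½ [L,X]_{≤0} L + ½ [L, (Λ^N + 1) g]`. -/
def P₂With (N M : ℕ) (X : DiffOp N M) (g : Hat N M) : DiffOp N M :=
  (1 / 2 : ℂ) • opComm (lax N M) (part (Set.Iio 0) (opMul (lax N M) X + opMul X (lax N M)))
    - (1 / 2 : ℂ) • opMul (lax N M) (part (Set.Iic 0) (opComm (lax N M) X))
    - (1 / 2 : ℂ) • opMul (part (Set.Iic 0) (opComm (lax N M) X)) (lax N M)
    + (1 / 2 : ℂ) • opComm (lax N M) (monomialOp (shift N g + g) 0)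

/-- A preimage of `f` under `Λ^N - 1` on `𝒜⟦ε⟧`, if there is one; it is unique up to the addition
of an element of `ℂ⟦ε⟧`, the kernel of `Λ^N - 1`. -/
def shiftSubOneInv (N M : ℕ) (f : Hat N M) : Hat N M :=
  Function.invFun (fun g : Hat N M => shift N g - g) f

/-- The operator `P₂`, with the nonlocal term `½ [L, (Λ^N + 1)(Λ^N - 1)⁻¹ res [L, X]]`. -/
def P₂ (N M : ℕ) (X : DiffOp N M) : DiffOp N M :=
  P₂With N M X (shiftSubOneInv N M (res (opComm (lax N M) X)))

/-! ### Explicit brackets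

A distribution `K(x, y)` is represented by the operator `f ↦ ∫ K(x, y) f(y) dy`. -/

/-- `a(x) δ(x - y + kε)`, i.e. the operator `f ↦ a Λ^k f`. -/
def deltaKernel {N M : ℕ} (a : Hat N M) (k : ℤ) : Hat N M → Hat N M :=
  fun f => a * shift k f

/-- The bracket `{u_n(x), u_m(y)}` defined by `P`: the operator `P^{nm}` with
`P(Λ^{-m} ∘ f) = ∑_n (P^{nm} f) Λ^n`. -/
def coordBracket {N M : ℕ} (P : DiffOp N M → DiffOp N M) (n m : ℤ) : Hat N M → Hat N M :=
  fun f => P (monomialOp (shift (-m) f) (-m)) n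

/-- `{f, g} = ∑_{n,m} ∫∫ δf/δu_n(x) K_{nm}(x,y) δg/δu_m(y) dx dy`. -/
def kernelBracket {N M : ℕ} (K : ℤ → ℤ → Hat N M → Hat N M) (f g : Hat N M) :
    LocalFunctional N M :=
  ∑ n ∈ Finset.Ico (-(M : ℤ)) N, ∑ m ∈ Finset.Ico (-(M : ℤ)) N,
    integral N M (varDeriv n f * K n m (varDeriv m g))

/-- The constants `c_{nm}`. -/
def cConst (n m : ℤ) : ℂ :=
  if 0 < n ∧ 0 < m then 1 else if n ≤ 0 ∧ m ≤ 0 then -1 else 0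

/-- `c_{nm} (u_{n+m}(x) δ(x-y+nε) - u_{n+m}(x-mε) δ(x-y-mε))`. -/
def kernel₁ (N M : ℕ) (n m : ℤ) : Hat N M → Hat N M :=
  cConst n m • (deltaKernel (uHat N M (n + m)) n
    - deltaKernel (shift (-m) (uHat N M (n + m))) (-m))

/-- `(e^{aλ} - e^{bλ}) / λ`. -/
def expDiffQuot (a b : ℤ) : ℂ⟦X⟧ :=
  PowerSeries.mk fun k => PowerSeries.coeff (k + 1) (expSymbol a - expSymbol b)

theorem X_mul_expDiffQuot (a b : ℤ) :
    PowerSeries.X * expDiffQuot a b = expSymbol a - expSymbol b := by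
  ext k
  cases k with
  | zero =>
    have h (m : ℤ) : PowerSeries.coeff 0 (expSymbol m) = 1 := by
      rw [expSymbol, PowerSeries.coeff_rescale, PowerSeries.coeff_exp]; simp
    rw [map_sub, h, h, sub_self, PowerSeries.coeff_zero_X_mul]
  | succ k => rw [PowerSeries.coeff_succ_X_mul, expDiffQuot, PowerSeries.coeff_mk]

/-- The symbol `(e^{nλ} - e^{Nλ})(e^{-mλ} - 1) / (1 - e^{Nλ}) ∈ ℂ⟦λ⟧`. -/
def nonlocalSymbol (N : ℕ) (n m : ℤ) : ℂ⟦X⟧ :=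
  expDiffQuot n N * (expSymbol (-m) - 1) * (expDiffQuot 0 N)⁻¹

theorem nonlocalSymbol_spec (N : ℕ) (hN : 1 ≤ N) (n m : ℤ) :
    (1 - expSymbol N) * nonlocalSymbol N n m =
      (expSymbol n - expSymbol N) * (expSymbol (-m) - 1) := by
  have h0 : expSymbol 0 = 1 := by simp [expSymbol]
  have hne : PowerSeries.constantCoeff (expDiffQuot 0 N) ≠ 0 := by
    rw [← PowerSeries.coeff_zero_eq_constantCoeff_apply, expDiffQuot, PowerSeries.coeff_mk]
    simp only [expSymbol, map_sub, PowerSeries.coeff_rescale, PowerSeries.coeff_exp]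
    simp
    omega
  rw [← h0, ← X_mul_expDiffQuot 0, ← X_mul_expDiffQuot n, h0, nonlocalSymbol]
  have := PowerSeries.mul_inv_cancel _ hne
  linear_combination
    PowerSeries.X * expDiffQuot n N * (expSymbol (-m) - 1) * this

/-- `∑_{l<m} [u_{n+m-l}(x) u_l(x+(n-l)ε) δ(x-y+(n-l)ε) - u_l(x) u_{n+m-l}(x+(l-m)ε) δ(x-y+(l-m)ε)]
+ u_n(x) ((Λ^n - Λ^N)(Λ^{-m} - 1)/(1 - Λ^N)) u_m(x) δ(x-y)`; the sum starts at `l = -M` since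
`u_l = 0` for `l < -M`. -/
def kernel₂ (N M : ℕ) (n m : ℤ) : Hat N M → Hat N M :=
  (∑ l ∈ Finset.Ico (-(M : ℤ)) m,
      (deltaKernel (uHat N M (n + m - l) * shift (n - l) (uHat N M l)) (n - l)
        - deltaKernel (uHat N M l * shift (l - m) (uHat N M (n + m - l))) (l - m)))
    + fun f => uHat N M n * applySymbol (nonlocalSymbol N n m) (uHat N M m * f)

end BigradedToda

end

open BigradedToda

noncomputable section

namespace BigradedToda

/-! Everything rests on writing both operators with one auxiliary function. If `(Λ^N - 1) g = res
[L, X]`, then `P₂(X) = L((XL)_- + g) - ((LX)_- + Λ^N g)L` (`P₂With_eq`). Such a `g` exists because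
`res [L, X]` is a sum of terms `(Λ^i - 1) h_i`, and each `Λ^i - 1` is divisible by `Λ^N - 1`: both
are `ε∂ₓ` times a power series, and the series for `N` is a unit. Two choices of `g` differ by a
constant, which commutes with `L`. Since `[L + 1, X] = [L, X]`, the same `g` serves at `L + 1`, and
the difference of the two values of the formula is exactly `P₁(X)` (`skewP_add_one`, `P₁_eq`). Thus
`P₁` is the Lie derivative of `P₂` in the direction of the identity operator.

The Jacobi identity for `P₂` is proved for an arbitrary finite difference operator `L`
(`skewP_jacobi`), in the skew group ring of `ℤ` over `𝒜⟦ε⟧`, where `A ↦ ∫ res A` is a trace. It is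
the classical R-matrix argument: `A_- + g` has nonpositive orders, `A - (A_- + g)` has nonnegative
orders, and `tr(A[B, C])` vanishes on operators of one sign because residues multiply there and
coefficients commute. Applied to `XL, YL, ZL` and to `LX, LY, LZ`, this gives two cubic identities
whose difference is the cyclic sum (`trace_cyclic_sum`). Evaluating the Jacobi identity at `L`, `L +
1` and `L - 1` yields the vanishing of all three Schouten brackets of the pencil
(`skewP_pencil_jacobi`).

The formal calculus of variations turns this into a statement on local functionals. The pairing of
forms with tangent vectors is nondegenerate, so differentials are unique modulo null forms; second
derivatives of a functional are symmetric, so they drop out of the Jacobi identity and only the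
trilinear expression `derivPairing` is left (`isHamiltonianOperator_of_jacobi`). Forms may be
infinite operators, but the operators ignore all but finitely many coefficients, so forms can be
truncated. The explicit brackets come from inserting `X = Λ^{-m} ∘ f`. -/

/-! ### Evolutionary derivations of the differential algebra. -/

open MvPolynomial in
-- The value on `v⁻¹` is forced by differentiating `v⁻¹ v = 1`. Identities between derivations are
-- reduced by this to a check on generators.
theorem diffAlg_derivation_ext {N M : ℕ} {D₁ D₂ : Derivation ℂ (DiffAlg N M) (DiffAlg N M)}
    (hv : D₁ (vPow N M 1) = D₂ (vPow N M 1)) (hX : ∀ g, D₁ (X g) = D₂ (X g)) : D₁ = D₂ := by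
  have key : ∀ D : Derivation ℂ (DiffAlg N M) (DiffAlg N M), D (vPow N M 1) = 0 →
      (∀ g, D (X g) = 0) → ∀ p, D p = 0 := by
    intro D h1 h2
    have hinv : vPow N M (-1) * vPow N M 1 = 1 := by
      rw [vPow, vPow, ← map_mul, ← LaurentPolynomial.T_add]; simp
    have hm1 : D (vPow N M (-1)) = 0 := by
      have := congrArg D hinv
      rw [Derivation.leibniz, h1, Derivation.map_one_eq_zero] at this
      simp only [smul_eq_mul, mul_zero, zero_add] at this
      have h3 := congrArg (vPow N M (-1) * ·) this
      simpa [← mul_assoc, hinv] using h3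
    have hadd : ∀ i j, vPow N M (i + j) = vPow N M i * vPow N M j := by
      intro i j; rw [vPow, vPow, vPow, ← map_mul, LaurentPolynomial.T_add]
    have hC : ∀ a : ℂ[T;T⁻¹], D (C a) = 0 := by
      have hc : ∀ a : ℂ, D (C (LaurentPolynomial.C a)) = 0 := fun a => D.map_algebraMap a
      intro a
      induction a using LaurentPolynomial.induction_on with
      | h_C a => exact hc a
      | h_add hp hq => rw [map_add, map_add, hp, hq, add_zero]
      | h_C_mul_T n a ih =>
        have e : (C (LaurentPolynomial.C a * LaurentPolynomial.T ((n : ℤ) + 1)) : DiffAlg N M)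
          = C (LaurentPolynomial.C a * LaurentPolynomial.T (n : ℤ)) * vPow N M 1 := by
          rw [vPow, ← map_mul, mul_assoc, LaurentPolynomial.T_add]
        rw [e, Derivation.leibniz, h1, ih]; simp
      | h_C_mul_T_Z n a ih =>
        have e : (C (LaurentPolynomial.C a * LaurentPolynomial.T (-(n : ℤ) - 1)) : DiffAlg N M)
          = C (LaurentPolynomial.C a * LaurentPolynomial.T (-(n : ℤ))) * vPow N M (-1) := by
          rw [vPow, ← map_mul, mul_assoc, ← LaurentPolynomial.T_add]; rfl
        rw [e, Derivation.leibniz, hm1, ih]; simp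
    intro p
    induction p using MvPolynomial.induction_on with
    | C a => exact hC a
    | add p q hp hq => rw [map_add, hp, hq, add_zero]
    | mul_X p g hp => rw [Derivation.leibniz, hp, h2]; simp
  refine Derivation.ext fun p => ?_
  have := key (D₁ - D₂) (by simp [hv]) (by simp [hX]) p
  simpa [sub_eq_zero] using this

theorem vPow_add {N M : ℕ} (i j : ℤ) : vPow N M (i + j) = vPow N M i * vPow N M j := by
  rw [vPow, vPow, vPow, ← map_mul, LaurentPolynomial.T_add]

@[simp] theorem vPow_zero {N M : ℕ} : vPow N M 0 = 1 := by
  rw [vPow, LaurentPolynomial.T_zero, map_one]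

@[simp] theorem derivV_X {N M : ℕ} (g : Gen N M) : derivV N M (MvPolynomial.X g) = 0 := by
  change derivVFun N M (MvPolynomial.monomial _ 1) = 0
  rw [derivVFun_monomial, Derivation.map_one_eq_zero, MvPolynomial.monomial_zero]

@[simp] theorem derivV_vPow {N M : ℕ} (j : ℤ) :
    derivV N M (vPow N M j) = (j : ℂ) • vPow N M (j - 1) := by
  change derivVFun N M (MvPolynomial.monomial 0 _) = _
  rw [derivVFun_monomial]
  change MvPolynomial.monomial 0 (laurentDerivLin _) = _
  rw [laurentDerivLin_T, ← MvPolynomial.smul_monomial]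
  rfl

/-- The evolutionary derivation of `𝒜` with characteristic `a`: it commutes with the total
derivative and sends `u_n` to `a n`. -/
def evolD {N M : ℕ} (a : ℤ → DiffAlg N M) : Derivation ℂ (DiffAlg N M) (DiffAlg N M) :=
  (MvPolynomial.mkDerivation ℂ[T;T⁻¹] fun g : Gen N M =>
      match g with
      | Gen.ell => vPow N M (-M) * a (-M)
      | Gen.low k => (totalD N M)^[k + 1] (a (-M))
      | Gen.jet n k => (totalD N M)^[k] (a n)).restrictScalars ℂ
    + ((1 / (M : ℂ)) • (vPow N M (1 - M) * a (-M))) • derivV N M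

section generators
variable {N M : ℕ} (a : ℤ → DiffAlg N M)

theorem evolD_vPow (j : ℤ) :
    evolD a (vPow N M j) = ((j : ℂ) / M) • (vPow N M (j - M) * a (-M)) := by
  have h0 : ∀ φ : Gen N M → DiffAlg N M,
      MvPolynomial.mkDerivation ℂ[T;T⁻¹] φ (vPow N M j) = 0 := fun φ =>
    MvPolynomial.derivation_C _ _
  have e : vPow N M (j - M) = vPow N M (1 - M) * vPow N M (j - 1) := by
    rw [← vPow_add]; congr 1; ring
  rw [evolD, Derivation.add_apply, Derivation.restrictScalars_apply, h0, zero_add,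
    Derivation.smul_apply, derivV_vPow, e, smul_eq_mul, smul_mul_smul_comm, one_div_mul_eq_div,
    mul_right_comm]

theorem evolD_ell : evolD a (MvPolynomial.X Gen.ell) = vPow N M (-M) * a (-M) := by
  simp [evolD, MvPolynomial.mkDerivation_X]

theorem evolD_low (k : ℕ) :
    evolD a (MvPolynomial.X (Gen.low k)) = (totalD N M)^[k + 1] (a (-M)) := by
  simp [evolD, MvPolynomial.mkDerivation_X]

theorem evolD_jet (n : Set.Ioo (-(M : ℤ)) (N : ℤ)) (k : ℕ) :
    evolD a (MvPolynomial.X (Gen.jet n k)) = (totalD N M)^[k] (a n) := by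
  simp [evolD, MvPolynomial.mkDerivation_X]

theorem totalD_vPow (j : ℤ) : totalD N M (vPow N M j) =
    ((j : ℂ) / M) • (vPow N M (j - M) * MvPolynomial.X (Gen.low 0)) := by
  have h0 : ∀ φ : Gen N M → DiffAlg N M,
      MvPolynomial.mkDerivation ℂ[T;T⁻¹] φ (vPow N M j) = 0 := fun φ =>
    MvPolynomial.derivation_C _ _
  have e : vPow N M (j - M) = vPow N M (1 - M) * vPow N M (j - 1) := by
    rw [← vPow_add]; congr 1; ring
  rw [totalD, Derivation.add_apply, Derivation.restrictScalars_apply, h0, zero_add,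
    Derivation.smul_apply, derivV_vPow, e, smul_eq_mul, smul_mul_smul_comm, one_div_mul_eq_div,
    mul_right_comm]

theorem totalD_ell : totalD N M (MvPolynomial.X Gen.ell) =
    vPow N M (-M) * MvPolynomial.X (Gen.low 0) := by
  simp [totalD, MvPolynomial.mkDerivation_X]

theorem totalD_low (k : ℕ) :
    totalD N M (MvPolynomial.X (Gen.low k)) = MvPolynomial.X (Gen.low (k + 1)) := by
  simp [totalD, MvPolynomial.mkDerivation_X]

theorem totalD_jet (n : Set.Ioo (-(M : ℤ)) (N : ℤ)) (k : ℕ) :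
    totalD N M (MvPolynomial.X (Gen.jet n k)) = MvPolynomial.X (Gen.jet n (k + 1)) := by
  simp [totalD, MvPolynomial.mkDerivation_X]

end generators

/-- Outside the tangent range the `u_n` are the constants 0 and 1, which is why `a` has to vanish
there. -/
theorem evolD_uVar {N M : ℕ} (hM : 1 ≤ M) (a : ℤ → DiffAlg N M)
    (ha : ∀ n ∉ Finset.Ico (-(M : ℤ)) N, a n = 0) (n : ℤ) : evolD a (uVar N M n) = a n := by
  unfold uVar
  split_ifs with h1 h2 h3
  · have : (M : ℂ) ≠ 0 := by exact_mod_cast (by omega : M ≠ 0)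
    rw [evolD_vPow, h1]; simp [this]
  · rw [evolD_jet]; rfl
  · rw [Derivation.map_one_eq_zero, ha]; simp [h3]
  · rw [map_zero, ha]
    simp only [Finset.mem_Ico, Set.mem_Ioo] at *; omega

/-- On jet variables this holds by construction of `evolD`. Only `v` and `log u_{-M}`, whose
`x`-derivatives are products, need the Leibniz rule. -/
theorem totalD_evolD {N M : ℕ} (a : ℤ → DiffAlg N M) (p : DiffAlg N M) :
    totalD N M (evolD a p) = evolD a (totalD N M p) := by
  have : ⁅totalD N M, evolD a⁆ = 0 := by
    apply diffAlg_derivation_ext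
    · simp only [Derivation.commutator_apply, totalD_vPow, evolD_vPow, Derivation.map_smul,
        Derivation.leibniz, evolD_low, Function.iterate_one, Derivation.zero_apply, smul_eq_mul,
        ← smul_sub, zero_add, mul_smul_comm]
      rw [mul_left_comm (a _), mul_left_comm (MvPolynomial.X _), mul_comm (a _)]
      simp
    · intro g
      rw [Derivation.commutator_apply, Derivation.zero_apply]
      cases g with
      | ell =>
        simp only [totalD_ell, evolD_ell, Derivation.leibniz, totalD_vPow, evolD_vPow, evolD_low,
          Function.iterate_one, smul_eq_mul, zero_add, mul_smul_comm]
        rw [mul_left_comm (a _), mul_left_comm (MvPolynomial.X _), mul_comm (a _)]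
        simp
      | low k =>
        rw [evolD_low, totalD_low, evolD_low, ← Function.iterate_succ_apply' (totalD N M), sub_self]
      | jet n k =>
        rw [evolD_jet, totalD_jet, evolD_jet, ← Function.iterate_succ_apply' (totalD N M), sub_self]
  have h := DFunLike.congr_fun this p
  rwa [Derivation.commutator_apply, Derivation.zero_apply, sub_eq_zero] at h

theorem totalD_iterate_evolD {N M : ℕ} (a : ℤ → DiffAlg N M) (k : ℕ) (p : DiffAlg N M) :
    (totalD N M)^[k] (evolD a p) = evolD a ((totalD N M)^[k] p) := by
  induction k generalizing p with
  | zero => rfl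
  | succ k ih => rw [Function.iterate_succ_apply, Function.iterate_succ_apply, totalD_evolD, ih]

theorem totalD_iterate_sub {N M : ℕ} (k : ℕ) (p q : DiffAlg N M) :
    (totalD N M)^[k] (p - q) = (totalD N M)^[k] p - (totalD N M)^[k] q :=
  iterate_map_sub _ _ _ _

/-- Both derivations commute with `∂ₓ`, so the values of the commutator on jets follow from those on
the `u_n`. -/
theorem evolD_commutator {N M : ℕ} (a b : ℤ → DiffAlg N M) :
    ⁅evolD a, evolD b⁆ = evolD (fun n => evolD a (b n) - evolD b (a n)) := by
  apply diffAlg_derivation_ext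
  · simp only [Derivation.commutator_apply, evolD_vPow, Derivation.map_smul,
      Derivation.leibniz, smul_eq_mul, ← smul_sub, mul_smul_comm, mul_sub]
    rw [mul_left_comm (b _), mul_left_comm (a _), mul_comm (a _)]
    congr 1; abel
  · intro g
    rw [Derivation.commutator_apply]
    cases g with
    | ell =>
      simp only [evolD_ell, Derivation.leibniz, evolD_vPow, smul_eq_mul, mul_smul_comm, mul_sub]
      rw [mul_left_comm (b _), mul_left_comm (a _), mul_comm (a _)]
      abel
    | low k =>
      simp only [evolD_low, totalD_iterate_sub, totalD_iterate_evolD]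
    | jet n k =>
      simp only [evolD_jet, totalD_iterate_sub, totalD_iterate_evolD]

theorem partialU_bound {N M : ℕ} (p : DiffAlg N M) :
    ∃ K : ℕ, ∀ n, ∀ k ≥ K, partialU N M n k p = 0 := by
  induction p using MvPolynomial.induction_on with
  | C a =>
    -- A Laurent polynomial in `v` is seen only by the zeroth-order derivative with respect to
    -- `u_{-M}`.
    refine ⟨1, fun n k hk => ?_⟩
    obtain ⟨k, rfl⟩ : ∃ j, k = j + 1 := ⟨k - 1, by omega⟩
    unfold partialU
    split_ifs <;> simp
  | add p q hp hq =>
    obtain ⟨K, hK⟩ := hp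
    obtain ⟨K', hK'⟩ := hq
    refine ⟨max K K', fun n k hk => ?_⟩
    rw [map_add, hK n k (le_trans (le_max_left _ _) hk),
      hK' n k (le_trans (le_max_right _ _) hk), add_zero]
  | mul_X p g hp =>
    obtain ⟨K, hK⟩ := hp
    obtain ⟨K', hK'⟩ : ∃ K' : ℕ, ∀ n, ∀ k ≥ K', partialU N M n k (MvPolynomial.X g) = 0 := by
      have : ∃ K' : ℕ, ∀ k ≥ K', g ≠ Gen.low k ∧ ∀ n, g ≠ Gen.jet n k := by
        cases g with
        | ell => exact ⟨0, by simp⟩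
        | low j =>
          refine ⟨j + 1, fun k hk => ⟨fun h => ?_, by simp⟩⟩
          simp only [Gen.low.injEq] at h; omega
        | jet m j =>
          refine ⟨j + 1, fun k hk => ⟨by simp, fun n h => ?_⟩⟩
          simp only [Gen.jet.injEq] at h; omega
      obtain ⟨K', hK'⟩ := this
      -- The generator `low k` stands for the derivative of order `k + 1`, which costs one more
      -- order in the bound.
      refine ⟨K' + 1, fun n k hk => ?_⟩
      obtain ⟨k, rfl⟩ : ∃ j, k = j + 1 := ⟨k - 1, by omega⟩
      unfold partialU
      split_ifs
      · simp only [Derivation.restrictScalars_apply]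
        exact MvPolynomial.pderiv_X_of_ne (hK' k (by omega)).1
      · simp only [Derivation.restrictScalars_apply]
        exact MvPolynomial.pderiv_X_of_ne ((hK' (k + 1) (by omega)).2 _)
      · rfl
    refine ⟨max K K', fun n k hk => ?_⟩
    rw [Derivation.leibniz, hK n k (le_trans (le_max_left _ _) hk),
      hK' n k (le_trans (le_max_right _ _) hk)]
    simp

theorem partialU_support_finite {N M : ℕ} (n : ℤ) (p : DiffAlg N M) (w : ℕ → DiffAlg N M) :
    (Function.support fun k => partialU N M n k p * w k).Finite := by
  obtain ⟨K, hK⟩ := partialU_bound p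
  refine (Set.finite_lt_nat K).subset fun k hk => ?_
  by_contra h
  exact hk (by simp [hK n k (not_lt.1 h)])

theorem finsum_partialU_eq_sum {N M : ℕ} {p : DiffAlg N M} {K : ℕ} {n : ℤ}
    (hK : ∀ k ≥ K, partialU N M n k p = 0) (w : ℕ → DiffAlg N M) :
    ∑ᶠ k, partialU N M n k p * w k = ∑ k ∈ Finset.range K, partialU N M n k p * w k := by
  refine finsum_eq_sum_of_support_subset _ fun k hk => ?_
  simp only [Finset.coe_range, Set.mem_Iio]
  by_contra h
  exact hk (by simp [hK k (not_lt.1 h)])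

end BigradedToda

/-! ### Partial derivatives and integration by parts in the differential algebra. -/

namespace BigradedToda

theorem partialU_low {N M : ℕ} (k : ℕ) : partialU N M (-(M : ℤ)) (k + 1) =
    (MvPolynomial.pderiv (Gen.low k)).restrictScalars ℂ := by
  simp [partialU]

theorem partialU_low_zero {N M : ℕ} : partialU N M (-(M : ℤ)) 0 =
    ((1 / (M : ℂ)) • vPow N M (1 - M)) • derivV N M
        + vPow N M (-M) • (MvPolynomial.pderiv Gen.ell).restrictScalars ℂ := by
  simp [partialU]

theorem partialU_jet {N M : ℕ} (n : Set.Ioo (-(M : ℤ)) (N : ℤ)) (k : ℕ) :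
    partialU N M n k = (MvPolynomial.pderiv (Gen.jet n k)).restrictScalars ℂ := by
  have h1 : (n : ℤ) ≠ -(M : ℤ) := n.2.1.ne'
  simp only [partialU, h1, if_false]
  rw [dif_pos n.2]

theorem eq_or_mem_Ioo {N M : ℕ} {n : ℤ} (hn : n ∈ Finset.Ico (-(M : ℤ)) N) :
    n = -(M : ℤ) ∨ ∃ m : Set.Ioo (-(M : ℤ)) (N : ℤ), n = m := by
  rw [Finset.mem_Ico] at hn
  by_cases h : n = -(M : ℤ)
  · exact Or.inl h
  · exact Or.inr ⟨⟨n, by omega, hn.2⟩, rfl⟩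

theorem partialU_ell_eq_zero {N M : ℕ} {n : ℤ} (hn : n ∈ Finset.Ico (-(M : ℤ)) N) {k : ℕ}
    (h : ¬ (n = -(M : ℤ) ∧ k = 0)) :
    partialU N M n k (MvPolynomial.X Gen.ell) = 0 := by
  rcases eq_or_mem_Ioo hn with rfl | ⟨m, rfl⟩
  · obtain _ | k := k
    · simp at h
    · rw [partialU_low]
      exact MvPolynomial.pderiv_X_of_ne (by simp)
  · rw [partialU_jet]
    exact MvPolynomial.pderiv_X_of_ne (by simp)

theorem partialU_C_eq_zero {N M : ℕ} {n : ℤ} (hn : n ∈ Finset.Ico (-(M : ℤ)) N) {k : ℕ}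
    (h : ¬ (n = -(M : ℤ) ∧ k = 0)) (c : ℂ[T;T⁻¹]) :
    partialU N M n k (MvPolynomial.C c) = 0 := by
  rcases eq_or_mem_Ioo hn with rfl | ⟨m, rfl⟩
  · obtain _ | k := k
    · simp at h
    · rw [partialU_low]
      exact MvPolynomial.derivation_C _ _
  · rw [partialU_jet]
    exact MvPolynomial.derivation_C _ _

theorem partialU_X_low_eq_zero {N M : ℕ} {n : ℤ} (hn : n ∈ Finset.Ico (-(M : ℤ)) N) {k j : ℕ}
    (h : ¬ (n = -(M : ℤ) ∧ k = j + 1)) :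
    partialU N M n k (MvPolynomial.X (Gen.low j)) = 0 := by
  rcases eq_or_mem_Ioo hn with rfl | ⟨m, rfl⟩
  · obtain _ | k := k
    · rw [partialU_low_zero, Derivation.add_apply, Derivation.smul_apply, derivV_X, smul_zero,
        zero_add, Derivation.smul_apply, Derivation.restrictScalars_apply,
        MvPolynomial.pderiv_X_of_ne (by simp), smul_zero]
    · rw [partialU_low]
      exact MvPolynomial.pderiv_X_of_ne (by
        intro h'; simp only [Gen.low.injEq] at h'; simp [h'] at h)
  · rw [partialU_jet]
    exact MvPolynomial.pderiv_X_of_ne (by simp)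

theorem partialU_X_jet_eq_zero {N M : ℕ} {n : ℤ} (hn : n ∈ Finset.Ico (-(M : ℤ)) N) {k j : ℕ}
    {m : Set.Ioo (-(M : ℤ)) (N : ℤ)} (h : ¬ (n = m ∧ k = j)) :
    partialU N M n k (MvPolynomial.X (Gen.jet m j)) = 0 := by
  rcases eq_or_mem_Ioo hn with rfl | ⟨m', rfl⟩
  · obtain _ | k := k
    · rw [partialU_low_zero, Derivation.add_apply, Derivation.smul_apply, derivV_X, smul_zero,
        zero_add, Derivation.smul_apply, Derivation.restrictScalars_apply,
        MvPolynomial.pderiv_X_of_ne (by simp), smul_zero]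
    · rw [partialU_low]
      exact MvPolynomial.pderiv_X_of_ne (by simp)
  · rw [partialU_jet]
    exact MvPolynomial.pderiv_X_of_ne (by
      intro h'; simp only [Gen.jet.injEq] at h'; simp [h'] at h)

theorem sum_partialU_single {N M : ℕ} (p : DiffAlg N M) (a : ℤ → DiffAlg N M) {n₀ : ℤ} {k₀ : ℕ}
    (hn₀ : n₀ ∈ Finset.Ico (-(M : ℤ)) N)
    (h : ∀ n ∈ Finset.Ico (-(M : ℤ)) N, ∀ k, ¬ (n = n₀ ∧ k = k₀) → partialU N M n k p = 0) :
    ∑ n ∈ Finset.Ico (-(M : ℤ)) N, ∑ᶠ k : ℕ, partialU N M n k p * (totalD N M)^[k] (a n) =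
      partialU N M n₀ k₀ p * (totalD N M)^[k₀] (a n₀) := by
  rw [Finset.sum_eq_single_of_mem n₀ hn₀, finsum_eq_single _ k₀]
  · intro k hk
    rw [h n₀ hn₀ k (by simp [hk]), zero_mul]
  · intro n hn hne
    rw [finsum_eq_zero_of_forall_eq_zero]
    intro k
    rw [h n hn k (by simp [hne]), zero_mul]

/-- Both sides are derivations in `p`, and each generator is seen by a single partial derivative.
The coordinate definition of the directional derivative is thereby replaced by one whose commutation
with `∂ₓ` is known. -/
theorem sum_partialU_eq_evolD {N M : ℕ} (hM : 1 ≤ M) (a : ℤ → DiffAlg N M) (p : DiffAlg N M) :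
    ∑ n ∈ Finset.Ico (-(M : ℤ)) N, ∑ᶠ k : ℕ, partialU N M n k p * (totalD N M)^[k] (a n) =
      evolD a p := by
  have hlow : -(M : ℤ) ∈ Finset.Ico (-(M : ℤ)) N := by simp only [Finset.mem_Ico]; omega
  induction p using MvPolynomial.induction_on with
  | C c =>
    rw [sum_partialU_single _ _ hlow fun n hn k h => partialU_C_eq_zero hn h c, partialU_low_zero,
      evolD]
    simp only [Derivation.add_apply, Derivation.smul_apply, Derivation.restrictScalars_apply,
      MvPolynomial.derivation_C, smul_zero, add_zero, zero_add, Function.iterate_zero, id]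
    rw [smul_eq_mul, smul_eq_mul, ← smul_mul_assoc, mul_right_comm]
  | add p q hp hq =>
    rw [map_add, ← hp, ← hq, ← Finset.sum_add_distrib]
    refine Finset.sum_congr rfl fun n _ => ?_
    rw [← finsum_add_distrib (partialU_support_finite _ _ _) (partialU_support_finite _ _ _)]
    refine finsum_congr fun k => ?_
    rw [map_add, add_mul]
  | mul_X p g hp =>
    have hg : ∑ n ∈ Finset.Ico (-(M : ℤ)) N,
        ∑ᶠ k : ℕ, partialU N M n k (MvPolynomial.X g) * (totalD N M)^[k] (a n) =
        evolD a (MvPolynomial.X g) := by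
      cases g with
      | ell =>
        rw [sum_partialU_single _ _ hlow fun n hn k h => partialU_ell_eq_zero hn h,
          partialU_low_zero, evolD_ell, Derivation.add_apply, Derivation.smul_apply, derivV_X,
          smul_zero, zero_add, Derivation.smul_apply, Derivation.restrictScalars_apply,
          MvPolynomial.pderiv_X_self, smul_eq_mul, mul_one]
        rfl
      | low j =>
        rw [sum_partialU_single _ _ hlow fun n hn k h => partialU_X_low_eq_zero hn h,
          partialU_low, evolD_low, Derivation.restrictScalars_apply,
          MvPolynomial.pderiv_X_self, one_mul]
      | jet m j =>
        have hm : (m : ℤ) ∈ Finset.Ico (-(M : ℤ)) N := Finset.mem_Ico.2 ⟨m.2.1.le, m.2.2⟩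
        rw [sum_partialU_single _ _ hm fun n hn k h => partialU_X_jet_eq_zero hn h,
          partialU_jet, evolD_jet, Derivation.restrictScalars_apply,
          MvPolynomial.pderiv_X_self, one_mul]
    rw [Derivation.leibniz, ← hp, ← hg, smul_eq_mul, smul_eq_mul, Finset.mul_sum, Finset.mul_sum,
      ← Finset.sum_add_distrib]
    refine Finset.sum_congr rfl fun n _ => ?_
    rw [mul_finsum' _ _ (partialU_support_finite _ _ _),
      mul_finsum' _ _ (partialU_support_finite _ _ _), ← finsum_add_distrib]
    · refine finsum_congr fun k => ?_
      rw [Derivation.leibniz, smul_eq_mul, smul_eq_mul]; ring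
    · exact (partialU_support_finite n (MvPolynomial.X g) fun k =>
        (totalD N M)^[k] (a n)).subset (Function.support_mul_subset_right _ _)
    · exact (partialU_support_finite n p fun k =>
        (totalD N M)^[k] (a n)).subset (Function.support_mul_subset_right _ _)

/-- The image of the total derivative on `𝒜`. -/
def totalDRange (N M : ℕ) : Submodule ℂ (DiffAlg N M) :=
  LinearMap.range (totalD N M).toLinearMap

theorem totalD_mem_range {N M : ℕ} (p : DiffAlg N M) : totalD N M p ∈ totalDRange N M :=
  ⟨p, rfl⟩

/-- Integration by parts, moving one `∂ₓ` at a time. -/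
theorem mul_iterate_sub_mem_range {N M : ℕ} (k : ℕ) (p q : DiffAlg N M) :
    p * (totalD N M)^[k] q - ((-1 : ℂ) ^ k • (totalD N M)^[k] p) * q ∈ totalDRange N M := by
  induction k generalizing p q with
  | zero => simp
  | succ k ih =>
    have h1 := ih p (totalD N M q)
    have h2 := (totalDRange N M).smul_mem ((-1 : ℂ) ^ k)
      (totalD_mem_range ((totalD N M)^[k] p * q))
    rw [Derivation.leibniz] at h2
    have h3 := Submodule.add_mem _ h1 h2
    convert h3 using 1
    rw [Function.iterate_succ_apply, Function.iterate_succ_apply' (totalD N M) k p]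
    rw [pow_succ, mul_neg_one]
    generalize (-1 : ℂ) ^ k = c
    simp only [smul_eq_mul, Algebra.smul_def, map_neg]
    ring

/-- `∂ₓ` raises the order of a jet by one. This controls the highest jet occurring in a total
derivative. -/
theorem pderiv_totalD_jet {N M : ℕ} (n : Set.Ioo (-(M : ℤ)) (N : ℤ)) (k : ℕ) (p : DiffAlg N M) :
    MvPolynomial.pderiv (Gen.jet n (k + 1)) (totalD N M p) =
      totalD N M (MvPolynomial.pderiv (Gen.jet n (k + 1)) p)
        + MvPolynomial.pderiv (Gen.jet n k) p := by
  classical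
  have hv : ∀ g : Gen N M, ∀ j, MvPolynomial.pderiv (R := ℂ[T;T⁻¹]) g (vPow N M j) = 0 := fun g j =>
    MvPolynomial.derivation_C _ _
  have h : ⁅(MvPolynomial.pderiv (R := ℂ[T;T⁻¹]) (Gen.jet n (k + 1))).restrictScalars ℂ,
      totalD N M⁆ =
      (MvPolynomial.pderiv (Gen.jet n k)).restrictScalars ℂ := by
    apply diffAlg_derivation_ext
    · simp only [Derivation.commutator_apply, Derivation.restrictScalars_apply, hv, map_zero,
        sub_zero, totalD_vPow, Derivation.map_smul_of_tower, Derivation.leibniz]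
      rw [MvPolynomial.pderiv_X_of_ne (by simp)]; simp
    · intro g
      simp only [Derivation.commutator_apply, Derivation.restrictScalars_apply]
      cases g with
      | ell =>
        rw [totalD_ell, Derivation.leibniz, hv, MvPolynomial.pderiv_X_of_ne (by simp),
          MvPolynomial.pderiv_X_of_ne (by simp), MvPolynomial.pderiv_X_of_ne (by simp)]
        simp
      | low j =>
        rw [totalD_low, MvPolynomial.pderiv_X_of_ne (by simp),
          MvPolynomial.pderiv_X_of_ne (by simp), MvPolynomial.pderiv_X_of_ne (by simp)]
        simp
      | jet m j =>
        have h1 : ∀ (i : Gen N M) j, totalD N M (MvPolynomial.pderiv i (MvPolynomial.X j)) = 0 := by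
          intro i j
          rw [MvPolynomial.pderiv_X, Pi.single_apply]
          split_ifs
          · exact Derivation.map_one_eq_zero _
          · exact map_zero _
        rw [totalD_jet, h1, sub_zero]
        simp only [MvPolynomial.pderiv_X, Pi.single_apply, Gen.jet.injEq, add_left_inj]
  have h' := DFunLike.congr_fun h p
  simp only [Derivation.commutator_apply, Derivation.restrictScalars_apply] at h'
  rw [← h']; ring

/-- A total derivative is affine in its highest jet, so `w x²` cannot be one when `x` is a jet of
order higher than those in `w`, unless `w = 0`. This is the nondegeneracy of the pairing behind the
uniqueness of differentials. -/
theorem eq_zero_of_forall_mul_mem_range {N M : ℕ} (hN : 1 ≤ N) (hM : 1 ≤ M) (w : DiffAlg N M)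
    (hw : ∀ v, w * v ∈ totalDRange N M) : w = 0 := by
  -- The index 0 lies strictly between `-M` and `N`, so the jets of `u_0` are polynomial generators.
  let n : Set.Ioo (-(M : ℤ)) (N : ℤ) := ⟨0, by simp only [Set.mem_Ioo]; omega⟩
  have hb : ∀ p : DiffAlg N M, ∃ K, ∀ k ≥ K, MvPolynomial.pderiv (Gen.jet n k) p = 0 := by
    intro p
    obtain ⟨K, hK⟩ := partialU_bound p
    refine ⟨K, fun k hk => ?_⟩
    have := hK n k hk
    rwa [partialU_jet] at this
  obtain ⟨K, hK⟩ := hb w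
  set x : DiffAlg N M := MvPolynomial.X (Gen.jet n (K + 1)) with hx
  obtain ⟨h, hh : totalD N M h = _⟩ := hw (x ^ 2)
  have hxk : ∀ k ≥ K + 1, MvPolynomial.pderiv (Gen.jet n (k + 1)) x = 0 := fun k hk =>
    MvPolynomial.pderiv_X_of_ne (by
      intro h'; simp only [Gen.jet.injEq, true_and] at h'; omega)
  have hstep : ∀ k ≥ K + 1, MvPolynomial.pderiv (Gen.jet n (k + 1)) h = 0 →
      MvPolynomial.pderiv (Gen.jet n k) h = 0 := by
    intro k hk h0
    have := pderiv_totalD_jet n k h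
    rw [hh, h0, map_zero, zero_add, Derivation.leibniz, Derivation.leibniz_pow, hxk k hk,
      hK (k + 1) (by omega)] at this
    simpa using this.symm
  obtain ⟨K', hK'⟩ := hb h
  -- Descent from the top jet of `h`: a primitive `h` of `w x²` contains no jet of `u_0` of order `K
  -- + 1` or higher.
  have hall : ∀ j, ∀ k ≥ K + 1, k + j ≥ K' → MvPolynomial.pderiv (Gen.jet n k) h = 0 := by
    intro j
    induction j with
    | zero => exact fun k _ hk => hK' k hk
    | succ j ih => exact fun k hk hk' => hstep k hk (ih (k + 1) (by omega) (by omega))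
  have h1 : MvPolynomial.pderiv (Gen.jet n (K + 1)) h = 0 := hall K' (K + 1) le_rfl (by omega)
  have h2 := pderiv_totalD_jet n K h
  rw [hh, h1, map_zero, zero_add, Derivation.leibniz, Derivation.leibniz_pow,
    hK (K + 1) (by omega), hx, MvPolynomial.pderiv_X_self] at h2
  -- `h2` says that `∂h/∂u_0^{(K)} = 2 w x`; one more derivative in `x` gives `2 w` on one side, and
  -- zero on the other since `h` does not contain `x`.
  have h3 := congrArg (MvPolynomial.pderiv (Gen.jet n (K + 1))) h2
  have hcomm : MvPolynomial.pderiv (Gen.jet n (K + 1)) (MvPolynomial.pderiv (Gen.jet n K) h) =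
      MvPolynomial.pderiv (Gen.jet n K) (MvPolynomial.pderiv (Gen.jet n (K + 1)) h) := by
    have : ⁅MvPolynomial.pderiv (R := ℂ[T;T⁻¹]) (Gen.jet n (K + 1)),
        MvPolynomial.pderiv (R := ℂ[T;T⁻¹]) (Gen.jet n K)⁆ = 0 := by
      classical
      refine MvPolynomial.derivation_ext fun i => ?_
      have hh : ∀ (i : Gen N M) j j', MvPolynomial.pderiv (R := ℂ[T;T⁻¹]) i
          (MvPolynomial.pderiv j (MvPolynomial.X j')) = 0 := by
        intro i j j'
        rw [MvPolynomial.pderiv_X, Pi.single_apply]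
        split_ifs
        · exact Derivation.map_one_eq_zero _
        · exact map_zero _
      rw [Derivation.commutator_apply, hh, hh, sub_zero, Derivation.zero_apply]
    have := DFunLike.congr_fun this h
    rwa [Derivation.commutator_apply, Derivation.zero_apply, sub_eq_zero] at this
  rw [hcomm, h1, map_zero] at h3
  simp only [smul_eq_mul, mul_zero, add_zero, Nat.add_one_sub_one, pow_one, mul_one] at h3
  rw [Derivation.leibniz, hK (K + 1) (by omega), map_nsmul, MvPolynomial.pderiv_X_self] at h3
  have h4 : (2 : ℂ) • w = 0 := by
    rw [two_smul]
    simpa only [mul_zero, add_zero, smul_eq_mul, mul_one, two_nsmul, mul_add] using h3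
  simpa using h4

end BigradedToda

/-! ### Linear operators over constants on the completed algebra. -/

namespace BigradedToda

open PowerSeries Finset.HasAntidiagonal

theorem coeff_smul_hat {N M : ℕ} (c : ℂ⟦X⟧) (f : Hat N M) (j : ℕ) :
    coeff j (c • f) = ∑ p ∈ antidiagonal j, coeff p.1 c • coeff p.2 f := by
  simp only [Algebra.smul_def, PowerSeries.algebraMap_apply'', PowerSeries.coeff_mul,
    PowerSeries.coeff_map]

theorem coeff_hatD {N M : ℕ} (f : Hat N M) (j : ℕ) :
    coeff j (hatD N M f) = totalD N M (coeff j f) := by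
  simp [hatD]

/-- The `ℂ⟦ε⟧`-linear extension to `𝒜⟦ε⟧` of the map `∑_k ε^k θ_k` from `𝒜` to `𝒜⟦ε⟧`. -/
def extLin {N M : ℕ} (θ : ℕ → DiffAlg N M →ₗ[ℂ] DiffAlg N M) : Hat N M →ₗ[ℂ⟦X⟧] Hat N M where
  toFun f := PowerSeries.mk fun j => ∑ p ∈ antidiagonal j, θ p.1 (coeff p.2 f)
  map_add' f g := by ext1 j; simp [Finset.sum_add_distrib]
  map_smul' c f := by
    ext1 j
    simp only [coeff_mk, RingHom.id_apply, coeff_smul_hat, map_sum, map_smul, Finset.smul_sum]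
    rw [Finset.sum_sigma', Finset.sum_sigma']
    -- Both double sums run over triples with total `j`; the bijection exchanges the order in which
    -- the index of `θ` and that of `c` are split off.
    refine Finset.sum_nbij' (fun x => ⟨(x.2.1, x.1.1 + x.2.2), (x.1.1, x.2.2)⟩)
      (fun x => ⟨(x.2.1, x.1.1 + x.2.2), (x.1.1, x.2.2)⟩) ?_ ?_ ?_ ?_ ?_
    · rintro ⟨⟨a, s⟩, ⟨b, d⟩⟩ h
      simp only [Finset.mem_sigma, mem_antidiagonal] at h
      obtain ⟨h1, h2⟩ := h
      exact Finset.mem_sigma.2 ⟨mem_antidiagonal.2 (by dsimp only; omega),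
        mem_antidiagonal.2 rfl⟩
    · rintro ⟨⟨a, s⟩, ⟨b, d⟩⟩ h
      simp only [Finset.mem_sigma, mem_antidiagonal] at h
      obtain ⟨h1, h2⟩ := h
      exact Finset.mem_sigma.2 ⟨mem_antidiagonal.2 (by dsimp only; omega),
        mem_antidiagonal.2 rfl⟩
    · rintro ⟨⟨a, s⟩, ⟨b, d⟩⟩ h
      simp only [Finset.mem_sigma, mem_antidiagonal] at h ⊢
      simp [h.2]
    · rintro ⟨⟨a, s⟩, ⟨b, d⟩⟩ h
      simp only [Finset.mem_sigma, mem_antidiagonal] at h ⊢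
      simp [h.2]
    · rintro ⟨⟨a, s⟩, ⟨b, d⟩⟩ h
      rfl

theorem coeff_extLin {N M : ℕ} (θ : ℕ → DiffAlg N M →ₗ[ℂ] DiffAlg N M) (f : Hat N M) (j : ℕ) :
    coeff j (extLin θ f) = ∑ p ∈ antidiagonal j, θ p.1 (coeff p.2 f) := by
  simp [extLin]

theorem coeff_extLin_C {N M : ℕ} (θ : ℕ → DiffAlg N M →ₗ[ℂ] DiffAlg N M) (p : DiffAlg N M)
    (j : ℕ) : coeff j (extLin θ (C p)) = θ j p := by
  rw [coeff_extLin, Finset.sum_eq_single (j, 0)]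
  · simp
  · rintro ⟨a, b⟩ hab hne
    rw [coeff_C, if_neg, map_zero]
    rintro rfl
    simp only [mem_antidiagonal, add_zero] at hab
    exact hne (by simp [hab])
  · simp

theorem coeff_X_smul {N M : ℕ} (f : Hat N M) (j : ℕ) :
    coeff (j + 1) ((X : ℂ⟦X⟧) • f) = coeff j f := by
  rw [Algebra.smul_def, PowerSeries.algebraMap_apply'', map_X, coeff_succ_X_mul]

theorem coeff_zero_X_smul {N M : ℕ} (f : Hat N M) : coeff 0 ((X : ℂ⟦X⟧) • f) = 0 := by
  rw [Algebra.smul_def, PowerSeries.algebraMap_apply'', map_X, coeff_zero_X_mul]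

/-- A `ℂ⟦ε⟧`-linear endomorphism of `𝒜⟦ε⟧` is determined by its restriction to `𝒜`. -/
theorem hat_linearMap_ext {N M : ℕ} {Φ Ψ : Hat N M →ₗ[ℂ⟦X⟧] Hat N M}
    (h : ∀ p, Φ (C p) = Ψ (C p)) : Φ = Ψ := by
  have key : ∀ j, ∀ f, coeff j (Φ f) = coeff j (Ψ f) := by
    intro j
    induction j with
    | zero =>
      intro f
      -- Splitting off the constant term makes linearity over `ℂ⟦ε⟧` do the work of continuity: the
      -- remainder carries a factor `ε`, which lowers the order of the coefficient to be compared.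
      have e : f = (X : ℂ⟦X⟧) • (mk fun p => coeff (p + 1) f) + C (constantCoeff f) := by
        rw [Algebra.smul_def, PowerSeries.algebraMap_apply'', map_X]
        exact eq_X_mul_shift_add_const f
      rw [e, Φ.map_add, Ψ.map_add, Φ.map_smul, Ψ.map_smul, h, map_add, map_add, coeff_zero_X_smul,
        coeff_zero_X_smul]
    | succ j ih =>
      intro f
      have e : f = (X : ℂ⟦X⟧) • (mk fun p => coeff (p + 1) f) + C (constantCoeff f) := by
        rw [Algebra.smul_def, PowerSeries.algebraMap_apply'', map_X]
        exact eq_X_mul_shift_add_const f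
      rw [e, Φ.map_add, Ψ.map_add, Φ.map_smul, Ψ.map_smul, h, map_add, map_add, coeff_X_smul,
        coeff_X_smul, ih]
  exact LinearMap.ext fun f => PowerSeries.ext fun j => key j f

theorem extLin_extLin {N M : ℕ} (θ η : ℕ → DiffAlg N M →ₗ[ℂ] DiffAlg N M) (f : Hat N M) :
    extLin θ (extLin η f) =
      extLin (fun j => ∑ p ∈ antidiagonal j, θ p.1 ∘ₗ η p.2) f := by
  refine DFunLike.congr_fun (f := extLin θ ∘ₗ extLin η) (hat_linearMap_ext fun p => ?_) f
  ext1 j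
  rw [LinearMap.comp_apply, coeff_extLin_C, coeff_extLin, LinearMap.sum_apply]
  simp only [coeff_extLin_C, LinearMap.comp_apply]

theorem extLin_comm {N M : ℕ} {θ η : ℕ → DiffAlg N M →ₗ[ℂ] DiffAlg N M}
    (h : ∀ a b p, θ a (η b p) = η b (θ a p)) (f : Hat N M) :
    extLin θ (extLin η f) = extLin η (extLin θ f) := by
  rw [extLin_extLin, extLin_extLin]
  congr 2
  funext j
  rw [← Finset.Nat.sum_antidiagonal_swap]
  exact Finset.sum_congr rfl fun p _ => LinearMap.ext fun q => h _ _ _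

theorem hatD_eq_extLin {N M : ℕ} :
    hatD N M = extLin fun k => if k = 0 then (totalD N M).toLinearMap else 0 := by
  refine hat_linearMap_ext fun p => ?_
  ext1 j
  rw [coeff_extLin_C, coeff_hatD, coeff_C]
  split_ifs <;> simp

/-! ### Operators with constant symbol -/

/-- `applySymbol φ` as a linear map. -/
def symbolLin {N M : ℕ} (φ : ℂ⟦X⟧) : Hat N M →ₗ[ℂ⟦X⟧] Hat N M :=
  extLin fun k => coeff k φ • (totalD N M).toLinearMap ^ k

theorem applySymbol_eq {N M : ℕ} (φ : ℂ⟦X⟧) (f : Hat N M) : applySymbol φ f = symbolLin φ f := by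
  ext1 j
  rw [symbolLin, coeff_extLin, applySymbol, coeff_mk]
  refine Finset.sum_congr rfl fun p _ => ?_
  rw [LinearMap.smul_apply, Module.End.pow_apply]
  rfl

theorem symbolLin_mul {N M : ℕ} (φ ψ : ℂ⟦X⟧) (f : Hat N M) :
    symbolLin (φ * ψ) f = symbolLin φ (symbolLin ψ f) := by
  rw [symbolLin, symbolLin, symbolLin, extLin_extLin]
  congr 2
  funext j
  rw [coeff_mul, Finset.sum_smul]
  refine Finset.sum_congr rfl fun p hp => ?_
  rw [LinearMap.smul_comp, LinearMap.comp_smul, smul_smul, ← Module.End.mul_eq_comp, ← pow_add,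
    mem_antidiagonal.1 hp]

theorem symbolLin_add {N M : ℕ} (φ ψ : ℂ⟦X⟧) (f : Hat N M) :
    symbolLin (φ + ψ) f = symbolLin φ f + symbolLin ψ f := by
  ext1 j
  simp [symbolLin, coeff_extLin, add_smul, Finset.sum_add_distrib]

theorem symbolLin_sub {N M : ℕ} (φ ψ : ℂ⟦X⟧) (f : Hat N M) :
    symbolLin (φ - ψ) f = symbolLin φ f - symbolLin ψ f := by
  rw [eq_sub_iff_add_eq, ← symbolLin_add, sub_add_cancel]

theorem symbolLin_one {N M : ℕ} (f : Hat N M) : symbolLin 1 f = f := by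
  refine DFunLike.congr_fun (g := LinearMap.id) (hat_linearMap_ext fun p => ?_) f
  ext1 j
  rw [symbolLin, coeff_extLin_C, coeff_one, LinearMap.id_apply, coeff_C]
  split_ifs with h
  · simp [h]
  · simp

theorem symbolLin_X {N M : ℕ} (f : Hat N M) : symbolLin X f = (X : ℂ⟦X⟧) • hatD N M f := by
  refine DFunLike.congr_fun (g := (X : ℂ⟦X⟧) • hatD N M) (hat_linearMap_ext fun p => ?_) f
  ext1 j
  rw [symbolLin, coeff_extLin_C]
  change _ = coeff j ((X : ℂ⟦X⟧) • hatD N M (C p))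
  obtain _ | j := j
  · rw [coeff_zero_X_smul]; simp
  · rw [coeff_X_smul, coeff_hatD, coeff_C, coeff_X]
    obtain _ | j := j <;> simp

theorem expSymbol_zero : expSymbol 0 = 1 := by simp [expSymbol]

theorem expSymbol_add (m n : ℤ) : expSymbol (m + n) = expSymbol m * expSymbol n := by
  rw [expSymbol, expSymbol, expSymbol, exp_mul_exp_eq_exp_add]; push_cast; rfl

/-- `Λ^m` as a linear map. -/
def shiftLin {N M : ℕ} (m : ℤ) : Hat N M →ₗ[ℂ⟦X⟧] Hat N M := symbolLin (expSymbol m)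

theorem shift_eq {N M : ℕ} (m : ℤ) (f : Hat N M) : shift m f = shiftLin m f := applySymbol_eq _ _

theorem shift_zero {N M : ℕ} (f : Hat N M) : shift 0 f = f := by
  rw [shift_eq, shiftLin, expSymbol_zero, symbolLin_one]

theorem shift_shift {N M : ℕ} (m n : ℤ) (f : Hat N M) : shift m (shift n f) = shift (m + n) f := by
  rw [shift_eq, shift_eq, shift_eq, shiftLin, shiftLin, shiftLin, expSymbol_add, symbolLin_mul]

theorem shift_map_add {N M : ℕ} (m : ℤ) (f g : Hat N M) :
    shift m (f + g) = shift m f + shift m g := by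
  simp only [shift_eq, map_add]

theorem shift_map_zero {N M : ℕ} (m : ℤ) : shift m (0 : Hat N M) = 0 := by
  simp only [shift_eq, map_zero]

theorem shift_smul {N M : ℕ} (m : ℤ) (c : ℂ⟦X⟧) (f : Hat N M) :
    shift m (c • f) = c • shift m f := by
  simp only [shift_eq, map_smul]

theorem shift_map_sum {N M : ℕ} {ι : Type*} (m : ℤ) (s : Finset ι) (f : ι → Hat N M) :
    shift m (∑ i ∈ s, f i) = ∑ i ∈ s, shift m (f i) := by
  simp only [shift_eq, map_sum]

theorem derivation_iterate_mul {A : Type*} [CommRing A] [Algebra ℂ A] (D : Derivation ℂ A A)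
    (n : ℕ) (p q : A) : D^[n] (p * q) =
      ∑ ij ∈ antidiagonal n, n.choose ij.1 • (D^[ij.1] p * D^[ij.2] q) := by
  induction n with
  | zero => simp
  | succ n ih =>
    rw [Finset.sum_antidiagonal_choose_succ_nsmul (M := A) (fun i j => D^[i] p * D^[j] q) n]
    simp only [Function.iterate_succ_apply', ih, map_sum, map_nsmul, Derivation.leibniz, smul_add,
      smul_eq_mul, Finset.sum_add_distrib]
    congr 1
    refine Finset.sum_congr rfl fun ij hij => ?_
    rw [n.choose_symm_of_eq_add (mem_antidiagonal.1 hij).symm, mul_comm]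

theorem coeff_expSymbol (m : ℤ) (k : ℕ) :
    coeff k (expSymbol m) = (m : ℂ) ^ k * (1 / (k.factorial : ℂ)) := by
  simp [expSymbol, coeff_rescale, coeff_exp]

/-- The exponential of a derivation is multiplicative: in the Leibniz rule for `∂ₓ^n` the binomial
coefficient divided by `n!` is `1/(i! j!)`. -/
theorem shift_C_mul_C {N M : ℕ} (m : ℤ) (p q : DiffAlg N M) :
    shift m (C p * C q : Hat N M) = shift m (C p) * shift m (C q) := by
  ext1 j
  rw [← map_mul, shift_eq, shift_eq, shift_eq, coeff_mul]
  simp only [shiftLin, symbolLin, coeff_extLin_C, LinearMap.smul_apply, Module.End.pow_apply,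
    Derivation.coeFn_coe, coeff_expSymbol]
  rw [derivation_iterate_mul, Finset.smul_sum]
  refine Finset.sum_congr rfl fun ij hij => ?_
  rw [smul_mul_smul_comm, ← Nat.cast_smul_eq_nsmul ℂ, smul_smul]
  congr 1
  rw [← mem_antidiagonal.1 hij, pow_add,
    Nat.choose_symm_add, Nat.add_choose,
    Nat.cast_div (Nat.factorial_mul_factorial_dvd_factorial_add _ _)
      (by exact_mod_cast mul_ne_zero (Nat.factorial_ne_zero _) (Nat.factorial_ne_zero _))]
  have h1 : (ij.1.factorial : ℂ) ≠ 0 := by exact_mod_cast Nat.factorial_ne_zero _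
  have h2 : (ij.2.factorial : ℂ) ≠ 0 := by exact_mod_cast Nat.factorial_ne_zero _
  have h3 : ((ij.1 + ij.2).factorial : ℂ) ≠ 0 := by exact_mod_cast Nat.factorial_ne_zero _
  push_cast
  field_simp

theorem shift_mul {N M : ℕ} (m : ℤ) (f g : Hat N M) : shift m (f * g) = shift m f * shift m g := by
  have h1 : ∀ p : DiffAlg N M, ∀ g : Hat N M, shift m (C p * g) = shift m (C p) * shift m g := by
    intro p g
    rw [shift_eq, shift_eq m g]
    refine DFunLike.congr_fun (f := shiftLin m ∘ₗ LinearMap.mulLeft ℂ⟦X⟧ (C p))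
      (g := LinearMap.mulLeft ℂ⟦X⟧ (shift m (C p)) ∘ₗ shiftLin m)
      (hat_linearMap_ext fun q => ?_) g
    simp only [LinearMap.comp_apply, LinearMap.mulLeft_apply, ← shift_eq]
    exact shift_C_mul_C m p q
  rw [shift_eq, shift_eq m f]
  refine DFunLike.congr_fun (f := shiftLin m ∘ₗ LinearMap.mulRight ℂ⟦X⟧ g)
      (g := LinearMap.mulRight ℂ⟦X⟧ (shift m g) ∘ₗ shiftLin m)
      (hat_linearMap_ext fun q => ?_) f
  simp only [LinearMap.comp_apply, LinearMap.mulRight_apply, ← shift_eq]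
  exact h1 q g

theorem shift_one {N M : ℕ} (m : ℤ) : shift m (1 : Hat N M) = 1 := by
  ext1 j
  rw [shift_eq, ← map_one (C (R := DiffAlg N M)), shiftLin, symbolLin, coeff_extLin_C, coeff_C]
  obtain _ | j := j
  · simp [coeff_expSymbol]
  · rw [LinearMap.smul_apply, pow_succ, Module.End.mul_apply]
    simp

/-! ### Evolutionary derivations of `𝒜⟦ε⟧` -/

theorem evolD_add {N M : ℕ} (a b : ℤ → DiffAlg N M) : evolD (a + b) = evolD a + evolD b := by
  apply diffAlg_derivation_ext
  · simp [evolD_vPow, mul_add]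
  · intro g
    cases g with
    | ell => simp [evolD_ell, mul_add]
    | low k =>
      simp only [evolD_low, Derivation.add_apply, Pi.add_apply]
      exact iterate_map_add _ _ _ _
    | jet n k =>
      simp only [evolD_jet, Derivation.add_apply, Pi.add_apply]
      exact iterate_map_add _ _ _ _

theorem totalD_iterate_smul {N M : ℕ} (c : ℂ) (k : ℕ) (p : DiffAlg N M) :
    (totalD N M)^[k] (c • p) = c • (totalD N M)^[k] p := by
  induction k generalizing p with
  | zero => rfl
  | succ k ih => rw [Function.iterate_succ_apply, Function.iterate_succ_apply,
      Derivation.map_smul, ih]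

theorem evolD_smul {N M : ℕ} (c : ℂ) (a : ℤ → DiffAlg N M) : evolD (c • a) = c • evolD a := by
  apply diffAlg_derivation_ext
  · simp only [evolD_vPow, Pi.smul_apply, Derivation.smul_apply, mul_smul_comm]
    rw [smul_comm]
  · intro g
    cases g with
    | ell => simp [evolD_ell]
    | low k =>
      simp only [evolD_low, Derivation.smul_apply, Pi.smul_apply, totalD_iterate_smul]
    | jet n k =>
      simp only [evolD_jet, Derivation.smul_apply, Pi.smul_apply, totalD_iterate_smul]

/-- `evolD a p` as a linear function of the characteristic `a`. -/
def evolLin {N M : ℕ} (p : DiffAlg N M) : (ℤ → DiffAlg N M) →ₗ[ℂ] DiffAlg N M where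
  toFun a := evolD a p
  map_add' a b := by rw [evolD_add, Derivation.add_apply]
  map_smul' c a := by rw [evolD_smul, Derivation.smul_apply, RingHom.id_apply]

/-- `f ↦ dirDeriv f V` as a linear map. -/
def dirLin {N M : ℕ} (V : DiffOp N M) : Hat N M →ₗ[ℂ⟦X⟧] Hat N M :=
  extLin fun q => (evolD fun n => coeff q (V n)).toLinearMap

theorem dirDeriv_eq {N M : ℕ} (hM : 1 ≤ M) (f : Hat N M) (V : DiffOp N M) :
    dirDeriv f V = dirLin V f := by
  ext1 j
  rw [dirDeriv, coeff_mk, dirLin, coeff_extLin, ← Finset.Nat.sum_antidiagonal_swap]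
  exact Finset.sum_congr rfl fun p _ => sum_partialU_eq_evolD hM (fun n => coeff p.1 (V n)) _

theorem coeff_dirLin_C {N M : ℕ} (V : DiffOp N M) (p : DiffAlg N M) (j : ℕ) :
    coeff j (dirLin V (C p)) = evolD (fun n => coeff j (V n)) p :=
  coeff_extLin_C _ _ _

theorem dirLin_mul {N M : ℕ} (V : DiffOp N M) (f g : Hat N M) :
    dirLin V (f * g) = f * dirLin V g + g * dirLin V f := by
  have h1 : ∀ p : DiffAlg N M, ∀ g : Hat N M,
      dirLin V (C p * g) = C p * dirLin V g + g * dirLin V (C p) := by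
    intro p g
    refine DFunLike.congr_fun (f := dirLin V ∘ₗ LinearMap.mulLeft ℂ⟦X⟧ (C p))
      (g := LinearMap.mulLeft ℂ⟦X⟧ (C p) ∘ₗ dirLin V + LinearMap.mulRight ℂ⟦X⟧ (dirLin V (C p)))
      (hat_linearMap_ext fun q => ?_) g
    simp only [LinearMap.comp_apply, LinearMap.mulLeft_apply, LinearMap.mulRight_apply,
      LinearMap.add_apply]
    ext1 j
    rw [← map_mul, map_add, coeff_C_mul, coeff_C_mul, coeff_dirLin_C, coeff_dirLin_C,
      coeff_dirLin_C, Derivation.leibniz, smul_eq_mul, smul_eq_mul]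
  refine DFunLike.congr_fun (f := dirLin V ∘ₗ LinearMap.mulRight ℂ⟦X⟧ g)
    (g := LinearMap.mulRight ℂ⟦X⟧ (dirLin V g) + LinearMap.mulLeft ℂ⟦X⟧ g ∘ₗ dirLin V)
      (hat_linearMap_ext fun q => ?_) f
  simp only [LinearMap.comp_apply, LinearMap.mulLeft_apply, LinearMap.mulRight_apply,
    LinearMap.add_apply]
  exact h1 q g

theorem dirLin_symbolLin {N M : ℕ} (V : DiffOp N M) (φ : ℂ⟦X⟧) (f : Hat N M) :
    dirLin V (symbolLin φ f) = symbolLin φ (dirLin V f) := by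
  rw [dirLin, symbolLin]
  refine extLin_comm (fun a b p => ?_) f
  rw [LinearMap.smul_apply, LinearMap.smul_apply, map_smul, Module.End.pow_apply,
    Module.End.pow_apply]
  exact congrArg _ (totalD_iterate_evolD _ _ _).symm

theorem dirLin_shift {N M : ℕ} (V : DiffOp N M) (m : ℤ) (f : Hat N M) :
    dirLin V (shift m f) = shift m (dirLin V f) := by
  rw [shift_eq, shift_eq]
  exact dirLin_symbolLin V _ f

theorem dirLin_hatD {N M : ℕ} (V : DiffOp N M) (f : Hat N M) :
    dirLin V (hatD N M f) = hatD N M (dirLin V f) := by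
  rw [hatD_eq_extLin, dirLin]
  refine extLin_comm (fun a b p => ?_) f
  by_cases hb : b = 0
  · rw [if_pos hb]
    exact (totalD_evolD _ _).symm
  · rw [if_neg hb, LinearMap.zero_apply, LinearMap.zero_apply, map_zero]

theorem dirLin_map_add {N M : ℕ} (V W : DiffOp N M) (f : Hat N M) :
    dirLin (V + W) f = dirLin V f + dirLin W f := by
  refine DFunLike.congr_fun (g := dirLin V + dirLin W) (hat_linearMap_ext fun p => ?_) f
  ext1 j
  rw [LinearMap.add_apply, map_add, coeff_dirLin_C, coeff_dirLin_C, coeff_dirLin_C]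
  exact (evolLin p).map_add (fun n => coeff j (V n)) (fun n => coeff j (W n))

theorem dirLin_map_smul {N M : ℕ} (c : ℂ⟦X⟧) (V : DiffOp N M) (f : Hat N M) :
    dirLin (c • V) f = c • dirLin V f := by
  refine DFunLike.congr_fun (g := c • dirLin V) (hat_linearMap_ext fun p => ?_) f
  ext1 j
  rw [LinearMap.smul_apply, coeff_dirLin_C, coeff_smul_hat]
  simp only [coeff_dirLin_C]
  have : (fun n => coeff j ((c • V) n)) =
      ∑ q ∈ antidiagonal j, coeff q.1 c • fun n => coeff q.2 (V n) := by
    funext n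
    rw [Pi.smul_apply, coeff_smul_hat, Finset.sum_apply]
    rfl
  rw [this]
  change evolLin p _ = _
  rw [map_sum]
  exact Finset.sum_congr rfl fun q _ => (evolLin p).map_smul _ _

theorem dirLin_uHat {N M : ℕ} (hM : 1 ≤ M) {V : DiffOp N M} (hV : IsTangent V) (n : ℤ) :
    dirLin V (uHat N M n) = V n := by
  ext1 j
  rw [uHat, coeff_dirLin_C]
  refine evolD_uVar hM _ (fun n hn => ?_) n
  rw [hV n hn, map_zero]

theorem coeff_dirLin {N M : ℕ} (V : DiffOp N M) (f : Hat N M) (j : ℕ) :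
    coeff j (dirLin V f) =
      ∑ q ∈ antidiagonal j, evolD (fun n => coeff q.1 (V n)) (coeff q.2 f) :=
  coeff_extLin _ _ _

theorem coeff_dirLin' {N M : ℕ} (V : DiffOp N M) (f : Hat N M) (j : ℕ) :
    coeff j (dirLin V f) =
      ∑ q ∈ antidiagonal j, evolD (fun n => coeff q.2 (V n)) (coeff q.1 f) := by
  rw [coeff_dirLin, ← Finset.Nat.sum_antidiagonal_swap]
  rfl

/-- Order by order in `ε` this is `evolD_commutator`. The two compositions are expanded with
opposite orders of the antidiagonal, so that matching terms form commutators. -/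
theorem dirLin_commutator {N M : ℕ} (V W : DiffOp N M) (f : Hat N M) :
    dirLin V (dirLin W f) - dirLin W (dirLin V f) =
      dirLin (fun n => dirLin V (W n) - dirLin W (V n)) f := by
  refine DFunLike.congr_fun (f := dirLin V ∘ₗ dirLin W - dirLin W ∘ₗ dirLin V)
    (hat_linearMap_ext fun p => ?_) f
  ext1 j
  rw [LinearMap.sub_apply, LinearMap.comp_apply, LinearMap.comp_apply, map_sub, coeff_dirLin,
    coeff_dirLin', coeff_dirLin_C, ← Finset.sum_sub_distrib]
  have e : (fun n => coeff j (dirLin V (W n) - dirLin W (V n))) =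
      ∑ q ∈ antidiagonal j, fun n => evolD (fun n => coeff q.1 (V n)) (coeff q.2 (W n)) -
        evolD (fun n => coeff q.2 (W n)) (coeff q.1 (V n)) := by
    funext n
    rw [map_sub, coeff_dirLin, coeff_dirLin', ← Finset.sum_sub_distrib, Finset.sum_apply]
  have e2 := congrArg (evolLin p) e
  rw [map_sum] at e2
  refine Eq.trans ?_ e2.symm
  refine Finset.sum_congr rfl fun q _ => ?_
  rw [coeff_dirLin_C, coeff_dirLin_C, ← Derivation.commutator_apply, evolD_commutator]
  rfl

end BigradedToda

/-! ### Local functionals and the pairing of forms with tangent vectors. -/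

namespace BigradedToda

open PowerSeries Finset.HasAntidiagonal

theorem integral_eq_zero_iff {N M : ℕ} (f : Hat N M) :
    integral N M f = 0 ↔ ∀ j, coeff j f ∈ totalDRange N M := by
  rw [integral, Submodule.mkQ_apply, Submodule.Quotient.mk_eq_zero]
  constructor
  · rintro ⟨g, rfl⟩ j
    rw [coeff_hatD]
    exact totalD_mem_range _
  · intro h
    choose g hg using h
    refine ⟨PowerSeries.mk g, PowerSeries.ext fun j => ?_⟩
    rw [coeff_hatD, coeff_mk]
    exact hg j

theorem integral_hatD {N M : ℕ} (f : Hat N M) : integral N M (hatD N M f) = 0 := by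
  rw [integral, Submodule.mkQ_apply, Submodule.Quotient.mk_eq_zero]
  exact ⟨f, rfl⟩

theorem integral_eq_iff {N M : ℕ} (f g : Hat N M) :
    integral N M f = integral N M g ↔ ∃ h, f - g = hatD N M h := by
  rw [← sub_eq_zero, ← map_sub, integral, Submodule.mkQ_apply, Submodule.Quotient.mk_eq_zero]
  exact ⟨fun ⟨h, hh⟩ => ⟨h, hh.symm⟩, fun ⟨h, hh⟩ => ⟨h, hh.symm⟩⟩

theorem expSymbol_sub_one (m : ℤ) : expSymbol m - 1 = X * expDiffQuot m 0 := by
  rw [X_mul_expDiffQuot, expSymbol_zero]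

/-- `Λ^m - 1` is divisible by `ε∂ₓ`. -/
theorem integral_shift {N M : ℕ} (m : ℤ) (f : Hat N M) :
    integral N M (shift m f) = integral N M f := by
  rw [← sub_eq_zero, ← map_sub, shift_eq, shiftLin]
  nth_rewrite 2 [← symbolLin_one f]
  rw [← symbolLin_sub, expSymbol_sub_one, symbolLin_mul, symbolLin_X, map_smul, integral_hatD,
    smul_zero]

theorem eq_zero_of_integral_mul {N M : ℕ} (hN : 1 ≤ N) (hM : 1 ≤ M) (w : Hat N M)
    (hw : ∀ v, integral N M (w * v) = 0) : w = 0 := by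
  refine PowerSeries.ext fun j => ?_
  rw [map_zero]
  refine eq_zero_of_forall_mul_mem_range hN hM _ fun v => ?_
  have := (integral_eq_zero_iff _).1 (hw (C v)) j
  rwa [coeff_mul_C] at this

theorem res_opMul_tangent {N M : ℕ} {V : DiffOp N M} (hV : IsTangent V) (W : DiffOp N M) :
    res (opMul W V) = ∑ n ∈ Finset.Ico (-(M : ℤ)) N, W (-n) * shift (-n) (V n) := by
  rw [res, opMul, ← finsum_comp_equiv (Equiv.neg ℤ)]
  simp only [Equiv.neg_apply, sub_neg_eq_add, zero_add]
  refine finsum_eq_sum_of_support_subset _ fun n hn => ?_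
  by_contra h
  exact hn (by simp only; rw [hV n h, shift_map_zero, mul_zero])

theorem pairing_tangent {N M : ℕ} {V : DiffOp N M} (hV : IsTangent V) (W : DiffOp N M) :
    pairing W V = ∑ n ∈ Finset.Ico (-(M : ℤ)) N, integral N M (W (-n) * shift (-n) (V n)) := by
  rw [pairing, res_opMul_tangent hV, map_sum]

theorem pairing_tangent' {N M : ℕ} {V : DiffOp N M} (hV : IsTangent V) (W : DiffOp N M) :
    pairing W V = ∑ n ∈ Finset.Ico (-(M : ℤ)) N, integral N M (shift n (W (-n)) * V n) := by
  rw [pairing_tangent hV]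
  refine Finset.sum_congr rfl fun n _ => ?_
  rw [← integral_shift n, shift_mul, shift_shift, add_neg_cancel, shift_zero]

theorem isTangent_single {N M : ℕ} {n : ℤ} (hn : n ∈ Finset.Ico (-(M : ℤ)) N) (v : Hat N M) :
    IsTangent (Pi.single n v : DiffOp N M) := fun k hk =>
  Pi.single_eq_of_ne (fun h => hk (by rwa [h])) _

theorem eq_zero_of_pairing {N M : ℕ} (hN : 1 ≤ N) (hM : 1 ≤ M) {W : DiffOp N M}
    (h : ∀ V, IsTangent V → pairing W V = 0) : ∀ n ∈ Finset.Ico (-(M : ℤ)) N, W (-n) = 0 := by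
  intro n hn
  have h0 : shift n (W (-n)) = 0 := by
    refine eq_zero_of_integral_mul hN hM _ fun v => ?_
    have := h _ (isTangent_single hn v)
    rw [pairing_tangent' (isTangent_single hn v), Finset.sum_eq_single_of_mem n hn] at this
    · rwa [Pi.single_eq_same] at this
    · intro k _ hk
      rw [Pi.single_eq_of_ne hk, mul_zero, map_zero]
  rw [← shift_zero (W (-n)), ← neg_add_cancel n, ← shift_shift, h0, shift_map_zero]

theorem pairing_congr_left {N M : ℕ} {V W W' : DiffOp N M} (hV : IsTangent V)
    (h : ∀ n ∈ Finset.Ico (-(M : ℤ)) N, W (-n) = W' (-n)) : pairing W V = pairing W' V := by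
  rw [pairing_tangent hV, pairing_tangent hV]
  exact Finset.sum_congr rfl fun n hn => by rw [h n hn]

theorem pairing_sub_left {N M : ℕ} {V : DiffOp N M} (hV : IsTangent V) (W W' : DiffOp N M) :
    pairing (W - W') V = pairing W V - pairing W' V := by
  simp only [pairing_tangent hV, ← Finset.sum_sub_distrib, ← map_sub, Pi.sub_apply, sub_mul]

theorem pairing_add_left {N M : ℕ} {V : DiffOp N M} (hV : IsTangent V) (W W' : DiffOp N M) :
    pairing (W + W') V = pairing W V + pairing W' V := by
  simp only [pairing_tangent hV, ← Finset.sum_add_distrib, ← map_add, Pi.add_apply, add_mul]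

theorem pairing_smul_left {N M : ℕ} {V : DiffOp N M} (hV : IsTangent V) (c : ℂ⟦X⟧)
    (W : DiffOp N M) : pairing (c • W) V = c • pairing W V := by
  simp only [pairing_tangent hV, Finset.smul_sum, ← map_smul, Pi.smul_apply, smul_mul_assoc]

theorem IsTangent.add {N M : ℕ} {V W : DiffOp N M} (hV : IsTangent V) (hW : IsTangent W) :
    IsTangent (V + W) := fun k hk => by rw [Pi.add_apply, hV k hk, hW k hk, add_zero]

theorem IsTangent.sub {N M : ℕ} {V W : DiffOp N M} (hV : IsTangent V) (hW : IsTangent W) :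
    IsTangent (V - W) := fun k hk => by rw [Pi.sub_apply, hV k hk, hW k hk, sub_zero]

theorem IsTangent.smul {N M : ℕ} {V : DiffOp N M} (hV : IsTangent V) (c : ℂ⟦X⟧) :
    IsTangent (c • V) := fun k hk => by rw [Pi.smul_apply, hV k hk, smul_zero]

theorem pairing_add_right {N M : ℕ} {V V' : DiffOp N M} (hV : IsTangent V) (hV' : IsTangent V')
    (W : DiffOp N M) : pairing W (V + V') = pairing W V + pairing W V' := by
  simp only [pairing_tangent' (hV.add hV'), pairing_tangent' hV, pairing_tangent' hV',
    ← Finset.sum_add_distrib, ← map_add, Pi.add_apply, mul_add]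

theorem pairing_sub_right {N M : ℕ} {V V' : DiffOp N M} (hV : IsTangent V) (hV' : IsTangent V')
    (W : DiffOp N M) : pairing W (V - V') = pairing W V - pairing W V' := by
  simp only [pairing_tangent' (hV.sub hV'), pairing_tangent' hV, pairing_tangent' hV',
    ← Finset.sum_sub_distrib, ← map_sub, Pi.sub_apply, mul_sub]

theorem pairing_smul_right {N M : ℕ} {V : DiffOp N M} (hV : IsTangent V) (c : ℂ⟦X⟧)
    (W : DiffOp N M) : pairing W (c • V) = c • pairing W V := by
  simp only [pairing_tangent' (hV.smul c), pairing_tangent' hV, Finset.smul_sum, ← map_smul,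
    Pi.smul_apply, mul_smul_comm]

/-! ### Differentials -/

theorem gradOp_apply_neg {N M : ℕ} (f : Hat N M) {n : ℤ} (hn : n ∈ Finset.Ico (-(M : ℤ)) N) :
    gradOp f (-n) = shift (-n) (varDeriv n f) := by
  rw [gradOp, Finset.sum_apply, Finset.sum_eq_single_of_mem n hn]
  · exact Pi.single_eq_same _ _
  · intro k _ hk
    exact Pi.single_eq_of_ne (fun h => hk (neg_injective h).symm) _

theorem gradOp_apply_eq_zero {N M : ℕ} (f : Hat N M) {k : ℤ}
    (hk : -k ∉ Finset.Ico (-(M : ℤ)) N) : gradOp f k = 0 := by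
  rw [gradOp, Finset.sum_apply]
  refine Finset.sum_eq_zero fun n hn => Pi.single_eq_of_ne (fun h => hk ?_) _
  rwa [h, neg_neg]

theorem finsum_by_parts {N M : ℕ} (n : ℤ) (p q : DiffAlg N M) :
    (∑ᶠ k : ℕ, partialU N M n k p * (totalD N M)^[k] q) -
      (∑ᶠ k : ℕ, (-1 : ℂ) ^ k • (totalD N M)^[k] (partialU N M n k p)) * q
        ∈ totalDRange N M := by
  obtain ⟨K, hK⟩ := partialU_bound p
  rw [finsum_partialU_eq_sum (hK n), finsum_eq_sum_of_support_subset (s := Finset.range K),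
    Finset.sum_mul, ← Finset.sum_sub_distrib]
  · exact Submodule.sum_mem _ fun k _ => mul_iterate_sub_mem_range k _ _
  · intro k hk
    simp only [Finset.coe_range, Set.mem_Iio]
    by_contra h
    refine hk ?_
    beta_reduce
    rw [hK n k (not_lt.1 h), iterate_map_zero, smul_zero]

theorem isDifferential_gradOp {N M : ℕ} (f : Hat N M) : IsDifferential f (gradOp f) := by
  intro V hV
  rw [pairing_tangent' hV, ← map_sum, ← sub_eq_zero, ← map_sub, integral_eq_zero_iff]
  intro j
  have e : ∑ n ∈ Finset.Ico (-(M : ℤ)) N, shift n (gradOp f (-n)) * V n =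
      ∑ n ∈ Finset.Ico (-(M : ℤ)) N, varDeriv n f * V n := by
    refine Finset.sum_congr rfl fun n hn => ?_
    rw [gradOp_apply_neg f hn, shift_shift, add_neg_cancel, shift_zero]
  rw [e, map_sub, dirDeriv, coeff_mk, map_sum]
  simp only [coeff_mul]
  rw [Finset.sum_comm (s := Finset.Ico _ _), ← Finset.sum_sub_distrib]
  refine Submodule.sum_mem _ fun p _ => ?_
  rw [← Finset.sum_sub_distrib]
  refine Submodule.sum_mem _ fun n _ => ?_
  rw [varDeriv, coeff_mk]
  exact finsum_by_parts _ _ _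

/-- Nondegeneracy of the pairing: two differentials of the same functional differ by a null form. -/
theorem IsDifferential.eq_gradOp {N M : ℕ} (hN : 1 ≤ N) (hM : 1 ≤ M) {f : Hat N M}
    {W : DiffOp N M} (h : IsDifferential f W) :
    ∀ n ∈ Finset.Ico (-(M : ℤ)) N, W (-n) = gradOp f (-n) := by
  intro n hn
  refine sub_eq_zero.1 (eq_zero_of_pairing hN hM (W := W - gradOp f) (fun V hV => ?_) n hn)
  rw [pairing_sub_left hV, ← h V hV, ← isDifferential_gradOp f V hV, sub_self]

/-- Among all differentials, `gradOp f` is the one without a null part. Its linearity in `f` and its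
vanishing on total derivatives follow from this characterization, with no computation of variational
derivatives. -/
theorem gradOp_eq_of_isDifferential {N M : ℕ} (hN : 1 ≤ N) (hM : 1 ≤ M) {f : Hat N M}
    {W : DiffOp N M} (h : IsDifferential f W)
    (hW : ∀ k, -k ∉ Finset.Ico (-(M : ℤ)) N → W k = 0) : W = gradOp f := by
  funext k
  by_cases hk : -k ∈ Finset.Ico (-(M : ℤ)) N
  · simpa using h.eq_gradOp hN hM _ hk
  · rw [hW k hk, gradOp_apply_eq_zero f hk]

theorem gradOp_add {N M : ℕ} (hN : 1 ≤ N) (hM : 1 ≤ M) (f g : Hat N M) :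
    gradOp (f + g) = gradOp f + gradOp g := by
  refine (gradOp_eq_of_isDifferential hN hM (fun V hV => ?_) fun k hk => ?_).symm
  · rw [dirDeriv_eq hM, map_add, map_add, pairing_add_left hV, ← isDifferential_gradOp f V hV,
      ← isDifferential_gradOp g V hV, dirDeriv_eq hM, dirDeriv_eq hM]
  · rw [Pi.add_apply, gradOp_apply_eq_zero f hk, gradOp_apply_eq_zero g hk, add_zero]

theorem gradOp_smul {N M : ℕ} (hN : 1 ≤ N) (hM : 1 ≤ M) (c : ℂ⟦X⟧) (f : Hat N M) :
    gradOp (c • f) = c • gradOp f := by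
  refine (gradOp_eq_of_isDifferential hN hM (fun V hV => ?_) fun k hk => ?_).symm
  · rw [dirDeriv_eq hM, map_smul, map_smul, pairing_smul_left hV, ← isDifferential_gradOp f V hV,
      dirDeriv_eq hM]
  · rw [Pi.smul_apply, gradOp_apply_eq_zero f hk, smul_zero]

theorem gradOp_hatD {N M : ℕ} (hN : 1 ≤ N) (hM : 1 ≤ M) (f : Hat N M) :
    gradOp (hatD N M f) = 0 := by
  refine (gradOp_eq_of_isDifferential hN hM (fun V hV => ?_) fun k hk => rfl).symm
  rw [dirDeriv_eq hM, dirLin_hatD, integral_hatD, pairing_tangent hV]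
  simp

/-- The differential of a local functional, as a linear map. -/
def gradLin {N M : ℕ} (hN : 1 ≤ N) (hM : 1 ≤ M) : LocalFunctional N M →ₗ[ℂ⟦X⟧] DiffOp N M :=
  (LinearMap.range (hatD N M)).liftQ
    { toFun := gradOp, map_add' := gradOp_add hN hM, map_smul' := gradOp_smul hN hM } (by
      rintro _ ⟨f, rfl⟩
      exact gradOp_hatD hN hM f)

/-! ### Derivatives of operators and the Hessian -/

/-- The derivative along `V` of the coefficients of a difference operator. -/
def dirOp {N M : ℕ} (V A : DiffOp N M) : DiffOp N M := fun k => dirLin V (A k)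

theorem IsTangent.dirOp {N M : ℕ} {W : DiffOp N M} (V : DiffOp N M) (hW : IsTangent W) :
    IsTangent (dirOp V W) := fun k hk => by rw [BigradedToda.dirOp, hW k hk, map_zero]

theorem integral_dirLin_pairing {N M : ℕ} (V X : DiffOp N M) {W : DiffOp N M}
    (hW : IsTangent W) : integral N M (dirLin V (res (opMul X W))) =
      pairing (dirOp V X) W + pairing X (dirOp V W) := by
  rw [res_opMul_tangent hW, pairing_tangent hW, pairing_tangent (hW.dirOp V),
    ← Finset.sum_add_distrib, map_sum, map_sum]
  refine Finset.sum_congr rfl fun n _ => ?_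
  rw [dirLin_mul, dirLin_shift, map_add, add_comm, mul_comm (shift _ _)]
  rfl

theorem integral_dirLin_congr {N M : ℕ} (V : DiffOp N M) {f g : Hat N M}
    (h : integral N M f = integral N M g) :
    integral N M (dirLin V f) = integral N M (dirLin V g) := by
  obtain ⟨k, hk⟩ := (integral_eq_iff f g).1 h
  rw [← sub_eq_zero, ← map_sub, ← map_sub, hk, dirLin_hatD, integral_hatD]

/-- Symmetry of the Hessian of `∫ f`. Differentiating `∫ ∂_W f = ⟨df, W⟩` along `V` and
antisymmetrizing, the commutator of the two vector fields contributes the same term on both sides.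
-/
theorem pairing_dirOp_gradOp_comm {N M : ℕ} (hM : 1 ≤ M) (f : Hat N M) {V W : DiffOp N M}
    (hV : IsTangent V) (hW : IsTangent W) :
    pairing (dirOp V (gradOp f)) W = pairing (dirOp W (gradOp f)) V := by
  have h : ∀ V W : DiffOp N M, IsTangent W → integral N M (dirLin V (dirLin W f)) =
      pairing (dirOp V (gradOp f)) W + pairing (gradOp f) (dirOp V W) := by
    intro V W hW
    rw [← integral_dirLin_pairing V _ hW]
    refine integral_dirLin_congr V ?_
    rw [← dirDeriv_eq hM]
    exact isDifferential_gradOp f W hW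
  have hT := (hW.dirOp V).sub (hV.dirOp W)
  have h3 : integral N M (dirLin (dirOp V W - dirOp W V) f) =
      pairing (gradOp f) (dirOp V W) - pairing (gradOp f) (dirOp W V) := by
    rw [← dirDeriv_eq hM, isDifferential_gradOp f _ hT,
      pairing_sub_right (hW.dirOp V) (hV.dirOp W)]
  have h4 : dirLin V (dirLin W f) - dirLin W (dirLin V f) =
      dirLin (dirOp V W - dirOp W V) f := dirLin_commutator V W f
  rw [← h4, map_sub, h V W hW, h W V hV] at h3
  rw [← sub_eq_zero]
  rw [← sub_eq_zero] at h3
  rw [← h3]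
  abel

end BigradedToda

/-! ### Reduction of the Poisson property to a trilinear identity for forms. -/

namespace BigradedToda

theorem localFunctional_eq_zero_of_add_self {N M : ℕ} (F : LocalFunctional N M) (h : F + F = 0) :
    F = 0 := by
  rw [← two_smul ℂ⟦X⟧] at h
  have h2 := congrArg ((PowerSeries.C (1 / 2 : ℂ)) • ·) h
  simp only [smul_smul, smul_zero] at h2
  rwa [← map_ofNat (PowerSeries.C (R := ℂ)) 2, ← map_mul, one_div_mul_cancel two_ne_zero,
    map_one, one_smul] at h2

/-- The bracket `{F, G} = ⟨dF, P(dG)⟩` of local functionals, for a linear operator `P` with values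
in tangent vectors. -/
def functionalBracket {N M : ℕ} (hN : 1 ≤ N) (hM : 1 ≤ M) (P : DiffOp N M →ₗ[ℂ⟦X⟧] DiffOp N M)
    (hP : ∀ X, IsTangent (P X)) :
    LocalFunctional N M →ₗ[ℂ⟦X⟧] LocalFunctional N M →ₗ[ℂ⟦X⟧] LocalFunctional N M :=
  LinearMap.mk₂ ℂ⟦X⟧ (fun F G => pairing (gradLin hN hM F) (P (gradLin hN hM G)))
    (fun F F' G => by rw [map_add, pairing_add_left (hP _)])
    (fun c F G => by rw [map_smul, pairing_smul_left (hP _)])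
    (fun F G G' => by rw [map_add, map_add, pairing_add_right (hP _) (hP _)])
    (fun c F G => by rw [map_smul, map_smul, pairing_smul_right (hP _)])

/-- The trilinear expression `⟨X, P'(P(Z))(Y)⟩`, where `P'(V)` is the derivative of the operator
`P` along `V`. -/
def derivPairing {N M : ℕ} (P Q : DiffOp N M → DiffOp N M) (X Y Z : DiffOp N M) :
    LocalFunctional N M :=
  pairing X (dirOp (Q Z) (P Y) - P (dirOp (Q Z) Y))

/-- The two Hessian terms are arranged, by skew symmetry of `P` and symmetry of the Hessian, as a
difference that telescopes under cyclic permutation of `f, g, h`. -/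
theorem pairing_dirOp_apply {N M : ℕ} (hM : 1 ≤ M) {P : DiffOp N M → DiffOp N M}
    (hP : ∀ X, IsTangent (P X)) (hskew : ∀ X Y, pairing X (P Y) = -pairing Y (P X))
    (f g h : Hat N M) :
    integral N M (dirLin (P (gradOp h)) (res (opMul (gradOp f) (P (gradOp g))))) =
      derivPairing P P (gradOp f) (gradOp g) (gradOp h)
        + pairing (dirOp (P (gradOp g)) (gradOp f)) (P (gradOp h))
        - pairing (dirOp (P (gradOp h)) (gradOp g)) (P (gradOp f)) := by
  rw [integral_dirLin_pairing _ _ (hP _), derivPairing,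
    pairing_sub_right ((hP _).dirOp _) (hP _), hskew (gradOp f) (dirOp _ _),
    pairing_dirOp_gradOp_comm hM f (hP (gradOp h)) (hP (gradOp g))]
  abel

/-- Once the Hessian terms have cancelled, the forms need no longer be differentials: `hjac` is the
vanishing of the Schouten bracket of `P` on arbitrary forms. -/
theorem isHamiltonianOperator_of_jacobi {N M : ℕ} (hN : 1 ≤ N) (hM : 1 ≤ M)
    (P : DiffOp N M →ₗ[ℂ⟦X⟧] DiffOp N M) (hP : ∀ X, IsTangent (P X))
    (hnull : ∀ X : DiffOp N M, (∀ n ∈ Finset.Ico (-(M : ℤ)) N, X (-n) = 0) → P X = 0)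
    (hskew : ∀ X Y, pairing X (P Y) = -pairing Y (P X))
    (hjac : ∀ X Y Z, derivPairing P P X Y Z + derivPairing P P Y Z X + derivPairing P P Z X Y = 0) :
    IsHamiltonianOperator P where
  map_add := map_add P
  map_smul := map_smul P
  map_tangent := hP
  map_null := hnull
  skew := hskew
  poisson := by
    have hval : ∀ f g : Hat N M, functionalBracket hN hM P hP (integral N M f) (integral N M g) =
        pairing (gradOp f) (P (gradOp g)) := fun f g => rfl
    refine ⟨functionalBracket hN hM P hP, fun f g Wf Wg hf hg => ?_, fun F => ?_, ?_⟩
    · have h1 : P Wg = P (gradOp g) := by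
        rw [← sub_eq_zero, ← map_sub]
        refine hnull _ fun n hn => ?_
        rw [Pi.sub_apply, hg.eq_gradOp hN hM n hn, sub_self]
      rw [hval, h1]
      exact (pairing_congr_left (hP _) (hf.eq_gradOp hN hM)).symm
    · obtain ⟨f, rfl⟩ := Submodule.mkQ_surjective _ F
      change functionalBracket hN hM P hP (integral N M f) (integral N M f) = 0
      have h := hskew (gradOp f) (gradOp f)
      rw [← hval, eq_neg_iff_add_eq_zero] at h
      exact localFunctional_eq_zero_of_add_self _ h
    -- `{{f, g}, h}` is the derivative of `{f, g}` along `P(dh)`.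
    · have key : ∀ f g h : Hat N M, functionalBracket hN hM P hP
          (functionalBracket hN hM P hP (integral N M f) (integral N M g)) (integral N M h) =
          derivPairing P P (gradOp f) (gradOp g) (gradOp h)
        + pairing (dirOp (P (gradOp g)) (gradOp f)) (P (gradOp h))
        - pairing (dirOp (P (gradOp h)) (gradOp g)) (P (gradOp f)) := by
        intro f g h
        rw [← pairing_dirOp_apply hM hP hskew, ← dirDeriv_eq hM,
          isDifferential_gradOp _ _ (hP _), ← hval]
        rfl
      intro F G H
      obtain ⟨f, rfl⟩ := Submodule.mkQ_surjective _ F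
      obtain ⟨g, rfl⟩ := Submodule.mkQ_surjective _ G
      obtain ⟨h, rfl⟩ := Submodule.mkQ_surjective _ H
      have e := hjac (gradOp f) (gradOp g) (gradOp h)
      have k1 := key f g h
      have k2 := key g h f
      have k3 := key h f g
      unfold integral at k1 k2 k3
      rw [k1, k2, k3, ← e]
      abel

end BigradedToda

namespace BigradedToda

/-! ### Identities for traces on associative rings -/

section Trace

variable {K E : Type*} [Ring K] [AddCommGroup E] (tr : K →+ E)

/-- The form `φ(x, y, z) = tr(x[y, z])` is trilinear and alternating. The claim is the expansion of
`φ(a - p, b - q, c - r) = 0` with `φ(p, q, r) = 0`; in use, `p, q, r` are the nonpositive parts of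
`a, b, c`. -/
theorem trace_cubic (htr : ∀ a b, tr (a * b) = tr (b * a)) (a b c p q r : K)
    (h1 : tr (p * (q * r - r * q)) = 0)
    (h2 : tr ((a - p) * ((b - q) * (c - r) - (c - r) * (b - q))) = 0) :
    tr (p * (b * c - c * b)) + tr (q * (c * a - a * c)) + tr (r * (a * b - b * a))
      + tr (a * (r * q - q * r)) + tr (b * (p * r - r * p)) + tr (c * (q * p - p * q)) =
      tr (a * (b * c - c * b)) := by
  have rot : ∀ x y z, tr (x * (y * z)) = tr (z * (x * y)) := fun x y z => by
    rw [← mul_assoc, htr]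
  have rot' : ∀ x y z, tr (x * (y * z)) = tr (y * (z * x)) := fun x y z => by
    rw [htr, mul_assoc]
  simp only [mul_sub, sub_mul, map_sub] at h1 h2 ⊢
  rw [rot q c a, rot' q a c, rot' r a b, rot r b a, rot' b p r, rot b r p, rot' c p q, rot c q p]
  rw [← sub_eq_zero, ← neg_eq_zero, ← h2, ← sub_eq_zero, ← h1]
  abel

/-- By cyclicity, `L` is absorbed into the products `XL, YL` next to `π` and `LX, LY` next to `ρ`.
The last four terms, which mix `π` and `ρ`, cancel in the cyclic sum. -/
theorem trace_expand (htr : ∀ a b, tr (a * b) = tr (b * a)) (L X Y πX πY πZ ρX ρY ρZ : K) :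
    tr ((L * πZ - ρZ * L) *
        (πY * X - πX * Y + Y * ρX - X * ρY + X * L * Y - Y * L * X)) =
      tr (πZ * (X * L * (Y * L) - Y * L * (X * L))) + tr (πZ * πY * (X * L))
        - tr (πZ * πX * (Y * L))
        - tr (ρZ * (L * X * (L * Y) - L * Y * (L * X))) - tr (ρX * ρZ * (L * Y))
        + tr (ρY * ρZ * (L * X))
        + tr (ρX * L * πZ * Y) - tr (ρY * L * πZ * X)
        - tr (ρZ * L * πY * X) + tr (ρZ * L * πX * Y) := by
  have e1 : tr (L * πZ * (πY * X)) = tr (πZ * πY * (X * L)) := by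
    rw [mul_assoc, htr]; simp only [mul_assoc]
  have e2 : tr (L * πZ * (πX * Y)) = tr (πZ * πX * (Y * L)) := by
    rw [mul_assoc, htr]; simp only [mul_assoc]
  have e3 : tr (L * πZ * (Y * ρX)) = tr (ρX * L * πZ * Y) := by
    rw [← mul_assoc, htr]; simp only [mul_assoc]
  have e4 : tr (L * πZ * (X * ρY)) = tr (ρY * L * πZ * X) := by
    rw [← mul_assoc, htr]; simp only [mul_assoc]
  have e5 : tr (L * πZ * (X * L * Y)) = tr (πZ * (X * L * (Y * L))) := by
    rw [mul_assoc, htr]; simp only [mul_assoc]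
  have e6 : tr (L * πZ * (Y * L * X)) = tr (πZ * (Y * L * (X * L))) := by
    rw [mul_assoc, htr]; simp only [mul_assoc]
  have e7 : tr (ρZ * L * (Y * ρX)) = tr (ρX * ρZ * (L * Y)) := by
    rw [← mul_assoc, htr]; simp only [mul_assoc]
  have e8 : tr (ρZ * L * (X * ρY)) = tr (ρY * ρZ * (L * X)) := by
    rw [← mul_assoc, htr]; simp only [mul_assoc]
  simp only [mul_sub, mul_add, sub_mul, map_sub, map_add]
  rw [e1, e2, e3, e4, e5, e6, e7, e8]
  simp only [mul_assoc]
  abel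

/-- The algebraic core of the Jacobi identity: `trace_cubic` is applied to the products `XL, YL, ZL`
with `π` and to `LX, LY, LZ` with `ρ`, and the two right-hand sides agree by cyclicity of the trace.
-/
theorem trace_cyclic_sum (htr : ∀ a b, tr (a * b) = tr (b * a))
    (L X Y Z πX πY πZ ρX ρY ρZ : K)
    (h1 : tr (πX * (πY * πZ - πZ * πY)) = 0)
    (h2 : tr ((X * L - πX) *
      ((Y * L - πY) * (Z * L - πZ) - (Z * L - πZ) * (Y * L - πY))) = 0)
    (h3 : tr (ρX * (ρY * ρZ - ρZ * ρY)) = 0)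
    (h4 : tr ((L * X - ρX) *
      ((L * Y - ρY) * (L * Z - ρZ) - (L * Z - ρZ) * (L * Y - ρY))) = 0) :
    tr ((L * πZ - ρZ * L) * (πY * X - πX * Y + Y * ρX - X * ρY + X * L * Y - Y * L * X))
    + tr ((L * πX - ρX * L) * (πZ * Y - πY * Z + Z * ρY - Y * ρZ + Y * L * Z - Z * L * Y))
    + tr ((L * πY - ρY * L) * (πX * Z - πZ * X + X * ρZ - Z * ρX + Z * L * X - X * L * Z))
      = 0 := by
  have hA := trace_cubic tr htr (X * L) (Y * L) (Z * L) πX πY πZ h1 h2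
  have hB := trace_cubic tr htr (L * X) (L * Y) (L * Z) ρX ρY ρZ h3 h4
  have hAB : tr (X * L * (Y * L * (Z * L) - Z * L * (Y * L))) =
      tr (L * X * (L * Y * (L * Z) - L * Z * (L * Y))) := by
    have e : X * L * (Y * L * (Z * L) - Z * L * (Y * L)) =
      (X * (L * Y * (L * Z) - L * Z * (L * Y))) * L := by
      simp only [mul_sub, sub_mul, mul_assoc]
    rw [e, htr, ← mul_assoc]
  rw [trace_expand tr htr, trace_expand tr htr, trace_expand tr htr]
  rw [← sub_eq_zero] at hAB
  have hAB' := hAB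
  rw [← hA, ← hB] at hAB'
  have c1 : ∀ p q a : K, tr (p * q * a) = tr (a * (p * q)) := fun p q a => htr _ _
  rw [← hAB', c1 πZ, c1 πZ, c1 ρX ρZ, c1 ρY ρZ, c1 πX, c1 πX, c1 ρY ρX, c1 ρZ ρX, c1 πY, c1 πY,
    c1 ρZ ρY, c1 ρX ρY]
  simp only [mul_sub, map_sub]
  abel

end Trace

/-! ### Finite difference operators as a skew group ring -/

open SkewMonoidAlgebra

section Skew

variable {R E : Type*} [CommRing R] [AddCommGroup E]

local notation "𝒦" => SkewMonoidAlgebra R (Multiplicative ℤ)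

/-- The constant-order operator `r Λ^0`. -/
def skewConst : R →+ SkewMonoidAlgebra R (Multiplicative ℤ) := singleAddHom 1

/-- The residue of a finite difference operator. -/
def skewRes : SkewMonoidAlgebra R (Multiplicative ℤ) →+ R where
  toFun A := A.coeff 1
  map_zero' := rfl
  map_add' A B := by rw [coeff_add]; rfl

/-- The part of a finite difference operator with exponents in `S`. -/
def skewPart (S : Set ℤ) :
    SkewMonoidAlgebra R (Multiplicative ℤ) →+ SkewMonoidAlgebra R (Multiplicative ℤ) where
  toFun A := ⟨by classical exact A.coeff.filter fun g => g.toAdd ∈ S⟩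
  map_zero' := by classical simp [Finsupp.filter_zero]
  map_add' A B := by classical simp [Finsupp.filter_add]

theorem skewPart_coeff (S : Set ℤ) (A : 𝒦) (g : Multiplicative ℤ) :
    (skewPart S A).coeff g = S.indicator (fun k => A.coeff (Multiplicative.ofAdd k)) g.toAdd := by
  classical
  simp only [skewPart, AddMonoidHom.coe_mk, ZeroHom.coe_mk, Finsupp.filter_apply, Set.indicator]
  rfl

theorem skewConst_coeff (r : R) (g : Multiplicative ℤ) :
    (skewConst r : 𝒦).coeff g = if g = 1 then r else 0 := by
  classical
  rw [skewConst, singleAddHom_apply, coeff_single_apply]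
  simp only [eq_comm]

theorem skewPart_add_const_add (A : 𝒦) :
    skewPart (Set.Iio 0) A + skewConst (skewRes A) + skewPart (Set.Ioi 0) A = A := by
  ext g
  rw [coeff_add, coeff_add, Finsupp.add_apply, Finsupp.add_apply, skewPart_coeff, skewPart_coeff,
    skewConst_coeff]
  rcases lt_trichotomy g.toAdd 0 with h | h | h
  · have h1 : g ≠ 1 := fun h' => by simp [h'] at h
    simp [h1, h, h.le, Set.indicator]
  · have h1 : g = 1 := h
    simp [h1, Set.indicator, skewRes]
  · have h1 : g ≠ 1 := fun h' => by simp [h'] at h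
    simp [h1, h, Set.indicator, not_lt.2 h.le]

theorem skewPart_single (S : Set ℤ) [DecidablePred (· ∈ S)] (a : Multiplicative ℤ) (r : R) :
    skewPart S (single a r : 𝒦) = if a.toAdd ∈ S then single a r else 0 := by
  classical
  ext g
  rw [skewPart_coeff, Set.indicator]
  by_cases hg : a = g
  · subst hg
    by_cases h : a.toAdd ∈ S <;> simp [h]
  · have : a ≠ Multiplicative.ofAdd g.toAdd := hg
    simp only [coeff_single_apply, this, if_false, ite_self]
    split_ifs
    · rw [coeff_single_apply, if_neg hg]
    · rfl

/-- Together with the next lemma: for any constant `r`, the operators `A_- + r` and `A - (A_- + r)`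
lie in the subrings of nonpositive and nonnegative orders. So the nonlocal term does not disturb the
R-matrix argument. -/
theorem neg_part_add_const_nonpos (A : 𝒦) (r : R) (g : Multiplicative ℤ) (hg : 0 < g.toAdd) :
    (skewPart (Set.Iio 0) A + skewConst r).coeff g = 0 := by
  have h1 : g ≠ 1 := fun h' => by simp [h'] at hg
  rw [coeff_add, Finsupp.add_apply, skewPart_coeff, skewConst_coeff, if_neg h1,
    Set.indicator_of_notMem (by simpa using hg.le), add_zero]

theorem sub_neg_part_add_const_nonneg (A : 𝒦) (r : R) (g : Multiplicative ℤ) (hg : g.toAdd < 0) :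
    (A - (skewPart (Set.Iio 0) A + skewConst r)).coeff g = 0 := by
  have h1 : g ≠ 1 := fun h' => by simp [h'] at hg
  rw [coeff_sub, Finsupp.sub_apply, coeff_add, Finsupp.add_apply, skewPart_coeff, skewConst_coeff,
    if_neg h1, Set.indicator_of_mem (by simpa using hg), add_zero]
  exact sub_self _

variable [MulSemiringAction (Multiplicative ℤ) R]

theorem skewRes_mul_const (A : 𝒦) (r : R) : skewRes (A * skewConst r) = skewRes A * r := by
  change (A * single 1 r).coeff 1 = _
  rw [coeff_mul_single_one, one_smul]; rfl

/-- The trace `A ↦ ∫ res A`. -/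
def skewTrace (I : R →+ E) : SkewMonoidAlgebra R (Multiplicative ℤ) →+ E := I.comp skewRes

variable {I : R →+ E}

theorem skewRes_single_mul_single (a b : Multiplicative ℤ) (r s : R) :
    skewRes (single a r * single b s : 𝒦) = if a * b = 1 then r * a • s else 0 := by
  classical
  change (single a r * single b s : 𝒦).coeff 1 = _
  rw [single_mul_single, coeff_single_apply]

/-- For monomials of opposite orders the two residues differ by a shift, which `I` does not see;
otherwise both vanish. -/
theorem skewTrace_mul_comm (hI : ∀ (g : Multiplicative ℤ) (r : R), I (g • r) = I r)
    (A B : 𝒦) : skewTrace I (A * B) = skewTrace I (B * A) := by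
  induction A using SkewMonoidAlgebra.induction_on with
  | zero => simp
  | add A A' h h' => rw [add_mul, mul_add, map_add, map_add, h, h']
  | single a r =>
    induction B using SkewMonoidAlgebra.induction_on with
    | zero => simp
    | add A A' h h' => rw [add_mul, mul_add, map_add, map_add, h, h']
    | single b s =>
      rw [skewTrace, AddMonoidHom.comp_apply, AddMonoidHom.comp_apply, skewRes_single_mul_single,
        skewRes_single_mul_single, mul_comm b a]
      split_ifs with h
      · rw [← hI b, smul_mul', smul_smul, mul_comm b a, h, one_smul, mul_comm]
      · rfl

/-- Only opposite orders pair, so the adjoint of the projection to negative orders is the projection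
to positive orders. -/
theorem skewTrace_part_mul (A B : 𝒦) :
    skewTrace I (skewPart (Set.Iio 0) A * B) = skewTrace I (A * skewPart (Set.Ioi 0) B) := by
  induction A using SkewMonoidAlgebra.induction_on with
  | zero => simp
  | add A A' h h' => rw [map_add, add_mul, add_mul, map_add, map_add, h, h']
  | single a r =>
    induction B using SkewMonoidAlgebra.induction_on with
    | zero => simp
    | add A A' h h' => rw [map_add, mul_add, mul_add, map_add, map_add, h, h']
    | single b s =>
      rw [skewPart_single, skewPart_single]
      simp only [Set.mem_Iio, Set.mem_Ioi]
      have key : skewRes (single a r * single b s : 𝒦) = 0 ∨ (a.toAdd < 0 ↔ 0 < b.toAdd) := by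
        rw [skewRes_single_mul_single]
        by_cases h : a * b = 1
        · right
          have : a.toAdd + b.toAdd = 0 := h
          omega
        · left; rw [if_neg h]
      rcases key with h | h
      · have h' : skewTrace I (single a r * single b s : 𝒦) = 0 := by
          rw [skewTrace, AddMonoidHom.comp_apply, h, map_zero]
        split_ifs <;> simp only [h', zero_mul, mul_zero, map_zero]
      · simp only [h]
        split_ifs <;> simp only [zero_mul, mul_zero]

theorem skewRes_mul_of_nonpos {A B : 𝒦} (hA : ∀ g : Multiplicative ℤ, 0 < g.toAdd → A.coeff g = 0)
    (hB : ∀ g : Multiplicative ℤ, 0 < g.toAdd → B.coeff g = 0) :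
    (∀ g : Multiplicative ℤ, 0 < g.toAdd → (A * B).coeff g = 0) ∧
      skewRes (A * B) = skewRes A * skewRes B := by
  classical
  have key : ∀ g a : Multiplicative ℤ, 0 ≤ g.toAdd → a ≠ 1 ∨ 0 < g.toAdd →
      A.coeff a * a • B.coeff (a⁻¹ * g) = 0 := by
    intro g a hg ha
    by_cases h : 0 < a.toAdd
    · rw [hA a h, zero_mul]
    · rw [hB, smul_zero, mul_zero]
      change 0 < -a.toAdd + g.toAdd
      rcases ha with ha | ha
      · have : a.toAdd ≠ 0 := ha
        omega
      · omega
  constructor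
  · intro g hg
    rw [coeff_mul_left]
    exact Finset.sum_eq_zero fun a _ => key g a hg.le (Or.inr hg)
  · change (A * B).coeff 1 = A.coeff 1 * B.coeff 1
    rw [coeff_mul_left, sum_def, Finsupp.sum, Finset.sum_eq_single 1]
    · simp
    · intro a _ ha
      exact key 1 a le_rfl (Or.inl ha)
    · intro h
      rw [Finsupp.notMem_support_iff.1 h, zero_mul]

theorem skewRes_mul_of_nonneg {A B : 𝒦} (hA : ∀ g : Multiplicative ℤ, g.toAdd < 0 → A.coeff g = 0)
    (hB : ∀ g : Multiplicative ℤ, g.toAdd < 0 → B.coeff g = 0) :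
    (∀ g : Multiplicative ℤ, g.toAdd < 0 → (A * B).coeff g = 0) ∧
      skewRes (A * B) = skewRes A * skewRes B := by
  classical
  have key : ∀ g a : Multiplicative ℤ, g.toAdd ≤ 0 → a ≠ 1 ∨ g.toAdd < 0 →
      A.coeff a * a • B.coeff (a⁻¹ * g) = 0 := by
    intro g a hg ha
    by_cases h : a.toAdd < 0
    · rw [hA a h, zero_mul]
    · rw [hB, smul_zero, mul_zero]
      change -a.toAdd + g.toAdd < 0
      rcases ha with ha | ha
      · have : a.toAdd ≠ 0 := ha
        omega
      · omega
  constructor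
  · intro g hg
    rw [coeff_mul_left]
    exact Finset.sum_eq_zero fun a _ => key g a hg.le (Or.inr hg)
  · change (A * B).coeff 1 = A.coeff 1 * B.coeff 1
    rw [coeff_mul_left, sum_def, Finsupp.sum, Finset.sum_eq_single 1]
    · simp
    · intro a _ ha
      exact key 1 a le_rfl (Or.inl ha)
    · intro h
      rw [Finsupp.notMem_support_iff.1 h, zero_mul]

/-- On operators of nonpositive order the residue is multiplicative, with values in a commutative
ring, so it kills `A[B, C]`. -/
theorem skewTrace_commutator_nonpos {A B C : 𝒦}
    (hA : ∀ g : Multiplicative ℤ, 0 < g.toAdd → A.coeff g = 0)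
    (hB : ∀ g : Multiplicative ℤ, 0 < g.toAdd → B.coeff g = 0)
    (hC : ∀ g : Multiplicative ℤ, 0 < g.toAdd → C.coeff g = 0) :
    skewTrace I (A * (B * C - C * B)) = 0 := by
  have h1 := skewRes_mul_of_nonpos hB hC
  have h2 := skewRes_mul_of_nonpos hC hB
  rw [skewTrace, AddMonoidHom.comp_apply, mul_sub, map_sub, (skewRes_mul_of_nonpos hA h1.1).2,
    (skewRes_mul_of_nonpos hA h2.1).2, h1.2, h2.2, mul_comm (skewRes C), sub_self, map_zero]

theorem skewTrace_commutator_nonneg {A B C : 𝒦}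
    (hA : ∀ g : Multiplicative ℤ, g.toAdd < 0 → A.coeff g = 0)
    (hB : ∀ g : Multiplicative ℤ, g.toAdd < 0 → B.coeff g = 0)
    (hC : ∀ g : Multiplicative ℤ, g.toAdd < 0 → C.coeff g = 0) :
    skewTrace I (A * (B * C - C * B)) = 0 := by
  have h1 := skewRes_mul_of_nonneg hB hC
  have h2 := skewRes_mul_of_nonneg hC hB
  rw [skewTrace, AddMonoidHom.comp_apply, mul_sub, map_sub, (skewRes_mul_of_nonneg hA h1.1).2,
    (skewRes_mul_of_nonneg hA h2.1).2, h1.2, h2.2, mul_comm (skewRes C), sub_self, map_zero]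

end Skew

end BigradedToda

/-! ### Skew symmetry and Jacobi identity in the skew group ring. -/

namespace BigradedToda

open SkewMonoidAlgebra

section SkewBracket

variable {R E : Type*} [CommRing R] [AddCommGroup E]

local notation "𝒦" => SkewMonoidAlgebra R (Multiplicative ℤ)

/-- `(A)_- + g`. -/
def skewNeg (A : SkewMonoidAlgebra R (Multiplicative ℤ)) (g : R) :
    SkewMonoidAlgebra R (Multiplicative ℤ) := skewPart (Set.Iio 0) A + skewConst g

theorem skewNeg_add (A B : 𝒦) (g h : R) : skewNeg (A + B) (g + h) = skewNeg A g + skewNeg B h := by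
  simp only [skewNeg, map_add]; abel

theorem skewNeg_sub (A B : 𝒦) (g h : R) : skewNeg (A - B) (g - h) = skewNeg A g - skewNeg B h := by
  simp only [skewNeg, map_sub]; abel

theorem skewNeg_add_right (A B : 𝒦) (g : R) :
    skewNeg (A + B) g = skewNeg A g + skewPart (Set.Iio 0) B := by
  simp only [skewNeg, map_add]; abel

theorem skewNeg_sub_right (A B : 𝒦) (g : R) :
    skewNeg (A - B) g = skewNeg A g - skewPart (Set.Iio 0) B := by
  simp only [skewNeg, map_sub]; abel

theorem skewPart_pos_eq (A : 𝒦) (g : R) :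
    skewPart (Set.Ioi 0) A = A - skewNeg A g + skewConst (g - skewRes A) := by
  nth_rewrite 2 [← skewPart_add_const_add A]
  rw [skewNeg, map_sub]
  abel

variable [MulSemiringAction (Multiplicative ℤ) R]

/-- The second Hamiltonian operator at `L`, in the form `L((XL)_- + g) - ((LX)_- + σg)L`. -/
def skewP (σ : Multiplicative ℤ) (L X : SkewMonoidAlgebra R (Multiplicative ℤ)) (g : R) :
    SkewMonoidAlgebra R (Multiplicative ℤ) :=
  L * skewNeg (X * L) g - skewNeg (L * X) (σ • g) * L

/-- The first Hamiltonian operator at `L`, in the form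
`LX_- - X_-L + ((XL)_- + g) - ((LX)_- + σg)`. -/
def skewP1 (σ : Multiplicative ℤ) (L X : SkewMonoidAlgebra R (Multiplicative ℤ)) (g : R) :
    SkewMonoidAlgebra R (Multiplicative ℤ) :=
  L * skewPart (Set.Iio 0) X - skewPart (Set.Iio 0) X * L
    + (skewNeg (X * L) g - skewNeg (L * X) (σ • g))

/-- The derivative of `L ↦ skewP σ L X g` along `V`, the derivative of `g` being `g'`. -/
def skewPDeriv (σ : Multiplicative ℤ) (L V X : SkewMonoidAlgebra R (Multiplicative ℤ))
    (g g' : R) : SkewMonoidAlgebra R (Multiplicative ℤ) :=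
  V * skewNeg (X * L) g - skewNeg (L * X) (σ • g) * V
    + (L * skewNeg (X * V) g' - skewNeg (V * X) (σ • g') * L)

/-- The term of second order in the added 1 is `X_- - X_- = 0`, so `L ↦ skewP σ L X g` is affine
along the identity direction, with slope the first operator. -/
theorem skewP_add_one (σ : Multiplicative ℤ) (L X : 𝒦) (g : R) :
    skewP σ (L + 1) X g = skewP σ L X g + skewP1 σ L X g := by
  simp only [skewP, skewP1, mul_add, add_mul, mul_one, one_mul, skewNeg_add_right]
  abel

theorem skewP_sub_one (σ : Multiplicative ℤ) (L X : 𝒦) (g : R) :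
    skewP σ (L - 1) X g = skewP σ L X g - skewP1 σ L X g := by
  simp only [skewP, skewP1, mul_sub, sub_mul, mul_one, one_mul, skewNeg_sub_right]
  abel

theorem skewPDeriv_add_one (σ : Multiplicative ℤ) (L V X : 𝒦) (g g' : R) :
    skewPDeriv σ (L + 1) V X g g' = skewPDeriv σ L V X g g' + skewP1 σ V X g' := by
  simp only [skewPDeriv, skewP1, mul_add, add_mul, mul_one, one_mul, skewNeg_add_right]
  abel

theorem skewPDeriv_sub_one (σ : Multiplicative ℤ) (L V X : 𝒦) (g g' : R) :
    skewPDeriv σ (L - 1) V X g g' = skewPDeriv σ L V X g g' - skewP1 σ V X g' := by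
  simp only [skewPDeriv, skewP1, mul_sub, sub_mul, mul_one, one_mul, skewNeg_sub_right]
  abel

theorem skewPDeriv_add (σ : Multiplicative ℤ) (L V V' X : 𝒦) (g h h' : R) :
    skewPDeriv σ L (V + V') X g (h + h') = skewPDeriv σ L V X g h + skewPDeriv σ L V' X g h' := by
  simp only [skewPDeriv, add_mul, mul_add, smul_add, skewNeg_add]
  abel

theorem skewPDeriv_sub (σ : Multiplicative ℤ) (L V V' X : 𝒦) (g h h' : R) :
    skewPDeriv σ L (V - V') X g (h - h') = skewPDeriv σ L V X g h - skewPDeriv σ L V' X g h' := by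
  simp only [skewPDeriv, sub_mul, mul_sub, smul_sub, skewNeg_sub]
  abel

variable {I : R →+ E}

theorem skewTrace_mul_const (A : 𝒦) (r : R) :
    skewTrace I (A * skewConst r) = I (skewRes A * r) := by
  rw [skewTrace, AddMonoidHom.comp_apply, skewRes_mul_const]

theorem skewTrace_mul_neg (A B : 𝒦) (g : R) :
    skewTrace I (A * skewNeg B g) =
      skewTrace I (A * skewPart (Set.Iio 0) B) + I (skewRes A * g) := by
  rw [skewNeg, mul_add, map_add, skewTrace_mul_const]

theorem skewTrace_mul_neg_part (hI : ∀ (g : Multiplicative ℤ) (r : R), I (g • r) = I r)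
    (A B : 𝒦) : skewTrace I (A * skewPart (Set.Iio 0) B) =
      skewTrace I (B * skewPart (Set.Ioi 0) A) := by
  rw [skewTrace_mul_comm hI, skewTrace_part_mul]

theorem skewTrace_skewP (hI : ∀ (g : Multiplicative ℤ) (r : R), I (g • r) = I r)
    (σ : Multiplicative ℤ) (L X Y : 𝒦) (g : R) : skewTrace I (X * skewP σ L Y g) =
      skewTrace I ((X * L) * skewPart (Set.Iio 0) (Y * L)) + I (skewRes (X * L) * g)
      - (skewTrace I ((L * X) * skewPart (Set.Iio 0) (L * Y)) + I (skewRes (L * X) * σ • g)) := by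
  rw [← skewTrace_mul_neg, ← skewTrace_mul_neg, skewP, mul_sub, map_sub, ← mul_assoc, ← mul_assoc,
    skewTrace_mul_comm hI _ L, ← mul_assoc]

/-- The second term is the trace of `A` times the positive part of `B`, so only the zeroth-order
part of `B` is missing from `tr(AB)`. -/
theorem skewTrace_neg_add_neg (hI : ∀ (g : Multiplicative ℤ) (r : R), I (g • r) = I r)
    (A B : 𝒦) : skewTrace I (A * skewPart (Set.Iio 0) B) + skewTrace I (B * skewPart (Set.Iio 0) A)
      = skewTrace I (A * B) - I (skewRes A * skewRes B) := by
  rw [skewTrace_mul_neg_part hI B A, ← skewTrace_mul_const]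
  have e := congrArg (fun B' => skewTrace I (A * B')) (skewPart_add_const_add B)
  simp only [mul_add, map_add] at e
  rw [← e]
  abel

theorem skewP_skew (hI : ∀ (g : Multiplicative ℤ) (r : R), I (g • r) = I r)
    (σ : Multiplicative ℤ) {L X Y : 𝒦} {gX gY : R}
    (hX : σ • gX - gX = skewRes (L * X - X * L)) (hY : σ • gY - gY = skewRes (L * Y - Y * L)) :
    skewTrace I (X * skewP σ L Y gY) = -skewTrace I (Y * skewP σ L X gX) := by
  rw [map_sub] at hX hY
  have e1 := skewTrace_neg_add_neg hI (X * L) (Y * L)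
  have e2 := skewTrace_neg_add_neg hI (L * X) (L * Y)
  have e3 : skewTrace I (X * L * (Y * L)) = skewTrace I (L * X * (L * Y)) := by
    rw [← mul_assoc, skewTrace_mul_comm hI, ← mul_assoc, ← mul_assoc, ← mul_assoc]
  -- All residue terms collapse to `I(gX gY) - I(σ(gX gY))`, which vanishes by shift invariance.
  -- This is what the nonlocal term in the operator is for.
  have e4 : I (skewRes (X * L) * gY) - I (skewRes (L * X) * σ • gY)
      + (I (skewRes (Y * L) * gX) - I (skewRes (L * Y) * σ • gX))
      - I (skewRes (X * L) * skewRes (Y * L)) + I (skewRes (L * X) * skewRes (L * Y))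
      = 0 := by
    have h0 : I (gX * gY) - I (σ • (gX * gY)) = 0 := by rw [hI, sub_self]
    rw [← h0]
    simp only [← map_sub, ← map_add]
    congr 1
    rw [smul_mul', eq_add_of_sub_eq hX.symm, eq_add_of_sub_eq hY.symm]
    ring
  rw [eq_neg_iff_add_eq_zero, skewTrace_skewP hI, skewTrace_skewP hI, ← e4]
  rw [← sub_eq_zero] at e1 e2 e3
  have e5 := congrArg₂ (· + ·) (congrArg₂ (· - ·) e1 e2) e3
  simp only [sub_zero, add_zero] at e5
  rw [← sub_eq_zero, ← e5]
  abel

/-- The derivative of `⟨X, P(Y)⟩` along `V` for fixed `X` and `Y`, as a linear functional of `V`. -/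
theorem skewTrace_skewPDeriv (hI : ∀ (g : Multiplicative ℤ) (r : R), I (g • r) = I r)
    (σ : Multiplicative ℤ) {L V X Y : 𝒦} {gX gY g' : R}
    (hX : σ • gX - gX = skewRes (L * X - X * L)) (hV : σ • g' - g' = skewRes (V * Y - Y * V)) :
    skewTrace I (X * skewPDeriv σ L V Y gY g') =
      skewTrace I (V * (skewNeg (Y * L) gY * X - skewNeg (X * L) gX * Y
        + Y * skewNeg (L * X) (σ • gX) - X * skewNeg (L * Y) (σ • gY)
        + X * L * Y - Y * L * X)) := by
  have hc := skewTrace_mul_comm hI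
  have e1 : skewTrace I (X * (V * skewNeg (Y * L) gY)) =
      skewTrace I (V * (skewNeg (Y * L) gY * X)) := by rw [hc, mul_assoc]
  have e2 : skewTrace I (X * (skewNeg (L * Y) (σ • gY) * V)) =
      skewTrace I (V * (X * skewNeg (L * Y) (σ • gY))) := by rw [← mul_assoc, hc]
  -- To free `V` from the projection, `(YV)_-` is traded for the positive part of `XL`, rewritten as
  -- `XL` minus `(XL)_- + gX` plus a constant. The same is done with `LX` and `σ gX` in `e4`.
  have e3 : skewTrace I (X * (L * skewNeg (Y * V) g')) =
      skewTrace I (V * (X * L * Y)) - skewTrace I (V * (skewNeg (X * L) gX * Y))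
        + I (skewRes (Y * V) * (gX - skewRes (X * L))) + I (skewRes (X * L) * g') := by
    rw [← mul_assoc, skewTrace_mul_neg, skewTrace_mul_neg_part hI, skewPart_pos_eq _ gX, mul_add,
      map_add, skewTrace_mul_const, mul_sub, map_sub, hc (Y * V), hc (Y * V), ← mul_assoc,
      ← mul_assoc, hc _ V, hc _ V]
  have e4 : skewTrace I (X * (skewNeg (V * Y) (σ • g') * L)) =
      skewTrace I (V * (Y * L * X)) - skewTrace I (V * (Y * skewNeg (L * X) (σ • gX)))
        + I (skewRes (V * Y) * (σ • gX - skewRes (L * X))) + I (skewRes (L * X) * σ • g') := by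
    rw [← mul_assoc, hc, ← mul_assoc, skewTrace_mul_neg, skewTrace_mul_neg_part hI,
      skewPart_pos_eq _ (σ • gX), mul_add,
      map_add, skewTrace_mul_const, mul_sub, map_sub]
    simp only [mul_assoc]
  -- The leftover constants again reduce to `I(gX g') - I(σ(gX g'))`.
  have e5 : I (skewRes (Y * V) * (gX - skewRes (X * L))) + I (skewRes (X * L) * g')
      - I (skewRes (V * Y) * (σ • gX - skewRes (L * X))) - I (skewRes (L * X) * σ • g') = 0 := by
    have h0 : I (gX * g') - I (σ • (gX * g')) = 0 := by rw [hI, sub_self]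
    rw [map_sub] at hX hV
    rw [← h0]
    simp only [← map_sub, ← map_add]
    congr 1
    rw [smul_mul', eq_add_of_sub_eq hX.symm, eq_add_of_sub_eq hV.symm]
    ring
  rw [skewPDeriv]
  simp only [mul_add, mul_sub, map_add, map_sub] at e1 e2 e3 e4 e5 ⊢
  rw [e1, e2, e3, e4, ← sub_eq_zero, ← e5]
  abel

/-- No shape of `L` is assumed, only the existence of the preimages. This is what allows its use at
`L + 1` and `L - 1`. -/
theorem skewP_jacobi (hI : ∀ (g : Multiplicative ℤ) (r : R), I (g • r) = I r)
    (σ : Multiplicative ℤ) {L X Y Z : 𝒦} {gX gY gZ gXY gYZ gZX : R}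
    (hX : σ • gX - gX = skewRes (L * X - X * L)) (hY : σ • gY - gY = skewRes (L * Y - Y * L))
    (hZ : σ • gZ - gZ = skewRes (L * Z - Z * L))
    (hXY : σ • gXY - gXY = skewRes (skewP σ L Z gZ * Y - Y * skewP σ L Z gZ))
    (hYZ : σ • gYZ - gYZ = skewRes (skewP σ L X gX * Z - Z * skewP σ L X gX))
    (hZX : σ • gZX - gZX = skewRes (skewP σ L Y gY * X - X * skewP σ L Y gY)) :
    skewTrace I (X * skewPDeriv σ L (skewP σ L Z gZ) Y gY gXY)
      + skewTrace I (Y * skewPDeriv σ L (skewP σ L X gX) Z gZ gYZ)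
      + skewTrace I (Z * skewPDeriv σ L (skewP σ L Y gY) X gX gZX) = 0 := by
  rw [skewTrace_skewPDeriv hI σ hX hXY, skewTrace_skewPDeriv hI σ hY hYZ,
    skewTrace_skewPDeriv hI σ hZ hZX]
  exact trace_cyclic_sum (skewTrace I) (skewTrace_mul_comm hI) L X Y Z _ _ _ _ _ _
    (skewTrace_commutator_nonpos (neg_part_add_const_nonpos _ _) (neg_part_add_const_nonpos _ _)
      (neg_part_add_const_nonpos _ _))
    (skewTrace_commutator_nonneg (sub_neg_part_add_const_nonneg _ _)
      (sub_neg_part_add_const_nonneg _ _) (sub_neg_part_add_const_nonneg _ _))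
    (skewTrace_commutator_nonpos (neg_part_add_const_nonpos _ _) (neg_part_add_const_nonpos _ _)
      (neg_part_add_const_nonpos _ _))
    (skewTrace_commutator_nonneg (sub_neg_part_add_const_nonneg _ _)
      (sub_neg_part_add_const_nonneg _ _) (sub_neg_part_add_const_nonneg _ _))

theorem commutator_add_one (L X : 𝒦) : (L + 1) * X - X * (L + 1) = L * X - X * L := by
  rw [add_mul, mul_add, one_mul, mul_one]
  abel

theorem commutator_sub_one (L X : 𝒦) : (L - 1) * X - X * (L - 1) = L * X - X * L := by
  rw [sub_mul, mul_sub, one_mul, mul_one]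
  abel

theorem skewP1_skew (hI : ∀ (g : Multiplicative ℤ) (r : R), I (g • r) = I r)
    (σ : Multiplicative ℤ) {L X Y : 𝒦} {gX gY : R}
    (hX : σ • gX - gX = skewRes (L * X - X * L)) (hY : σ • gY - gY = skewRes (L * Y - Y * L)) :
    skewTrace I (X * skewP1 σ L Y gY) = -skewTrace I (Y * skewP1 σ L X gX) := by
  have h1 := skewP_skew hI σ hX hY
  have h2 := skewP_skew hI σ (L := L + 1) (X := X) (Y := Y) (gX := gX) (gY := gY)
    (by rw [commutator_add_one, hX]) (by rw [commutator_add_one, hY])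
  simp only [skewP_add_one, mul_add, map_add, h1] at h2
  rw [neg_add] at h2
  exact add_left_cancel h2

/-- The Schouten brackets of the two Hamiltonian operators with themselves and with each other
vanish. -/
theorem skewP_pencil_jacobi (hI : ∀ (g : Multiplicative ℤ) (r : R), I (g • r) = I r)
    (h2 : ∀ e : E, e + e = 0 → e = 0)
    (σ : Multiplicative ℤ) {L X Y Z : 𝒦} {gX gY gZ gXY gYZ gZX hXY hYZ hZX : R}
    (eX : σ • gX - gX = skewRes (L * X - X * L)) (eY : σ • gY - gY = skewRes (L * Y - Y * L))
    (eZ : σ • gZ - gZ = skewRes (L * Z - Z * L))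
    (eXY : σ • gXY - gXY = skewRes (skewP σ L Z gZ * Y - Y * skewP σ L Z gZ))
    (eYZ : σ • gYZ - gYZ = skewRes (skewP σ L X gX * Z - Z * skewP σ L X gX))
    (eZX : σ • gZX - gZX = skewRes (skewP σ L Y gY * X - X * skewP σ L Y gY))
    (fXY : σ • hXY - hXY = skewRes (skewP1 σ L Z gZ * Y - Y * skewP1 σ L Z gZ))
    (fYZ : σ • hYZ - hYZ = skewRes (skewP1 σ L X gX * Z - Z * skewP1 σ L X gX))
    (fZX : σ • hZX - hZX = skewRes (skewP1 σ L Y gY * X - X * skewP1 σ L Y gY)) :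
    (skewTrace I (X * skewPDeriv σ L (skewP σ L Z gZ) Y gY gXY)
      + skewTrace I (Y * skewPDeriv σ L (skewP σ L X gX) Z gZ gYZ)
      + skewTrace I (Z * skewPDeriv σ L (skewP σ L Y gY) X gX gZX) = 0) ∧
    ((skewTrace I (X * skewPDeriv σ L (skewP1 σ L Z gZ) Y gY hXY)
      + skewTrace I (X * skewP1 σ (skewP σ L Z gZ) Y gXY))
      + (skewTrace I (Y * skewPDeriv σ L (skewP1 σ L X gX) Z gZ hYZ)
      + skewTrace I (Y * skewP1 σ (skewP σ L X gX) Z gYZ))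
      + (skewTrace I (Z * skewPDeriv σ L (skewP1 σ L Y gY) X gX hZX)
      + skewTrace I (Z * skewP1 σ (skewP σ L Y gY) X gZX)) = 0) ∧
    (skewTrace I (X * skewP1 σ (skewP1 σ L Z gZ) Y hXY)
      + skewTrace I (Y * skewP1 σ (skewP1 σ L X gX) Z hYZ)
      + skewTrace I (Z * skewP1 σ (skewP1 σ L Y gY) X hZX) = 0) := by
  have k0 := skewP_jacobi hI σ eX eY eZ eXY eYZ eZX
  -- At `L + t` the Jacobi expression is a quadratic polynomial in `t`, whose coefficients are the
  -- three expressions in the claim. Its values at `t = 0, 1, -1` determine them after division by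
  -- 2, supplied by `h2`.
  have k1 := skewP_jacobi hI σ (L := L + 1) (X := X) (Y := Y) (Z := Z)
    (gX := gX) (gY := gY) (gZ := gZ) (gXY := gXY + hXY) (gYZ := gYZ + hYZ)
    (gZX := gZX + hZX)
    (by rw [commutator_add_one, eX]) (by rw [commutator_add_one, eY])
    (by rw [commutator_add_one, eZ])
    (by
      have e : ∀ A B : 𝒦, (A + B) * Y - Y * (A + B) =
          A * Y - Y * A + (B * Y - Y * B) := by
        intro A B; rw [add_mul, mul_add]; abel
      rw [skewP_add_one, e, map_add, ← eXY, ← fXY, smul_add]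
      abel)
    (by
      have e : ∀ A B : 𝒦, (A + B) * Z - Z * (A + B) =
          A * Z - Z * A + (B * Z - Z * B) := by
        intro A B; rw [add_mul, mul_add]; abel
      rw [skewP_add_one, e, map_add, ← eYZ, ← fYZ, smul_add]
      abel)
    (by
      have e : ∀ A B : 𝒦, (A + B) * X - X * (A + B) =
          A * X - X * A + (B * X - X * B) := by
        intro A B; rw [add_mul, mul_add]; abel
      rw [skewP_add_one, e, map_add, ← eZX, ← fZX, smul_add]
      abel)
  simp only [skewP_add_one, skewPDeriv_add_one, skewPDeriv_add, mul_add,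
    map_add] at k1
  have k2 := skewP_jacobi hI σ (L := L - 1) (X := X) (Y := Y) (Z := Z)
    (gX := gX) (gY := gY) (gZ := gZ) (gXY := gXY - hXY) (gYZ := gYZ - hYZ)
    (gZX := gZX - hZX)
    (by rw [commutator_sub_one, eX]) (by rw [commutator_sub_one, eY])
    (by rw [commutator_sub_one, eZ])
    (by
      have e : ∀ A B : 𝒦, (A - B) * Y - Y * (A - B) =
          A * Y - Y * A - (B * Y - Y * B) := by
        intro A B; rw [sub_mul, mul_sub]; abel
      rw [skewP_sub_one, e, map_sub, ← eXY, ← fXY, smul_sub]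
      abel)
    (by
      have e : ∀ A B : 𝒦, (A - B) * Z - Z * (A - B) =
          A * Z - Z * A - (B * Z - Z * B) := by
        intro A B; rw [sub_mul, mul_sub]; abel
      rw [skewP_sub_one, e, map_sub, ← eYZ, ← fYZ, smul_sub]
      abel)
    (by
      have e : ∀ A B : 𝒦, (A - B) * X - X * (A - B) =
          A * X - X * A - (B * X - X * B) := by
        intro A B; rw [sub_mul, mul_sub]; abel
      rw [skewP_sub_one, e, map_sub, ← eZX, ← fZX, smul_sub]
      abel)
  simp only [skewP_sub_one, skewPDeriv_sub_one, skewPDeriv_sub, mul_sub,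
    map_sub] at k2
  refine ⟨k0, h2 _ ?_, h2 _ ?_⟩
  · have := congrArg₂ (· - ·) k1 k2
    simp only [sub_zero] at this
    rw [← this]; abel
  · have := congrArg₂ (· - ·) (congrArg₂ (· + ·) k1 k2) (congrArg₂ (· + ·) k0 k0)
    simp only [sub_zero, add_zero] at this
    rw [← this]; abel

end SkewBracket

end BigradedToda

namespace BigradedToda

open PowerSeries

/-! ### Multiplication by the Lax operator -/

theorem uHat_eq_zero {N M : ℕ} {n : ℤ} (hn : n ∉ Finset.Icc (-(M : ℤ)) N) : uHat N M n = 0 := by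
  rw [Finset.mem_Icc] at hn
  rw [uHat, uVar, if_neg (by omega), dif_neg (by simp only [Set.mem_Ioo]; omega),
    if_neg (by omega), map_zero]

theorem uHat_top {N M : ℕ} (hN : 1 ≤ N) : uHat N M N = 1 := by
  rw [uHat, uVar, if_neg (by omega), dif_neg (by simp), if_pos rfl, map_one]

theorem lax_mul_apply {N M : ℕ} (X : DiffOp N M) (k : ℤ) : opMul (lax N M) X k =
    ∑ i ∈ Finset.Icc (-(M : ℤ)) N, uHat N M i * shift i (X (k - i)) := by
  refine finsum_eq_sum_of_support_subset _ fun i hi => ?_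
  by_contra h
  exact hi (by beta_reduce; rw [lax, uHat_eq_zero h, zero_mul])

theorem mul_lax_apply {N M : ℕ} (X : DiffOp N M) (k : ℤ) : opMul X (lax N M) k =
    ∑ i ∈ Finset.Icc (-(M : ℤ)) N, X (k - i) * shift (k - i) (uHat N M i) := by
  rw [opMul, ← finsum_comp_equiv (Equiv.subLeft k)]
  simp only [Equiv.subLeft_apply, sub_sub_cancel]
  refine finsum_eq_sum_of_support_subset _ fun i hi => ?_
  by_contra h
  exact hi (by beta_reduce; rw [lax, uHat_eq_zero h, shift_map_zero, mul_zero])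

/-- Left multiplication by the Lax operator. -/
def laxLeft (N M : ℕ) : DiffOp N M →ₗ[ℂ⟦X⟧] DiffOp N M where
  toFun X := opMul (lax N M) X
  map_add' X Y := by
    funext k
    simp only [Pi.add_apply, lax_mul_apply, shift_map_add, mul_add, Finset.sum_add_distrib]
  map_smul' c X := by
    funext k
    simp only [Pi.smul_apply, lax_mul_apply, shift_smul, mul_smul_comm, Finset.smul_sum,
      RingHom.id_apply]

/-- Right multiplication by the Lax operator. -/
def laxRight (N M : ℕ) : DiffOp N M →ₗ[ℂ⟦X⟧] DiffOp N M where
  toFun X := opMul X (lax N M)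
  map_add' X Y := by
    funext k
    simp only [Pi.add_apply, mul_lax_apply, add_mul, Finset.sum_add_distrib]
  map_smul' c X := by
    funext k
    simp only [Pi.smul_apply, mul_lax_apply, smul_mul_assoc, Finset.smul_sum, RingHom.id_apply]

theorem laxLeft_apply {N M : ℕ} (X : DiffOp N M) (k : ℤ) : laxLeft N M X k =
    ∑ i ∈ Finset.Icc (-(M : ℤ)) N, uHat N M i * shift i (X (k - i)) := lax_mul_apply X k

theorem laxRight_apply {N M : ℕ} (X : DiffOp N M) (k : ℤ) : laxRight N M X k =
    ∑ i ∈ Finset.Icc (-(M : ℤ)) N, X (k - i) * shift (k - i) (uHat N M i) := mul_lax_apply X k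

theorem opMul_lax_left {N M : ℕ} (X : DiffOp N M) : opMul (lax N M) X = laxLeft N M X := rfl

theorem opMul_lax_right {N M : ℕ} (X : DiffOp N M) : opMul X (lax N M) = laxRight N M X := rfl

/-- Associativity holds even for an infinite `X`, since `L` has finitely many terms. -/
theorem laxLeft_laxRight {N M : ℕ} (X : DiffOp N M) :
    laxLeft N M (laxRight N M X) = laxRight N M (laxLeft N M X) := by
  funext k
  simp only [laxLeft_apply, laxRight_apply, shift_map_sum, Finset.mul_sum, Finset.sum_mul]
  rw [Finset.sum_comm]
  refine Finset.sum_congr rfl fun j _ => Finset.sum_congr rfl fun i _ => ?_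
  rw [shift_mul, shift_shift, mul_assoc, sub_right_comm]
  congr 3
  ring

theorem laxLeft_apply_eq_zero {N M : ℕ} {X : DiffOp N M} {k : ℤ}
    (h : ∀ j, k - N ≤ j → j ≤ k + M → X j = 0) : laxLeft N M X k = 0 := by
  rw [laxLeft_apply]
  refine Finset.sum_eq_zero fun i hi => ?_
  rw [Finset.mem_Icc] at hi
  rw [h _ (by omega) (by omega), shift_map_zero, mul_zero]

theorem laxRight_apply_eq_zero {N M : ℕ} {X : DiffOp N M} {k : ℤ}
    (h : ∀ j, k - N ≤ j → j ≤ k + M → X j = 0) : laxRight N M X k = 0 := by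
  rw [laxRight_apply]
  refine Finset.sum_eq_zero fun i hi => ?_
  rw [Finset.mem_Icc] at hi
  rw [h _ (by omega) (by omega), zero_mul]

theorem laxLeft_monomialOp {N M : ℕ} (f : Hat N M) (j k : ℤ) :
    laxLeft N M (monomialOp f j) k = uHat N M (k - j) * shift (k - j) f := by
  rw [laxLeft_apply]
  by_cases hk : k - j ∈ Finset.Icc (-(M : ℤ)) N
  · rw [Finset.sum_eq_single_of_mem (k - j) hk]
    · rw [sub_sub_cancel, monomialOp, Pi.single_eq_same]
    · intro i _ hi
      rw [monomialOp, Pi.single_eq_of_ne (by omega), shift_map_zero, mul_zero]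
  · rw [uHat_eq_zero hk, zero_mul]
    refine Finset.sum_eq_zero fun i hi => ?_
    rw [monomialOp, Pi.single_eq_of_ne (fun h => hk (by rwa [← h, sub_sub_cancel])),
      shift_map_zero, mul_zero]

theorem laxRight_monomialOp {N M : ℕ} (f : Hat N M) (j k : ℤ) :
    laxRight N M (monomialOp f j) k = f * shift j (uHat N M (k - j)) := by
  rw [laxRight_apply]
  by_cases hk : k - j ∈ Finset.Icc (-(M : ℤ)) N
  · rw [Finset.sum_eq_single_of_mem (k - j) hk]
    · rw [sub_sub_cancel, monomialOp, Pi.single_eq_same]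
    · intro i _ hi
      rw [monomialOp, Pi.single_eq_of_ne (by omega), zero_mul]
  · rw [uHat_eq_zero hk, shift_map_zero, mul_zero]
    refine Finset.sum_eq_zero fun i hi => ?_
    rw [monomialOp, Pi.single_eq_of_ne (fun h => hk (by rwa [← h, sub_sub_cancel])), zero_mul]

theorem laxLeft_const {N M : ℕ} (f : Hat N M) (k : ℤ) :
    laxLeft N M (monomialOp f 0) k = uHat N M k * shift k f := by
  rw [laxLeft_monomialOp, sub_zero]

theorem laxRight_const {N M : ℕ} (f : Hat N M) (k : ℤ) :
    laxRight N M (monomialOp f 0) k = uHat N M k * f := by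
  rw [laxRight_monomialOp, sub_zero, shift_zero, mul_comm]

/-! ### The operator `Λ^N - 1` -/

theorem hatD_symbolLin {N M : ℕ} (φ : ℂ⟦X⟧) (f : Hat N M) :
    hatD N M (symbolLin φ f) = symbolLin φ (hatD N M f) := by
  rw [hatD_eq_extLin, symbolLin]
  refine extLin_comm (fun a b p => ?_) f
  by_cases ha : a = 0
  · rw [if_pos ha, LinearMap.smul_apply, LinearMap.smul_apply, map_smul, Module.End.pow_apply,
      Module.End.pow_apply]
    exact congrArg _ (Function.iterate_succ_apply' _ _ _).symm
  · rw [if_neg ha, LinearMap.zero_apply, LinearMap.zero_apply, map_zero]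

theorem constantCoeff_expDiffQuot_ne {a b : ℤ} (h : a ≠ b) :
    constantCoeff (expDiffQuot a b) ≠ 0 := by
  rw [← coeff_zero_eq_constantCoeff_apply, expDiffQuot, coeff_mk, map_sub, coeff_expSymbol,
    coeff_expSymbol]
  simpa [sub_eq_zero] using h

/-- `Λ^m - 1` is `ε∂ₓ` composed with an invertible series in `ε∂ₓ` of constant term `m`, and `ε` is
not a zero divisor. -/
theorem hatD_eq_zero_of_shift {N M : ℕ} {m : ℤ} (hm : m ≠ 0) {f : Hat N M} (h : shift m f = f) :
    hatD N M f = 0 := by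
  have h1 : (X : ℂ⟦X⟧) • hatD N M (symbolLin (expDiffQuot m 0) f) = 0 := by
    rw [← symbolLin_X, ← symbolLin_mul, ← expSymbol_sub_one, symbolLin_sub, symbolLin_one,
      sub_eq_zero]
    rwa [shift_eq] at h
  have h2 : symbolLin (expDiffQuot m 0) (hatD N M f) = 0 := by
    rw [← hatD_symbolLin]
    refine PowerSeries.ext fun j => ?_
    rw [← coeff_X_smul, h1, map_zero, map_zero]
  rw [← symbolLin_one (hatD N M f), ← PowerSeries.mul_inv_cancel _
    (constantCoeff_expDiffQuot_ne hm),
    mul_comm, symbolLin_mul, h2, map_zero]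

theorem shift_eq_self_of_hatD {N M : ℕ} {f : Hat N M} (h : hatD N M f = 0) (m : ℤ) :
    shift m f = f := by
  rw [← sub_eq_zero, shift_eq, shiftLin]
  nth_rewrite 2 [← symbolLin_one f]
  rw [← symbolLin_sub, expSymbol_sub_one, mul_comm, symbolLin_mul, symbolLin_X, h, smul_zero,
    map_zero]

/-- The symbol `(e^{mλ} - 1) / (e^{Nλ} - 1)`. -/
def ratioSymbol (N : ℕ) (m : ℤ) : ℂ⟦X⟧ := expDiffQuot m 0 * (expDiffQuot N 0)⁻¹

theorem ratioSymbol_spec {N : ℕ} (hN : 1 ≤ N) (m : ℤ) :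
    (expSymbol N - 1) * ratioSymbol N m = expSymbol m - 1 := by
  rw [expSymbol_sub_one, expSymbol_sub_one, ratioSymbol]
  have := PowerSeries.mul_inv_cancel (expDiffQuot N 0)
    (constantCoeff_expDiffQuot_ne (by omega : (N : ℤ) ≠ 0))
  linear_combination X * expDiffQuot m 0 * this

theorem shift_sub_self_ratioSymbol {N M : ℕ} (hN : 1 ≤ N) (m : ℤ) (f : Hat N M) :
    shift N (symbolLin (ratioSymbol N m) f) - symbolLin (ratioSymbol N m) f = shift m f - f := by
  have h := congrArg (fun φ => symbolLin φ f) (ratioSymbol_spec hN m)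
  simp only [symbolLin_sub, symbolLin_mul, symbolLin_one] at h
  rw [shift_eq, shift_eq]
  exact h

theorem res_opComm {N M : ℕ} (X : DiffOp N M) :
    res (opComm (lax N M) X) = laxLeft N M X 0 - laxRight N M X 0 := rfl

/-- The term of `res [L, X]` containing `u_i` is `(Λ^i - 1)(X_{-i} Λ^{-i} u_i)`, and `Λ^i - 1` is
divisible by `Λ^N - 1`. -/
theorem exists_shift_sub_eq_res {N M : ℕ} (hN : 1 ≤ N) (X : DiffOp N M) :
    ∃ g : Hat N M, shift N g - g = res (opComm (lax N M) X) := by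
  refine ⟨∑ i ∈ Finset.Icc (-(M : ℤ)) N,
    symbolLin (ratioSymbol N i) (X (-i) * shift (-i) (uHat N M i)), ?_⟩
  rw [res_opComm, laxLeft_apply, laxRight_apply, shift_map_sum, ← Finset.sum_sub_distrib,
    ← Finset.sum_sub_distrib]
  refine Finset.sum_congr rfl fun i _ => ?_
  rw [shift_sub_self_ratioSymbol hN, zero_sub, shift_mul, shift_shift, add_neg_cancel, shift_zero,
    mul_comm (shift i _)]

/-! ### The Hamiltonian operators -/

theorem part_of_mem {N M : ℕ} {S : Set ℤ} {k : ℤ} (A : DiffOp N M) (h : k ∈ S) :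
    part S A k = A k := Set.indicator_of_mem h A

theorem part_of_notMem {N M : ℕ} {S : Set ℤ} {k : ℤ} (A : DiffOp N M) (h : k ∉ S) :
    part S A k = 0 := Set.indicator_of_notMem h A

/-- `A_- + f`. -/
def negAdd {N M : ℕ} (A : DiffOp N M) (f : Hat N M) : DiffOp N M :=
  part (Set.Iio 0) A + monomialOp f 0

theorem negAdd_apply_neg {N M : ℕ} (A : DiffOp N M) (f : Hat N M) {k : ℤ} (hk : k < 0) :
    negAdd A f k = A k := by
  rw [negAdd, Pi.add_apply, part_of_mem A (Set.mem_Iio.2 hk), monomialOp,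
    Pi.single_eq_of_ne hk.ne, add_zero]

theorem negAdd_apply_zero {N M : ℕ} (A : DiffOp N M) (f : Hat N M) : negAdd A f 0 = f := by
  rw [negAdd, Pi.add_apply, part_of_notMem A (by simp), monomialOp,
    Pi.single_eq_same, zero_add]

theorem negAdd_apply_pos {N M : ℕ} (A : DiffOp N M) (f : Hat N M) {k : ℤ} (hk : 0 < k) :
    negAdd A f k = 0 := by
  rw [negAdd, Pi.add_apply, part_of_notMem A (by simp [hk.le]), monomialOp,
    Pi.single_eq_of_ne hk.ne', zero_add]

theorem part_add {N M : ℕ} (S : Set ℤ) (A B : DiffOp N M) :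
    part S (A + B) = part S A + part S B := Set.indicator_add' _ _ _

theorem part_sub {N M : ℕ} (S : Set ℤ) (A B : DiffOp N M) :
    part S (A - B) = part S A - part S B := Set.indicator_sub' _ _ _

theorem part_Iic_eq {N M : ℕ} (A : DiffOp N M) : part (Set.Iic 0) A = negAdd A (A 0) := by
  funext k
  rcases lt_trichotomy k 0 with h | rfl | h
  · rw [negAdd_apply_neg _ _ h, part_of_mem A (by simpa using h.le)]
  · rw [negAdd_apply_zero, part_of_mem A (by simp)]
  · rw [negAdd_apply_pos _ _ h, part_of_notMem A (by simpa using h)]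

theorem monomialOp_add {N M : ℕ} (f g : Hat N M) (k : ℤ) :
    monomialOp (f + g) k = monomialOp f k + monomialOp g k := Pi.single_add _ _ _

theorem monomialOp_sub {N M : ℕ} (f g : Hat N M) (k : ℤ) :
    monomialOp (f - g) k = monomialOp f k - monomialOp g k := Pi.single_sub _ _ _

theorem half_smul_identity {V : Type*} [AddCommGroup V] [Module ℂ V]
    (a b c d p q r s : V) :
    (1 / 2 : ℂ) • (a + b - (c + d)) - (1 / 2 : ℂ) • (a - b + (p - q))
      - (1 / 2 : ℂ) • (c - d + (r - s)) + (1 / 2 : ℂ) • (p + q - (r + s))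
      = b + q - (c + r) := by
  module

/-- The order-zero part of `[L, X]_{≤0}` is `(Λ^N - 1) g`. Combined with `½(Λ^N + 1) g` it leaves
`g` to the right of `L` and `Λ^N g` to the left, while the halves of the negative parts merge
likewise. -/
theorem P₂With_eq {N M : ℕ} {X : DiffOp N M} {g : Hat N M}
    (hg : shift N g - g = res (opComm (lax N M) X)) :
    P₂With N M X g = laxLeft N M (negAdd (laxRight N M X) g)
      - laxRight N M (negAdd (laxLeft N M X) (shift N g)) := by
  rw [P₂With, part_Iic_eq, show opComm (lax N M) X 0 = shift N g - g from hg.symm]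
  simp only [opComm, opMul_lax_left, opMul_lax_right, negAdd, part_add, part_sub, monomialOp_add,
    monomialOp_sub, map_add, map_sub]
  exact half_smul_identity _ _ _ _ _ _ _ _

/-- Substituting `X_+ = X - X_-` and `A_{>0} = A - A_{≤0}` gives `P₁(X) = [L, X_-] + [X, L]_{≤0}`.
The function `g` only rewrites the order-zero term in the shape of `skewP1`. -/
theorem P₁_eq {N M : ℕ} {X : DiffOp N M} {g : Hat N M}
    (hg : shift N g - g = res (opComm (lax N M) X)) :
    P₁ N M X = laxLeft N M (part (Set.Iio 0) X) - laxRight N M (part (Set.Iio 0) X)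
      + (negAdd (laxRight N M X) g - negAdd (laxLeft N M X) (shift N g)) := by
  have e1 : part (Set.Ici 0) X = X - part (Set.Iio 0) X := by
    rw [eq_sub_iff_add_eq, add_comm, part, part, ← Set.compl_Iio, Set.indicator_self_add_compl]
  have e2 : ∀ A : DiffOp N M, part (Set.Ioi 0) A = A - part (Set.Iic 0) A := by
    intro A
    rw [eq_sub_iff_add_eq, add_comm, part, part, ← Set.compl_Iic, Set.indicator_self_add_compl]
  have e3 : opComm X (lax N M) 0 = g - shift N g := by
    rw [← neg_sub (shift _ g), hg]
    exact (neg_sub _ _).symm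
  rw [P₁, e1, e2]
  have e4 : opComm (X - part (Set.Iio 0) X) (lax N M) =
      opComm X (lax N M) - opComm (part (Set.Iio 0) X) (lax N M) := by
    simp only [opComm, opMul_lax_left, opMul_lax_right, map_sub]
    abel
  rw [e4, part_sub, part_Iic_eq (opComm X _), e3]
  simp only [opComm, opMul_lax_left, opMul_lax_right, negAdd, part_sub, monomialOp_sub]
  abel

/-- The difference of two preimages is fixed by `Λ^N`, hence killed by `∂ₓ`, hence fixed by all
shifts, and so commutes with `L`. -/
theorem P₂With_unique {N M : ℕ} (hN : 1 ≤ N) {X : DiffOp N M} {g g' : Hat N M}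
    (hg : shift N g - g = res (opComm (lax N M) X))
    (hg' : shift N g' - g' = res (opComm (lax N M) X)) : P₂With N M X g = P₂With N M X g' := by
  have hc : shift N (g - g') = g - g' := by
    have := hg.trans hg'.symm
    rw [shift_eq, map_sub, ← shift_eq, ← shift_eq]
    linear_combination this
  have hk := shift_eq_self_of_hatD (hatD_eq_zero_of_shift (by omega) hc)
  have h0 : laxLeft N M (monomialOp (g - g') 0)
      = laxRight N M (monomialOp (shift N (g - g')) 0) := by
    funext k
    rw [laxLeft_const, laxRight_const, hk, hk]
  have hs : shift N (g - g') = shift N g - shift N g' := by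
    simp only [shift_eq, map_sub]
  rw [hs, monomialOp_sub, monomialOp_sub, map_sub, map_sub] at h0
  rw [P₂With_eq hg, P₂With_eq hg', negAdd, negAdd, negAdd, negAdd, map_add, map_add, map_add,
    map_add]
  rw [← sub_eq_zero] at h0 ⊢
  rw [← h0]
  abel

theorem P₂_eq_P₂With {N M : ℕ} (hN : 1 ≤ N) {X : DiffOp N M} {g : Hat N M}
    (hg : shift N g - g = res (opComm (lax N M) X)) : P₂ N M X = P₂With N M X g :=
  P₂With_unique hN (Function.invFun_eq (f := fun g : Hat N M => shift N g - g)
    (exists_shift_sub_eq_res hN X)) hg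

theorem P₂_eq {N M : ℕ} (hN : 1 ≤ N) {X : DiffOp N M} {g : Hat N M}
    (hg : shift N g - g = res (opComm (lax N M) X)) :
    P₂ N M X = laxLeft N M (negAdd (laxRight N M X) g)
      - laxRight N M (negAdd (laxLeft N M X) (shift N g)) := by
  rw [P₂_eq_P₂With hN hg, P₂With_eq hg]

theorem part_smul {N M : ℕ} (S : Set ℤ) (c : ℂ⟦X⟧) (A : DiffOp N M) :
    part S (c • A) = c • part S A :=
  (Set.indicator_const_smul S c A : S.indicator (fun k => c • A k) = _)

theorem negAdd_add {N M : ℕ} (A B : DiffOp N M) (f g : Hat N M) :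
    negAdd (A + B) (f + g) = negAdd A f + negAdd B g := by
  simp only [negAdd, part_add, monomialOp_add]; abel

theorem negAdd_smul {N M : ℕ} (c : ℂ⟦X⟧) (A : DiffOp N M) (f : Hat N M) :
    negAdd (c • A) (c • f) = c • negAdd A f := by
  rw [negAdd, negAdd, part_smul, smul_add, monomialOp, monomialOp, Pi.single_smul]

theorem res_opComm_add {N M : ℕ} (X Y : DiffOp N M) : res (opComm (lax N M) (X + Y)) =
    res (opComm (lax N M) X) + res (opComm (lax N M) Y) := by
  simp only [res_opComm, map_add, Pi.add_apply]; ring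

theorem res_opComm_smul {N M : ℕ} (c : ℂ⟦X⟧) (X : DiffOp N M) :
    res (opComm (lax N M) (c • X)) = c • res (opComm (lax N M) X) := by
  simp only [res_opComm, map_smul, Pi.smul_apply, smul_sub]

/-- The first Hamiltonian operator as a linear map. -/
def P₁Lin {N M : ℕ} (hN : 1 ≤ N) : DiffOp N M →ₗ[ℂ⟦X⟧] DiffOp N M where
  toFun := P₁ N M
  map_add' X Y := by
    obtain ⟨g, hg⟩ := exists_shift_sub_eq_res hN X
    obtain ⟨h, hh⟩ := exists_shift_sub_eq_res hN Y
    rw [P₁_eq hg, P₁_eq hh, P₁_eq (g := g + h) (by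
      rw [shift_map_add, res_opComm_add, ← hg, ← hh]; ring)]
    simp only [map_add, part_add, shift_map_add, negAdd_add]
    abel
  map_smul' c X := by
    obtain ⟨g, hg⟩ := exists_shift_sub_eq_res hN X
    rw [P₁_eq hg, P₁_eq (g := c • g) (by
      rw [shift_smul, res_opComm_smul, ← hg, smul_sub])]
    simp only [map_smul, part_smul, shift_smul, negAdd_smul, RingHom.id_apply]
    simp only [smul_sub, smul_add]

/-- The second Hamiltonian operator as a linear map. -/
def P₂Lin {N M : ℕ} (hN : 1 ≤ N) : DiffOp N M →ₗ[ℂ⟦X⟧] DiffOp N M where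
  toFun := P₂ N M
  map_add' X Y := by
    obtain ⟨g, hg⟩ := exists_shift_sub_eq_res hN X
    obtain ⟨h, hh⟩ := exists_shift_sub_eq_res hN Y
    rw [P₂_eq hN hg, P₂_eq hN hh, P₂_eq hN (g := g + h) (by
      rw [shift_map_add, res_opComm_add, ← hg, ← hh]; ring)]
    simp only [map_add, shift_map_add, negAdd_add]
    abel
  map_smul' c X := by
    obtain ⟨g, hg⟩ := exists_shift_sub_eq_res hN X
    rw [P₂_eq hN hg, P₂_eq hN (g := c • g) (by
      rw [shift_smul, res_opComm_smul, ← hg, smul_sub])]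
    simp only [map_smul, shift_smul, negAdd_smul, RingHom.id_apply]
    simp only [smul_sub]

/-- Order count: `[X_+, L]` has no order below `-M`, and `[X_-, L]` none above `N - 1`. -/
theorem P₁_tangent {N M : ℕ} (hN : 1 ≤ N) (X : DiffOp N M) : IsTangent (P₁ N M X) := by
  intro k hk
  have h1 : part (Set.Iic 0) (opComm (part (Set.Ici 0) X) (lax N M)) k = 0 := by
    by_cases hk0 : k ≤ 0
    · have hk' : k < -(M : ℤ) := by
        by_contra h
        exact hk (Finset.mem_Ico.2 (by omega))
      rw [part_of_mem _ (by simpa using hk0), opComm, Pi.sub_apply, opMul_lax_left,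
        opMul_lax_right, laxLeft_apply_eq_zero, laxRight_apply_eq_zero, sub_zero]
      all_goals exact fun j _ _ => part_of_notMem _ (by simp only [Set.mem_Ici]; omega)
    · exact part_of_notMem _ (by simpa using hk0)
  have h2 : part (Set.Ioi 0) (opComm (part (Set.Iio 0) X) (lax N M)) k = 0 := by
    by_cases hk0 : 0 < k
    · have hk' : (N : ℤ) ≤ k := by
        by_contra h
        exact hk (Finset.mem_Ico.2 (by omega))
      rw [part_of_mem _ (by simpa using hk0), opComm, Pi.sub_apply, opMul_lax_left,
        opMul_lax_right, laxLeft_apply_eq_zero, laxRight_apply_eq_zero, sub_zero]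
      all_goals exact fun j _ _ => part_of_notMem _ (by simp only [Set.mem_Iio]; omega)
    · exact part_of_notMem _ (by simpa using hk0)
  rw [P₁, Pi.sub_apply, h1, h2, sub_zero]

/-- Orders `≤ 0` of `[X_+, L]` involve only `X_j` with `0 ≤ j ≤ M`, and orders `> 0` of `[X_-, L]`
only those with `-N < j < 0`. -/
theorem P₁_null {N M : ℕ} (hN : 1 ≤ N) {X : DiffOp N M}
    (hX : ∀ n ∈ Finset.Ico (-(M : ℤ)) N, X (-n) = 0) : P₁ N M X = 0 := by
  have hX' : ∀ j : ℤ, -(N : ℤ) < j → j ≤ M → X j = 0 := fun j h1 h2 => by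
    have := hX (-j) (Finset.mem_Ico.2 (by omega))
    rwa [neg_neg] at this
  funext k
  have h1 : part (Set.Iic 0) (opComm (part (Set.Ici 0) X) (lax N M)) k = 0 := by
    by_cases hk0 : k ≤ 0
    · have h : ∀ j, k - N ≤ j → j ≤ k + M → part (Set.Ici 0) X j = 0 := fun j _ hj => by
        by_cases hj0 : 0 ≤ j
        · rw [part_of_mem _ (by simpa using hj0)]
          exact hX' j (by omega) (by omega)
        · exact part_of_notMem _ (by simpa using hj0)
      rw [part_of_mem _ (by simpa using hk0), opComm, Pi.sub_apply, opMul_lax_left,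
        opMul_lax_right, laxLeft_apply_eq_zero h, laxRight_apply_eq_zero h, sub_zero]
    · exact part_of_notMem _ (by simpa using hk0)
  have h2 : part (Set.Ioi 0) (opComm (part (Set.Iio 0) X) (lax N M)) k = 0 := by
    by_cases hk0 : 0 < k
    · have h : ∀ j, k - N ≤ j → j ≤ k + M → part (Set.Iio 0) X j = 0 := fun j hj _ => by
        by_cases hj0 : j < 0
        · rw [part_of_mem _ (by simpa using hj0)]
          exact hX' j (by omega) (by omega)
        · exact part_of_notMem _ (by simpa using hj0)
      rw [part_of_mem _ (by simpa using hk0), opComm, Pi.sub_apply, opMul_lax_left,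
        opMul_lax_right, laxLeft_apply_eq_zero h, laxRight_apply_eq_zero h, sub_zero]
    · exact part_of_notMem _ (by simpa using hk0)
  rw [P₁, Pi.sub_apply, h1, h2, sub_zero, Pi.zero_apply]

/-- Below order `-M` the projections are invisible and the expression is `L(XL) - (LX)L = 0`. From
order `N` on only the constants contribute, and at `Λ^N` they cancel thanks to the twist `Λ^N g`. -/
theorem P₂_tangent {N M : ℕ} (hN : 1 ≤ N) (X : DiffOp N M) : IsTangent (P₂ N M X) := by
  intro k hk
  obtain ⟨g, hg⟩ := exists_shift_sub_eq_res hN X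
  rw [P₂_eq hN hg, Pi.sub_apply]
  rcases lt_or_ge k (-(M : ℤ)) with h | h
  · have e1 : laxLeft N M (negAdd (laxRight N M X) g) k = laxLeft N M (laxRight N M X) k := by
      rw [← sub_eq_zero, ← Pi.sub_apply, ← map_sub]
      refine laxLeft_apply_eq_zero fun j _ _ => ?_
      rw [Pi.sub_apply, negAdd_apply_neg _ _ (by omega), sub_self]
    have e2 : laxRight N M (negAdd (laxLeft N M X) (shift N g)) k
        = laxRight N M (laxLeft N M X) k := by
      rw [← sub_eq_zero, ← Pi.sub_apply, ← map_sub]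
      refine laxRight_apply_eq_zero fun j _ _ => ?_
      rw [Pi.sub_apply, negAdd_apply_neg _ _ (by omega), sub_self]
    rw [e1, e2, laxLeft_laxRight, sub_self]
  · have hk' : (N : ℤ) ≤ k := by
      by_contra h'
      exact hk (Finset.mem_Ico.2 (by omega))
    have h1 : ∀ A : DiffOp N M, ∀ j, k - N ≤ j → j ≤ k + M → part (Set.Iio 0) A j = 0 :=
      fun A j _ _ => part_of_notMem _ (by simp only [Set.mem_Iio]; omega)
    rw [negAdd, negAdd, map_add, map_add, Pi.add_apply, Pi.add_apply, laxLeft_const,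
      laxRight_const, laxLeft_apply_eq_zero (h1 _), laxRight_apply_eq_zero (h1 _)]
    rcases hk'.eq_or_lt with rfl | h'
    · rw [sub_self]
    · rw [uHat_eq_zero (by simp only [Finset.mem_Icc]; omega)]
      simp

theorem P₂_null {N M : ℕ} (hN : 1 ≤ N) {X : DiffOp N M}
    (hX : ∀ n ∈ Finset.Ico (-(M : ℤ)) N, X (-n) = 0) : P₂ N M X = 0 := by
  have hX' : ∀ j : ℤ, -(N : ℤ) < j → j ≤ M → X j = 0 := fun j h1 h2 => by
    have := hX (-j) (Finset.mem_Ico.2 (by omega))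
    rwa [neg_neg] at this
  -- The coefficients of `X` above order `M` reach only positive orders of `LX` and `XL`, so just
  -- the tail of order `≤ -N` matters.
  set Y : DiffOp N M := part (Set.Iic (-(N : ℤ))) X with hY
  have hYX : ∀ j : ℤ, j ≤ M → Y j = X j := fun j hj => by
    by_cases h : j ≤ -(N : ℤ)
    · exact part_of_mem _ (Set.mem_Iic.2 h)
    · rw [hX' j (by omega) hj]
      exact part_of_notMem _ (by simpa using h)
  have hY0 : ∀ j, -(N : ℤ) < j → Y j = 0 := fun j hj =>
    part_of_notMem _ (by simpa using hj)
  have hNmem : (N : ℤ) ∈ Finset.Icc (-(M : ℤ)) N := Finset.mem_Icc.2 (by omega)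
  have hl0 : laxLeft N M Y 0 = shift N (X (-N)) := by
    rw [laxLeft_apply, Finset.sum_eq_single_of_mem _ hNmem, uHat_top hN, one_mul, zero_sub,
      hYX _ (by omega)]
    intro i hi hne
    rw [Finset.mem_Icc] at hi
    rw [hY0 _ (by omega), shift_map_zero, mul_zero]
  have hr0 : laxRight N M Y 0 = X (-N) := by
    rw [laxRight_apply, Finset.sum_eq_single_of_mem _ hNmem, uHat_top hN, shift_one, mul_one,
      zero_sub, hYX _ (by omega)]
    intro i hi hne
    rw [Finset.mem_Icc] at hi
    rw [hY0 _ (by omega), zero_mul]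
  have hlX : ∀ j ≤ 0, laxLeft N M X j = laxLeft N M Y j := fun j hj => by
    rw [← sub_eq_zero, ← Pi.sub_apply, ← map_sub]
    refine laxLeft_apply_eq_zero fun i _ _ => ?_
    rw [Pi.sub_apply, hYX i (by omega), sub_self]
  have hrX : ∀ j ≤ 0, laxRight N M X j = laxRight N M Y j := fun j hj => by
    rw [← sub_eq_zero, ← Pi.sub_apply, ← map_sub]
    refine laxRight_apply_eq_zero fun i _ _ => ?_
    rw [Pi.sub_apply, hYX i (by omega), sub_self]
  -- `YL` and `LY` have order at most 0, with leading coefficients `X_{-N}` and `Λ^N X_{-N}`. With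
  -- `g = X_{-N}` the brackets in `P₂` become the full products, and associativity gives 0.
  have hg : shift N (X (-N)) - X (-N) = res (opComm (lax N M) X) := by
    rw [res_opComm, hlX 0 le_rfl, hrX 0 le_rfl, hl0, hr0]
  have e1 : negAdd (laxRight N M X) (X (-N)) = laxRight N M Y := by
    funext k
    rcases lt_trichotomy k 0 with h | rfl | h
    · rw [negAdd_apply_neg _ _ h, hrX k h.le]
    · rw [negAdd_apply_zero, hr0]
    · rw [negAdd_apply_pos _ _ h, laxRight_apply_eq_zero fun j _ _ => hY0 j (by omega)]
  have e2 : negAdd (laxLeft N M X) (shift N (X (-N))) = laxLeft N M Y := by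
    funext k
    rcases lt_trichotomy k 0 with h | rfl | h
    · rw [negAdd_apply_neg _ _ h, hlX k h.le]
    · rw [negAdd_apply_zero, hl0]
    · rw [negAdd_apply_pos _ _ h, laxLeft_apply_eq_zero fun j _ _ => hY0 j (by omega)]
  rw [P₂_eq hN hg, e1, e2, laxLeft_laxRight, sub_self]

end BigradedToda

namespace BigradedToda

open SkewMonoidAlgebra

/-! ### Finite difference operators as elements of a skew group ring -/

/-- The group `ℤ`, written multiplicatively, acts on `𝒜⟦ε⟧` by shifts. -/
instance shiftAction (N M : ℕ) : MulSemiringAction (Multiplicative ℤ) (Hat N M) where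
  smul g f := shift g.toAdd f
  one_smul := shift_zero
  mul_smul g h f := (shift_shift g.toAdd h.toAdd f).symm
  smul_zero g := shift_map_zero g.toAdd
  smul_add g := shift_map_add g.toAdd
  smul_one g := shift_one g.toAdd
  smul_mul g := shift_mul g.toAdd

theorem ofAdd_smul_eq_shift {N M : ℕ} (k : ℤ) (f : Hat N M) :
    Multiplicative.ofAdd k • f = shift k f := rfl

/-- The difference operator given by an element of the skew group ring. -/
def opOf {N M : ℕ} (A : SkewMonoidAlgebra (Hat N M) (Multiplicative ℤ)) : DiffOp N M :=
  fun k => A.coeff (Multiplicative.ofAdd k)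

theorem opOf_sub {N M : ℕ} (A B : SkewMonoidAlgebra (Hat N M) (Multiplicative ℤ)) :
    opOf (A - B) = opOf A - opOf B := by
  funext k
  rw [opOf, coeff_sub]
  rfl

theorem opOf_add {N M : ℕ} (A B : SkewMonoidAlgebra (Hat N M) (Multiplicative ℤ)) :
    opOf (A + B) = opOf A + opOf B := by
  funext k
  rw [opOf, coeff_add]
  rfl

theorem opOf_mul {N M : ℕ} (A B : SkewMonoidAlgebra (Hat N M) (Multiplicative ℤ)) :
    opOf (A * B) = opMul (opOf A) (opOf B) := by
  funext k
  have e := finsum_comp_equiv (Multiplicative.toAdd (α := ℤ))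
    (f := fun i : ℤ => opOf A i * shift i (opOf B (k - i)))
  rw [opMul, ← e]
  have e' : ∀ i : Multiplicative ℤ, opOf A i.toAdd * shift i.toAdd (opOf B (k - i.toAdd)) =
      A.coeff i * i • B.coeff (i⁻¹ * Multiplicative.ofAdd k) := fun i => by
    rw [mul_comm i⁻¹, ← div_eq_mul_inv]
    rfl
  simp only [e']
  rw [finsum_eq_sum_of_support_subset (s := A.coeff.support) _ fun i hi => ?_, opOf,
    coeff_mul_left, sum_def, Finsupp.sum]
  rw [Finset.mem_coe, Finsupp.mem_support_iff]
  intro h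
  exact hi (by beta_reduce; rw [h, zero_mul])

theorem opOf_injective {N M : ℕ} : Function.Injective (opOf (N := N) (M := M)) := fun _ _ h =>
  SkewMonoidAlgebra.ext fun g => congrFun h g.toAdd

theorem opOf_skewNeg {N M : ℕ} (A : SkewMonoidAlgebra (Hat N M) (Multiplicative ℤ))
    (f : Hat N M) : opOf (skewNeg A f) = negAdd (opOf A) f := by
  funext k
  rw [skewNeg, opOf_add, negAdd, Pi.add_apply, Pi.add_apply, opOf, opOf, skewPart_coeff,
    skewConst_coeff, monomialOp, Pi.single_apply]
  rfl

theorem opOf_skewPart {N M : ℕ} (S : Set ℤ) (A : SkewMonoidAlgebra (Hat N M) (Multiplicative ℤ)) :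
    opOf (skewPart S A) = part S (opOf A) := by
  funext k
  rw [opOf, skewPart_coeff]
  rfl

/-- The truncation of a difference operator to a finite window. -/
def truncOp {N M : ℕ} (A : DiffOp N M) : SkewMonoidAlgebra (Hat N M) (Multiplicative ℤ) :=
  ∑ k ∈ Finset.Icc (-((M : ℤ) + N)) (M + N), single (Multiplicative.ofAdd k) (A k)

theorem opOf_truncOp_apply {N M : ℕ} (A : DiffOp N M) {k : ℤ}
    (hk : k ∈ Finset.Icc (-((M : ℤ) + N)) (M + N)) : opOf (truncOp A) k = A k := by
  rw [opOf, truncOp, ← coeffAddEquiv_apply, _root_.map_sum, Finsupp.finsetSum_apply,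
    Finset.sum_eq_single_of_mem k hk]
  · exact Finsupp.single_eq_same
  · intro j _ hj
    exact Finsupp.single_eq_of_ne (fun h => hj (Multiplicative.ofAdd.injective h).symm)

theorem opOf_truncOp_apply_eq_zero {N M : ℕ} (A : DiffOp N M) {k : ℤ}
    (hk : k ∉ Finset.Icc (-((M : ℤ) + N)) (M + N)) : opOf (truncOp A) k = 0 := by
  rw [opOf, truncOp, ← coeffAddEquiv_apply, _root_.map_sum, Finsupp.finsetSum_apply]
  refine Finset.sum_eq_zero fun j hj => ?_
  exact Finsupp.single_eq_of_ne (fun h => hk (by rwa [Multiplicative.ofAdd.injective h]))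

theorem opOf_truncOp {N M : ℕ} {A : DiffOp N M}
    (h : ∀ k ∉ Finset.Icc (-((M : ℤ) + N)) (M + N), A k = 0) : opOf (truncOp A) = A := by
  funext k
  by_cases hk : k ∈ Finset.Icc (-((M : ℤ) + N)) (M + N)
  · exact opOf_truncOp_apply A hk
  · rw [opOf_truncOp_apply_eq_zero A hk, h k hk]

/-- The Lax operator as an element of the skew group ring. -/
def laxSkew (N M : ℕ) : SkewMonoidAlgebra (Hat N M) (Multiplicative ℤ) := truncOp (lax N M)

theorem opOf_laxSkew {N M : ℕ} : opOf (laxSkew N M) = lax N M :=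
  opOf_truncOp fun k hk => uHat_eq_zero fun h => hk (by rw [Finset.mem_Icc] at h ⊢; omega)

/-- The window of `truncOp` contains both the orders of `L` and the orders from `-N + 1` to `M` on
which a form is tested. -/
theorem opOf_truncOp_neg {N M : ℕ} (X : DiffOp N M) :
    ∀ n ∈ Finset.Ico (-(M : ℤ)) N, opOf (truncOp X) (-n) = X (-n) := fun n hn =>
  opOf_truncOp_apply X (by rw [Finset.mem_Ico] at hn; rw [Finset.mem_Icc]; omega)

theorem laxLeft_opOf {N M : ℕ} (A : SkewMonoidAlgebra (Hat N M) (Multiplicative ℤ)) :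
    laxLeft N M (opOf A) = opOf (laxSkew N M * A) := by
  rw [opOf_mul, opOf_laxSkew]; rfl

theorem laxRight_opOf {N M : ℕ} (A : SkewMonoidAlgebra (Hat N M) (Multiplicative ℤ)) :
    laxRight N M (opOf A) = opOf (A * laxSkew N M) := by
  rw [opOf_mul, opOf_laxSkew]; rfl

theorem res_opComm_opOf {N M : ℕ} (A : SkewMonoidAlgebra (Hat N M) (Multiplicative ℤ)) :
    res (opComm (lax N M) (opOf A)) = skewRes (laxSkew N M * A - A * laxSkew N M) := by
  rw [res_opComm, laxLeft_opOf, laxRight_opOf, map_sub]; rfl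

theorem P₂_opOf {N M : ℕ} (hN : 1 ≤ N) {x : SkewMonoidAlgebra (Hat N M) (Multiplicative ℤ)}
    {g : Hat N M} (hg : Multiplicative.ofAdd (N : ℤ) • g - g =
      skewRes (laxSkew N M * x - x * laxSkew N M)) :
    P₂ N M (opOf x) = opOf (skewP (Multiplicative.ofAdd (N : ℤ)) (laxSkew N M) x g) := by
  rw [P₂_eq hN (hg.trans (res_opComm_opOf x).symm), laxLeft_opOf, laxRight_opOf, ← opOf_skewNeg,
    ← opOf_skewNeg, laxLeft_opOf, laxRight_opOf, ← opOf_sub]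
  rfl

theorem P₁_opOf {N M : ℕ} {x : SkewMonoidAlgebra (Hat N M) (Multiplicative ℤ)}
    {g : Hat N M} (hg : Multiplicative.ofAdd (N : ℤ) • g - g =
      skewRes (laxSkew N M * x - x * laxSkew N M)) :
    P₁ N M (opOf x) = opOf (skewP1 (Multiplicative.ofAdd (N : ℤ)) (laxSkew N M) x g) := by
  rw [P₁_eq (hg.trans (res_opComm_opOf x).symm), laxLeft_opOf, laxRight_opOf, ← opOf_skewNeg,
    ← opOf_skewNeg, ← opOf_skewPart, laxLeft_opOf, laxRight_opOf, ← opOf_sub, ← opOf_sub,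
    ← opOf_add]
  rfl

theorem pairing_opOf {N M : ℕ} (x y : SkewMonoidAlgebra (Hat N M) (Multiplicative ℤ)) :
    pairing (opOf x) (opOf y) = skewTrace (integral N M).toAddMonoidHom (x * y) := by
  rw [pairing, ← opOf_mul]; rfl

theorem integral_smul_shift {N M : ℕ} (g : Multiplicative ℤ) (f : Hat N M) :
    (integral N M).toAddMonoidHom (g • f) = (integral N M).toAddMonoidHom f :=
  integral_shift g.toAdd f

/-- The left factor is arbitrary because derivatives of the operators along `V` require preimages of
`res [V, X]` as well. -/
theorem exists_skew_preimage {N M : ℕ} (hN : 1 ≤ N)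
    (v x : SkewMonoidAlgebra (Hat N M) (Multiplicative ℤ)) :
    ∃ g : Hat N M, Multiplicative.ofAdd (N : ℤ) • g - g = skewRes (v * x - x * v) := by
  induction v using SkewMonoidAlgebra.induction_on with
  | zero => exact ⟨0, by simp⟩
  | add v w hv hw =>
    obtain ⟨g, hg⟩ := hv
    obtain ⟨h, hh⟩ := hw
    refine ⟨g + h, ?_⟩
    rw [smul_add, add_mul, mul_add, add_sub_add_comm, hg, hh, ← map_add]
    congr 1
    abel
  | single a r =>
    induction x using SkewMonoidAlgebra.induction_on with
    | zero => exact ⟨0, by simp⟩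
    | add v w hv hw =>
      obtain ⟨g, hg⟩ := hv
      obtain ⟨h, hh⟩ := hw
      refine ⟨g + h, ?_⟩
      rw [smul_add, add_mul, mul_add, add_sub_add_comm, hg, hh, ← map_add]
      congr 1
      abel
    | single b s =>
      rw [map_sub, skewRes_single_mul_single, skewRes_single_mul_single]
      by_cases h : a * b = 1
      · have hb : b = a⁻¹ := (inv_eq_of_mul_eq_one_right h).symm
        subst hb
        refine ⟨symbolLin (ratioSymbol N a.toAdd) (s * a⁻¹ • r), ?_⟩
        rw [if_pos (mul_inv_cancel a), if_pos (inv_mul_cancel a), ofAdd_smul_eq_shift,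
          shift_sub_self_ratioSymbol hN]
        congr 1
        change a • (s * a⁻¹ • r) = _
        rw [smul_mul', smul_inv_smul, mul_comm]
      · exact ⟨0, by rw [if_neg h, if_neg (fun h' => h (by rwa [mul_comm]))]; simp⟩

/-! ### Directional derivatives on the skew group ring -/

/-- The derivative along `V`, applied to every coefficient. -/
def skewDir {N M : ℕ} (V : DiffOp N M) : SkewMonoidAlgebra (Hat N M) (Multiplicative ℤ) →+
    SkewMonoidAlgebra (Hat N M) (Multiplicative ℤ) where
  toFun A := ⟨A.coeff.mapRange (dirLin V) (map_zero _)⟩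
  map_zero' := by
    refine SkewMonoidAlgebra.ext fun g => ?_
    exact map_zero (dirLin V)
  map_add' A B := by
    refine SkewMonoidAlgebra.ext fun g => ?_
    change dirLin V ((A + B).coeff g) = _
    rw [coeff_add, coeff_add]
    exact map_add (dirLin V) (A.coeff g) (B.coeff g)

theorem skewDir_coeff {N M : ℕ} (V : DiffOp N M)
    (A : SkewMonoidAlgebra (Hat N M) (Multiplicative ℤ)) (g : Multiplicative ℤ) :
    (skewDir V A).coeff g = dirLin V (A.coeff g) := rfl

theorem opOf_skewDir {N M : ℕ} (V : DiffOp N M)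
    (A : SkewMonoidAlgebra (Hat N M) (Multiplicative ℤ)) :
    opOf (skewDir V A) = dirOp V (opOf A) := rfl

theorem skewDir_single {N M : ℕ} (V : DiffOp N M) (g : Multiplicative ℤ) (f : Hat N M) :
    skewDir V (single g f) = single g (dirLin V f) := by
  classical
  refine SkewMonoidAlgebra.ext fun h => ?_
  rw [skewDir_coeff, coeff_single_apply, coeff_single_apply]
  split_ifs
  · rfl
  · exact map_zero _

theorem dirLin_smul_shift {N M : ℕ} (V : DiffOp N M) (g : Multiplicative ℤ) (f : Hat N M) :
    dirLin V (g • f) = g • dirLin V f := dirLin_shift V g.toAdd f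

theorem skewDir_mul {N M : ℕ} (V : DiffOp N M)
    (A B : SkewMonoidAlgebra (Hat N M) (Multiplicative ℤ)) :
    skewDir V (A * B) = skewDir V A * B + A * skewDir V B := by
  induction A using SkewMonoidAlgebra.induction_on with
  | zero => simp
  | add A A' h h' => simp only [add_mul, map_add, h, h']; abel
  | single a r =>
    induction B using SkewMonoidAlgebra.induction_on with
    | zero => simp
    | add B B' h h' => simp only [mul_add, map_add, h, h']; abel
    | single b s =>
      simp only [single_mul_single, skewDir_single, dirLin_mul, dirLin_smul_shift]
      rw [← single_add, add_comm, mul_comm (dirLin V r)]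

theorem skewDir_skewPart {N M : ℕ} (V : DiffOp N M) (S : Set ℤ)
    (A : SkewMonoidAlgebra (Hat N M) (Multiplicative ℤ)) :
    skewDir V (skewPart S A) = skewPart S (skewDir V A) := by
  classical
  refine SkewMonoidAlgebra.ext fun g => ?_
  rw [skewDir_coeff, skewPart_coeff, skewPart_coeff, Set.indicator, Set.indicator]
  split_ifs
  · rfl
  · exact map_zero _

theorem skewDir_skewNeg {N M : ℕ} (V : DiffOp N M)
    (A : SkewMonoidAlgebra (Hat N M) (Multiplicative ℤ)) (g : Hat N M) :
    skewDir V (skewNeg A g) = skewNeg (skewDir V A) (dirLin V g) := by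
  rw [skewNeg, map_add, skewDir_skewPart]
  exact congrArg _ (skewDir_single V 1 g)

theorem skewDir_laxSkew {N M : ℕ} (hM : 1 ≤ M) {V : DiffOp N M} (hV : IsTangent V) :
    opOf (skewDir V (laxSkew N M)) = V := by
  rw [opOf_skewDir, opOf_laxSkew]
  exact funext fun n => dirLin_uHat hM hV n

/-- The derivative of `g` splits into `g'`, belonging to the derivative of `L`, and the rest,
belonging to the derivative of `x`; by `skew_preimage_dir` the rest is a valid preimage for the
latter. -/
theorem skewDir_skewP {N M : ℕ} (V : DiffOp N M) (σ : Multiplicative ℤ)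
    (L x : SkewMonoidAlgebra (Hat N M) (Multiplicative ℤ)) (g g' : Hat N M) :
    skewDir V (skewP σ L x g) - skewP σ L (skewDir V x) (dirLin V g - g') =
      skewPDeriv σ L (skewDir V L) x g g' := by
  simp only [skewP, skewPDeriv, map_sub, skewDir_mul, skewDir_skewNeg, dirLin_smul_shift, smul_sub]
  simp only [skewNeg, map_add, map_sub, mul_add, add_mul, mul_sub, sub_mul]
  abel

theorem skewDir_skewP1 {N M : ℕ} (V : DiffOp N M) (σ : Multiplicative ℤ)
    (L x : SkewMonoidAlgebra (Hat N M) (Multiplicative ℤ)) (g g' : Hat N M) :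
    skewDir V (skewP1 σ L x g) - skewP1 σ L (skewDir V x) (dirLin V g - g') =
      skewP1 σ (skewDir V L) x g' := by
  simp only [skewP1, map_sub, map_add, skewDir_mul, skewDir_skewNeg, skewDir_skewPart,
    dirLin_smul_shift, smul_sub]
  simp only [skewNeg, map_add, map_sub]
  abel

theorem skewRes_skewDir {N M : ℕ} (V : DiffOp N M)
    (A : SkewMonoidAlgebra (Hat N M) (Multiplicative ℤ)) :
    skewRes (skewDir V A) = dirLin V (skewRes A) := rfl

theorem skew_preimage_dir {N M : ℕ} (V : DiffOp N M) {σ : Multiplicative ℤ}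
    {L x : SkewMonoidAlgebra (Hat N M) (Multiplicative ℤ)} {g g' : Hat N M}
    (hg : σ • g - g = skewRes (L * x - x * L))
    (hg' : σ • g' - g' = skewRes (skewDir V L * x - x * skewDir V L)) :
    σ • (dirLin V g - g') - (dirLin V g - g') =
      skewRes (L * skewDir V x - skewDir V x * L) := by
  have h := congrArg (dirLin V) hg
  rw [map_sub, dirLin_smul_shift, ← skewRes_skewDir, map_sub, skewDir_mul, skewDir_mul] at h
  rw [smul_sub, sub_sub_sub_comm, h, hg', ← map_sub]
  congr 1
  abel

theorem derivPairing_P₂ {N M : ℕ} (hN : 1 ≤ N) (hM : 1 ≤ M)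
    {x y z v : SkewMonoidAlgebra (Hat N M) (Multiplicative ℤ)} {g g' : Hat N M}
    {Q : DiffOp N M → DiffOp N M} (hQ : IsTangent (Q (opOf z))) (hv : Q (opOf z) = opOf v)
    (hg : Multiplicative.ofAdd (N : ℤ) • g - g =
      skewRes (laxSkew N M * y - y * laxSkew N M))
    (hg' : Multiplicative.ofAdd (N : ℤ) • g' - g' = skewRes (v * y - y * v)) :
    derivPairing (P₂ N M) Q (opOf x) (opOf y) (opOf z) =
      skewTrace (integral N M).toAddMonoidHom
        (x * skewPDeriv (Multiplicative.ofAdd (N : ℤ)) (laxSkew N M) v y g g') := by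
  -- The coefficients of `L` are the coordinates themselves, so the derivative of `L` along a
  -- tangent vector is that vector.
  obtain rfl : skewDir (Q (opOf z)) (laxSkew N M) = v :=
    opOf_injective ((skewDir_laxSkew hM hQ).trans hv)
  rw [derivPairing, ← opOf_skewDir, P₂_opOf hN hg, P₂_opOf hN (skew_preimage_dir _ hg hg'),
    ← opOf_skewDir, ← opOf_sub, skewDir_skewP, pairing_opOf]

theorem derivPairing_P₁ {N M : ℕ} (hM : 1 ≤ M)
    {x y z v : SkewMonoidAlgebra (Hat N M) (Multiplicative ℤ)} {g g' : Hat N M}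
    {Q : DiffOp N M → DiffOp N M} (hQ : IsTangent (Q (opOf z))) (hv : Q (opOf z) = opOf v)
    (hg : Multiplicative.ofAdd (N : ℤ) • g - g =
      skewRes (laxSkew N M * y - y * laxSkew N M))
    (hg' : Multiplicative.ofAdd (N : ℤ) • g' - g' = skewRes (v * y - y * v)) :
    derivPairing (P₁ N M) Q (opOf x) (opOf y) (opOf z) =
      skewTrace (integral N M).toAddMonoidHom
        (x * skewP1 (Multiplicative.ofAdd (N : ℤ)) v y g') := by
  obtain rfl : skewDir (Q (opOf z)) (laxSkew N M) = v :=
    opOf_injective ((skewDir_laxSkew hM hQ).trans hv)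
  rw [derivPairing, ← opOf_skewDir, P₁_opOf hg, P₁_opOf (skew_preimage_dir _ hg hg'),
    ← opOf_skewDir, ← opOf_sub, skewDir_skewP1, pairing_opOf]

/-! ### Skew symmetry and the Jacobi identity -/

theorem P₁_congr {N M : ℕ} (hN : 1 ≤ N) {X Y : DiffOp N M}
    (h : ∀ n ∈ Finset.Ico (-(M : ℤ)) N, X (-n) = Y (-n)) : P₁ N M X = P₁ N M Y := by
  refine sub_eq_zero.1 (((P₁Lin hN).map_sub X Y).symm.trans ?_)
  exact P₁_null hN fun n hn => by rw [Pi.sub_apply, h n hn, sub_self]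

theorem P₂_congr {N M : ℕ} (hN : 1 ≤ N) {X Y : DiffOp N M}
    (h : ∀ n ∈ Finset.Ico (-(M : ℤ)) N, X (-n) = Y (-n)) : P₂ N M X = P₂ N M Y := by
  refine sub_eq_zero.1 (((P₂Lin hN).map_sub X Y).symm.trans ?_)
  exact P₂_null hN fun n hn => by rw [Pi.sub_apply, h n hn, sub_self]

/-- Forms matter only modulo null forms, so they may be replaced by finite operators, for which the
skew group ring is available. -/
theorem pairing_trunc {N M : ℕ} {P : DiffOp N M → DiffOp N M} (hP : ∀ X, IsTangent (P X))
    (hc : ∀ X Y : DiffOp N M, (∀ n ∈ Finset.Ico (-(M : ℤ)) N, X (-n) = Y (-n)) → P X = P Y)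
    (X Y : DiffOp N M) :
    pairing X (P Y) = pairing (opOf (truncOp X)) (P (opOf (truncOp Y))) := by
  rw [hc _ _ (opOf_truncOp_neg Y)]
  exact (pairing_congr_left (hP _) (opOf_truncOp_neg X)).symm

theorem derivPairing_trunc {N M : ℕ} {P Q : DiffOp N M → DiffOp N M} (hP : ∀ X, IsTangent (P X))
    (hPc : ∀ X Y : DiffOp N M, (∀ n ∈ Finset.Ico (-(M : ℤ)) N, X (-n) = Y (-n)) → P X = P Y)
    (hQc : ∀ X Y : DiffOp N M, (∀ n ∈ Finset.Ico (-(M : ℤ)) N, X (-n) = Y (-n)) → Q X = Q Y)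
    (X Y Z : DiffOp N M) : derivPairing P Q X Y Z =
      derivPairing P Q (opOf (truncOp X)) (opOf (truncOp Y)) (opOf (truncOp Z)) := by
  rw [derivPairing, derivPairing, hPc _ _ (opOf_truncOp_neg Y), hQc _ _ (opOf_truncOp_neg Z),
    hPc (dirOp (Q Z) (opOf (truncOp Y))) (dirOp (Q Z) Y) fun n hn =>
      congrArg (dirLin (Q Z)) (opOf_truncOp_neg Y n hn)]
  exact (pairing_congr_left (((hP _).dirOp _).sub (hP _)) (opOf_truncOp_neg X)).symm

theorem P₁_skew {N M : ℕ} (hN : 1 ≤ N) (X Y : DiffOp N M) :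
    pairing X (P₁ N M Y) = -pairing Y (P₁ N M X) := by
  rw [pairing_trunc (P₁_tangent hN) (fun _ _ => P₁_congr hN) X Y,
    pairing_trunc (P₁_tangent hN) (fun _ _ => P₁_congr hN) Y X]
  obtain ⟨g, hg⟩ := exists_skew_preimage hN (laxSkew N M) (truncOp X)
  obtain ⟨h, hh⟩ := exists_skew_preimage hN (laxSkew N M) (truncOp Y)
  rw [P₁_opOf hg, P₁_opOf hh, pairing_opOf, pairing_opOf]
  exact skewP1_skew integral_smul_shift _ hg hh

theorem P₂_skew {N M : ℕ} (hN : 1 ≤ N) (X Y : DiffOp N M) :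
    pairing X (P₂ N M Y) = -pairing Y (P₂ N M X) := by
  rw [pairing_trunc (P₂_tangent hN) (fun _ _ => P₂_congr hN) X Y,
    pairing_trunc (P₂_tangent hN) (fun _ _ => P₂_congr hN) Y X]
  obtain ⟨g, hg⟩ := exists_skew_preimage hN (laxSkew N M) (truncOp X)
  obtain ⟨h, hh⟩ := exists_skew_preimage hN (laxSkew N M) (truncOp Y)
  rw [P₂_opOf hN hg, P₂_opOf hN hh, pairing_opOf, pairing_opOf]
  exact skewP_skew integral_smul_shift _ hg hh

theorem derivPairing_jacobi {N M : ℕ} (hN : 1 ≤ N) (hM : 1 ≤ M) (X Y Z : DiffOp N M) :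
    (derivPairing (P₂ N M) (P₂ N M) X Y Z + derivPairing (P₂ N M) (P₂ N M) Y Z X
      + derivPairing (P₂ N M) (P₂ N M) Z X Y = 0) ∧
    ((derivPairing (P₂ N M) (P₁ N M) X Y Z + derivPairing (P₁ N M) (P₂ N M) X Y Z)
      + (derivPairing (P₂ N M) (P₁ N M) Y Z X + derivPairing (P₁ N M) (P₂ N M) Y Z X)
      + (derivPairing (P₂ N M) (P₁ N M) Z X Y + derivPairing (P₁ N M) (P₂ N M) Z X Y) = 0) ∧
    (derivPairing (P₁ N M) (P₁ N M) X Y Z + derivPairing (P₁ N M) (P₁ N M) Y Z X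
      + derivPairing (P₁ N M) (P₁ N M) Z X Y = 0) := by
  have t1 := P₁_tangent (M := M) hN
  have t2 := P₂_tangent (M := M) hN
  have c1 : ∀ X Y : DiffOp N M, (∀ n ∈ Finset.Ico (-(M : ℤ)) N, X (-n) = Y (-n)) →
    P₁ N M X = P₁ N M Y := fun _ _ => P₁_congr hN
  have c2 : ∀ X Y : DiffOp N M, (∀ n ∈ Finset.Ico (-(M : ℤ)) N, X (-n) = Y (-n)) →
    P₂ N M X = P₂ N M Y := fun _ _ => P₂_congr hN
  simp only [derivPairing_trunc t1 c1 c1 X, derivPairing_trunc t1 c1 c2 X,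
    derivPairing_trunc t2 c2 c1 X, derivPairing_trunc t2 c2 c2 X,
    derivPairing_trunc t1 c1 c1 Y, derivPairing_trunc t1 c1 c2 Y,
    derivPairing_trunc t2 c2 c1 Y, derivPairing_trunc t2 c2 c2 Y,
    derivPairing_trunc t1 c1 c1 Z, derivPairing_trunc t1 c1 c2 Z,
    derivPairing_trunc t2 c2 c1 Z, derivPairing_trunc t2 c2 c2 Z]
  generalize truncOp X = x
  generalize truncOp Y = y
  generalize truncOp Z = z
  obtain ⟨gX, eX⟩ := exists_skew_preimage hN (laxSkew N M) x
  obtain ⟨gY, eY⟩ := exists_skew_preimage hN (laxSkew N M) y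
  obtain ⟨gZ, eZ⟩ := exists_skew_preimage hN (laxSkew N M) z
  obtain ⟨gXY, eXY⟩ := exists_skew_preimage hN (skewP (.ofAdd (N : ℤ)) (laxSkew N M) z gZ) y
  obtain ⟨gYZ, eYZ⟩ := exists_skew_preimage hN (skewP (.ofAdd (N : ℤ)) (laxSkew N M) x gX) z
  obtain ⟨gZX, eZX⟩ := exists_skew_preimage hN (skewP (.ofAdd (N : ℤ)) (laxSkew N M) y gY) x
  obtain ⟨hXY, fXY⟩ := exists_skew_preimage hN (skewP1 (.ofAdd (N : ℤ)) (laxSkew N M) z gZ) y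
  obtain ⟨hYZ, fYZ⟩ := exists_skew_preimage hN (skewP1 (.ofAdd (N : ℤ)) (laxSkew N M) x gX) z
  obtain ⟨hZX, fZX⟩ := exists_skew_preimage hN (skewP1 (.ofAdd (N : ℤ)) (laxSkew N M) y gY) x
  rw [derivPairing_P₂ hN hM (t2 _) (P₂_opOf hN eZ) eY eXY,
    derivPairing_P₂ hN hM (t2 _) (P₂_opOf hN eX) eZ eYZ,
    derivPairing_P₂ hN hM (t2 _) (P₂_opOf hN eY) eX eZX,
    derivPairing_P₂ hN hM (t1 _) (P₁_opOf eZ) eY fXY,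
    derivPairing_P₂ hN hM (t1 _) (P₁_opOf eX) eZ fYZ,
    derivPairing_P₂ hN hM (t1 _) (P₁_opOf eY) eX fZX,
    derivPairing_P₁ hM (t2 _) (P₂_opOf hN eZ) eY eXY,
    derivPairing_P₁ hM (t2 _) (P₂_opOf hN eX) eZ eYZ,
    derivPairing_P₁ hM (t2 _) (P₂_opOf hN eY) eX eZX,
    derivPairing_P₁ hM (t1 _) (P₁_opOf eZ) eY fXY,
    derivPairing_P₁ hM (t1 _) (P₁_opOf eX) eZ fYZ,
    derivPairing_P₁ hM (t1 _) (P₁_opOf eY) eX fZX]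
  exact skewP_pencil_jacobi integral_smul_shift localFunctional_eq_zero_of_add_self _
    eX eY eZ eXY eYZ eZX fXY fYZ fZX

/-- The operator enters twice, as the object differentiated and as the direction. The coefficients
of `a²`, `ab`, `b²` are the three expressions treated in `derivPairing_jacobi`. -/
theorem derivPairing_pencil {N M : ℕ} {P Q : DiffOp N M →ₗ[ℂ⟦X⟧] DiffOp N M}
    (hP : ∀ X, IsTangent (P X)) (hQ : ∀ X, IsTangent (Q X)) (a b : ℂ⟦X⟧) (X Y Z : DiffOp N M) :
    derivPairing (a • P + b • Q : DiffOp N M →ₗ[ℂ⟦X⟧] DiffOp N M)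
        (a • P + b • Q : DiffOp N M →ₗ[ℂ⟦X⟧] DiffOp N M) X Y Z =
      (a * a) • derivPairing P P X Y Z
        + (a * b) • (derivPairing Q P X Y Z + derivPairing P Q X Y Z)
        + (b * b) • derivPairing Q Q X Y Z := by
  have key : ∀ (A : DiffOp N M),
      dirOp (a • P Z + b • Q Z) A = a • dirOp (P Z) A + b • dirOp (Q Z) A := by
    intro A
    funext k
    simp only [dirOp, dirLin_map_add, dirLin_map_smul, Pi.add_apply, Pi.smul_apply]
  have lin : ∀ V A B : DiffOp N M, dirOp V (a • A + b • B) = a • dirOp V A + b • dirOp V B := by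
    intro V A B
    funext k
    simp only [dirOp, Pi.add_apply, Pi.smul_apply, map_add, map_smul]
  have T : ∀ {P Q : DiffOp N M →ₗ[ℂ⟦X⟧] DiffOp N M}, (∀ X, IsTangent (P X)) →
      IsTangent (dirOp (Q Z) (P Y) - P (dirOp (Q Z) Y)) := fun h => ((h _).dirOp _).sub (h _)
  have e : dirOp ((a • P + b • Q) Z) ((a • P + b • Q) Y)
      - (a • P + b • Q) (dirOp ((a • P + b • Q) Z) Y) =
      (a * a) • (dirOp (P Z) (P Y) - P (dirOp (P Z) Y))
        + (a * b) • ((dirOp (P Z) (Q Y) - Q (dirOp (P Z) Y))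
          + (dirOp (Q Z) (P Y) - P (dirOp (Q Z) Y)))
        + (b * b) • (dirOp (Q Z) (Q Y) - Q (dirOp (Q Z) Y)) := by
    simp only [LinearMap.add_apply, LinearMap.smul_apply, key, lin, map_add, map_smul, smul_add,
      smul_sub, smul_smul, mul_comm b a]
    abel
  simp only [derivPairing]
  rw [e, pairing_add_right ((((T hP).smul _).add (((T hQ).add (T hP)).smul _))) ((T hQ).smul _),
    pairing_add_right ((T hP).smul _) (((T hQ).add (T hP)).smul _), pairing_smul_right (T hP),
    pairing_smul_right ((T hQ).add (T hP)), pairing_smul_right (T hQ),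
    pairing_add_right (T hQ) (T hP)]

theorem compatible_P₁_P₂ {N M : ℕ} (hN : 1 ≤ N) (hM : 1 ≤ M) :
    Compatible (P₁ N M) (P₂ N M) := by
  intro a b
  refine isHamiltonianOperator_of_jacobi hN hM (a • P₁Lin hN + b • P₂Lin hN) (fun X => ?_)
    (fun X hX => ?_) (fun X Y => ?_) fun X Y Z => ?_
  · exact ((P₁_tangent hN X).smul a).add ((P₂_tangent hN X).smul b)
  · change a • P₁ N M X + b • P₂ N M X = 0
    rw [P₁_null hN hX, P₂_null hN hX, smul_zero, smul_zero, add_zero]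
  · change pairing X (a • P₁ N M Y + b • P₂ N M Y) = -pairing Y (a • P₁ N M X + b • P₂ N M X)
    have t1 := P₁_tangent (M := M) hN
    have t2 := P₂_tangent (M := M) hN
    rw [pairing_add_right ((t1 _).smul _) ((t2 _).smul _),
      pairing_add_right ((t1 _).smul _) ((t2 _).smul _), pairing_smul_right (t1 _),
      pairing_smul_right (t2 _), pairing_smul_right (t1 _), pairing_smul_right (t2 _),
      P₁_skew hN X Y, P₂_skew hN X Y, smul_neg, smul_neg, neg_add]
  · obtain ⟨h22, h12, h11⟩ := derivPairing_jacobi hN hM X Y Z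
    have hp := derivPairing_pencil (P := P₁Lin hN) (Q := P₂Lin hN) (P₁_tangent (M := M) hN)
      (P₂_tangent hN) a b
    rw [hp, hp, hp]
    have f1 : ⇑(P₁Lin (M := M) hN) = P₁ N M := rfl
    have f2 : ⇑(P₂Lin (M := M) hN) = P₂ N M := rfl
    rw [f1, f2]
    have h := congrArg₂ (· + ·) (congrArg₂ (· + ·) (congrArg ((a * a) • ·) h11)
      (congrArg ((a * b) • ·) h12)) (congrArg ((b * b) • ·) h22)
    simp only [smul_zero, add_zero] at h
    rw [← h]
    simp only [smul_add]
    abel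

theorem isHamiltonianOperator_P₁ {N M : ℕ} (hN : 1 ≤ N) (hM : 1 ≤ M) :
    IsHamiltonianOperator (P₁ N M) := by
  have h := compatible_P₁_P₂ hN hM 1 0
  simpa only [one_smul, zero_smul, add_zero] using h

theorem isHamiltonianOperator_P₂ {N M : ℕ} (hN : 1 ≤ N) (hM : 1 ≤ M) :
    IsHamiltonianOperator (P₂ N M) := by
  have h := compatible_P₁_P₂ hN hM 0 1
  simpa only [one_smul, zero_smul, zero_add] using h

end BigradedToda

namespace BigradedToda

/-! ### Explicit brackets -/

theorem part_monomialOp_of_mem {N M : ℕ} {S : Set ℤ} (f : Hat N M) {j : ℤ} (hj : j ∈ S) :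
    part S (monomialOp f j) = monomialOp f j := by
  funext k
  by_cases hk : k ∈ S
  · exact part_of_mem _ hk
  · rw [part_of_notMem _ hk, monomialOp, Pi.single_eq_of_ne (fun h => hk (by rwa [h]))]

theorem part_monomialOp_of_notMem {N M : ℕ} {S : Set ℤ} (f : Hat N M) {j : ℤ} (hj : j ∉ S) :
    part S (monomialOp f j) = 0 := by
  funext k
  by_cases hk : k ∈ S
  · rw [part_of_mem _ hk, monomialOp, Pi.single_eq_of_ne (fun h => hj (by rwa [← h]))]
    rfl
  · exact part_of_notMem _ hk

theorem opComm_zero_left {N M : ℕ} : opComm 0 (lax N M) = 0 := by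
  rw [opComm, opMul_lax_left, opMul_lax_right, map_zero, map_zero, sub_zero]

theorem part_zero {N M : ℕ} (S : Set ℤ) : part S (0 : DiffOp N M) = 0 := Set.indicator_zero' _

theorem opComm_monomialOp {N M : ℕ} (f : Hat N M) (n m : ℤ) :
    opComm (monomialOp (shift (-m) f) (-m)) (lax N M) n =
      shift (-m) (uHat N M (n + m)) * shift (-m) f - uHat N M (n + m) * shift n f := by
  rw [opComm, opMul_lax_left, opMul_lax_right, Pi.sub_apply, laxLeft_monomialOp,
    laxRight_monomialOp, sub_neg_eq_add, shift_shift, add_neg_cancel_right, mul_comm (shift _ f)]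

/-- A form `Λ^{-m} ∘ f` lies entirely in `X_+` or entirely in `X_-` according to the sign of `m`,
and the sign of `n` selects the projection; these cases are the values of `c_{nm}`. -/
theorem coordBracket_P₁ (N M : ℕ) (n m : ℤ) : coordBracket (P₁ N M) n m = kernel₁ N M n m := by
  funext f
  rw [coordBracket, P₁, Pi.sub_apply, kernel₁, Pi.smul_apply, Pi.sub_apply, deltaKernel,
    deltaKernel, cConst]
  rcases le_or_gt m 0 with hm | hm
  · rw [part_monomialOp_of_mem _ (Set.mem_Ici.2 (by omega)),
      part_monomialOp_of_notMem _ (by simpa using hm), opComm_zero_left, part_zero, Pi.zero_apply,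
      sub_zero, if_neg (by omega)]
    rcases le_or_gt n 0 with hn | hn
    · rw [part_of_mem _ (Set.mem_Iic.2 hn), if_pos ⟨hn, hm⟩, opComm_monomialOp, neg_one_smul,
        neg_sub]
    · rw [part_of_notMem _ (by simpa using hn), if_neg (by omega), zero_smul]
  · rw [part_monomialOp_of_notMem _ (by simpa using hm),
      part_monomialOp_of_mem _ (Set.mem_Iio.2 (by omega)), opComm_zero_left, part_zero,
      Pi.zero_apply, zero_sub]
    rcases le_or_gt n 0 with hn | hn
    · rw [part_of_notMem _ (by simpa using hn), if_neg (by omega), if_neg (by omega), zero_smul,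
        neg_zero]
    · rw [part_of_mem _ (Set.mem_Ioi.2 hn), if_pos ⟨hn, hm⟩, opComm_monomialOp, one_smul, neg_sub]

theorem one_sub_expSymbol_ne_zero {N : ℕ} (hN : 1 ≤ N) : (1 : ℂ⟦X⟧) - expSymbol N ≠ 0 := by
  rw [← neg_sub, expSymbol_sub_one]
  refine neg_ne_zero.2 (mul_ne_zero PowerSeries.X_ne_zero fun h => ?_)
  exact constantCoeff_expDiffQuot_ne (by omega : (N : ℤ) ≠ 0) (by rw [h, map_zero])

theorem nonlocalSymbol_eq {N : ℕ} (hN : 1 ≤ N) (n m : ℤ) :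
    nonlocalSymbol N n m = (expSymbol N - expSymbol n) * ratioSymbol N (-m) := by
  refine mul_left_cancel₀ (one_sub_expSymbol_ne_zero hN) ?_
  rw [nonlocalSymbol_spec N hN]
  linear_combination (expSymbol N - expSymbol n) * ratioSymbol_spec hN (-m)

/-- The reindexing makes `l` the index of the coefficient `u_l` inside `A = XL`. Negative order
becomes `l < m`, and the vanishing of `u_l` below `-M` gives the other end. -/
theorem laxLeft_part_sum {N M : ℕ} {A : DiffOp N M} {m : ℤ} (n : ℤ)
    (hA : ∀ l < -(M : ℤ), A (l - m) = 0) : laxLeft N M (part (Set.Iio 0) A) n =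
      ∑ l ∈ Finset.Ico (-(M : ℤ)) m, uHat N M (n + m - l) * shift (n + m - l) (A (l - m)) := by
  rw [← opMul_lax_left, opMul, ← finsum_comp_equiv (Equiv.subLeft (n + m))]
  have e : ∀ l, n - (n + m - l) = l - m := fun l => by ring
  simp only [Equiv.subLeft_apply, e]
  rw [finsum_eq_sum_of_support_subset (s := Finset.Ico (-(M : ℤ)) m) _ fun l hl => ?_]
  · refine Finset.sum_congr rfl fun l hl => ?_
    rw [Finset.mem_Ico] at hl
    rw [part_of_mem _ (Set.mem_Iio.2 (by omega))]
    rfl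
  · by_contra h
    rw [Finset.mem_coe, Finset.mem_Ico] at h
    refine hl ?_
    beta_reduce
    rcases lt_or_ge l m with h' | h'
    · rw [part_of_mem _ (Set.mem_Iio.2 (by omega)), hA l (by omega), shift_map_zero, mul_zero]
    · rw [part_of_notMem _ (by simpa using h'), shift_map_zero, mul_zero]

theorem laxRight_part_sum {N M : ℕ} {A : DiffOp N M} {m : ℤ} (n : ℤ)
    (hA : ∀ l < -(M : ℤ), A (l - m) = 0) : laxRight N M (part (Set.Iio 0) A) n =
      ∑ l ∈ Finset.Ico (-(M : ℤ)) m, A (l - m) * shift (l - m) (uHat N M (n + m - l)) := by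
  rw [← opMul_lax_right, opMul, ← finsum_comp_equiv (Equiv.subRight m)]
  have e : ∀ l, n - (l - m) = n + m - l := fun l => by ring
  simp only [Equiv.subRight_apply, e]
  rw [finsum_eq_sum_of_support_subset (s := Finset.Ico (-(M : ℤ)) m) _ fun l hl => ?_]
  · refine Finset.sum_congr rfl fun l hl => ?_
    rw [Finset.mem_Ico] at hl
    rw [part_of_mem _ (Set.mem_Iio.2 (by omega))]
    rfl
  · by_contra h
    rw [Finset.mem_coe, Finset.mem_Ico] at h
    refine hl ?_
    beta_reduce
    rcases lt_or_ge l m with h' | h'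
    · rw [part_of_mem _ (Set.mem_Iio.2 (by omega)), hA l (by omega), zero_mul]
    · rw [part_of_notMem _ (by simpa using h'), zero_mul]

theorem coordBracket_P₂ {N M : ℕ} (hN : 1 ≤ N) (n m : ℤ) :
    coordBracket (P₂ N M) n m = kernel₂ N M n m := by
  funext f
  set X : DiffOp N M := monomialOp (shift (-m) f) (-m) with hX
  have hl : ∀ l, laxLeft N M X (l - m) = uHat N M l * shift (l - m) f := fun l => by
    rw [hX, laxLeft_monomialOp, sub_neg_eq_add, sub_add_cancel, shift_shift, sub_eq_add_neg]
  have hr : ∀ l, laxRight N M X (l - m) = shift (-m) (uHat N M l * f) := fun l => by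
    rw [hX, laxRight_monomialOp, sub_neg_eq_add, sub_add_cancel, shift_mul, mul_comm]
  -- For this form `res [L, X] = -(Λ^{-m} - 1)(u_m f)`, so a preimage is explicit. The nonlocal term
  -- of the kernel is then `u_n (Λ^n - Λ^N) g`.
  have hg : shift N (-symbolLin (ratioSymbol N (-m)) (uHat N M m * f))
      - -symbolLin (ratioSymbol N (-m)) (uHat N M m * f) =
      res (opComm (lax N M) X) := by
    have h := shift_sub_self_ratioSymbol hN (-m) (uHat N M m * f)
    have h0 := hl m
    have h1 := hr m
    rw [sub_self] at h0 h1
    rw [res_opComm, h0, h1, shift_zero, shift_eq, map_neg, ← shift_eq,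
      ← neg_sub (shift _ _) (_ * f), ← h]
    ring
  have hu : ∀ l < -(M : ℤ), uHat N M l = 0 := fun l hl' => uHat_eq_zero (by
    rw [Finset.mem_Icc]; omega)
  rw [coordBracket, P₂_eq hN hg, Pi.sub_apply, negAdd, negAdd, map_add, map_add, Pi.add_apply,
    Pi.add_apply, laxLeft_const, laxRight_const,
    laxLeft_part_sum (m := m) n fun l hl' => by rw [hr, hu l hl', zero_mul, shift_map_zero],
    laxRight_part_sum (m := m) n fun l hl' => by rw [hl, hu l hl', zero_mul]]
  rw [kernel₂, Pi.add_apply, Finset.sum_apply, nonlocalSymbol_eq hN, applySymbol_eq, symbolLin_mul,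
    symbolLin_sub]
  simp only [hl, hr, Pi.sub_apply, deltaKernel, Finset.sum_sub_distrib]
  have e1 : ∀ l, uHat N M (n + m - l) * shift (n + m - l) (shift (-m) (uHat N M l * f)) =
      uHat N M (n + m - l) * shift (n - l) (uHat N M l) * shift (n - l) f := fun l => by
    rw [shift_shift, show n + m - l + -m = n - l by ring, shift_mul, mul_assoc]
  have e2 : ∀ l, uHat N M l * shift (l - m) f * shift (l - m) (uHat N M (n + m - l)) =
      uHat N M l * shift (l - m) (uHat N M (n + m - l)) * shift (l - m) f := fun l => by ring
  simp only [e1, e2]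
  simp only [shift_eq, map_neg]
  change _ = _ + uHat N M n * (shiftLin N _ - shiftLin n _)
  ring

theorem pairing_eq_kernelBracket {N M : ℕ} (hN : 1 ≤ N) (hM : 1 ≤ M)
    {P : DiffOp N M → DiffOp N M} (hP : IsHamiltonianOperator P)
    {K : ℤ → ℤ → Hat N M → Hat N M}
    (hK : ∀ n ∈ Finset.Ico (-(M : ℤ)) N, ∀ m ∈ Finset.Ico (-(M : ℤ)) N,
      coordBracket P n m = K n m)
    {f g : Hat N M} {Wf Wg : DiffOp N M} (hf : IsDifferential f Wf) (hg : IsDifferential g Wg) :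
    pairing Wf (P Wg) = kernelBracket K f g := by
  let Q : DiffOp N M →ₗ[ℂ⟦X⟧] DiffOp N M :=
    { toFun := P, map_add' := hP.map_add, map_smul' := hP.map_smul }
  have h1 : P Wg = P (gradOp g) := by
    refine sub_eq_zero.1 ((Q.map_sub Wg (gradOp g)).symm.trans ?_)
    exact hP.map_null _ fun n hn => by rw [Pi.sub_apply, hg.eq_gradOp hN hM n hn, sub_self]
  have h2 : P (gradOp g) =
      ∑ m ∈ Finset.Ico (-(M : ℤ)) N, P (monomialOp (shift (-m) (varDeriv m g)) (-m)) :=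
    map_sum Q _ _
  rw [pairing_tangent' (hP.map_tangent _), h1, h2, kernelBracket]
  refine Finset.sum_congr rfl fun n hn => ?_
  rw [hf.eq_gradOp hN hM n hn, gradOp_apply_neg f hn, shift_shift, add_neg_cancel, shift_zero,
    Finset.sum_apply, Finset.mul_sum, map_sum]
  refine Finset.sum_congr rfl fun m hm => ?_
  rw [← hK n hn m hm]
  rfl

end BigradedToda

end

theorem mainTheorem3 (N M : ℕ) (hN : 1 ≤ N) (hM : 1 ≤ M) :
    -- the nonlocal term of the second operator is well defined
    ((∀ X : DiffOp N M, ∃ g : Hat N M,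
        shift N g - g
          = res (opComm (lax N M) X)) ∧
      (∀ (X : DiffOp N M) (g : Hat N M),
        shift N g - g
          = res (opComm (lax N M) X) →
        P₂ N M X = P₂With N M X g)) ∧
    -- every local functional has a differential
    (∀ f : Hat N M, IsDifferential f (gradOp f)) ∧
    -- the two operators are compatible Hamiltonian operators
    IsHamiltonianOperator (P₁ N M) ∧
    IsHamiltonianOperator (P₂ N M) ∧
    Compatible (P₁ N M) (P₂ N M) ∧
    -- explicit form of the brackets
    (∀ n ∈ Finset.Ico (-(M : ℤ)) N, ∀ m ∈ Finset.Ico (-(M : ℤ)) N,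
      coordBracket (P₁ N M) n m = kernel₁ N M n m ∧
      coordBracket (P₂ N M) n m = kernel₂ N M n m) ∧
    (∀ (f g : Hat N M) (Wf Wg : DiffOp N M),
      IsDifferential f Wf → IsDifferential g Wg →
      pairing Wf (P₁ N M Wg)
          = kernelBracket (kernel₁ N M) f g ∧
      pairing Wf (P₂ N M Wg)
          = kernelBracket (kernel₂ N M) f g) := by
  have h1 : IsHamiltonianOperator (P₁ N M) := isHamiltonianOperator_P₁ hN hM
  have h2 : IsHamiltonianOperator (P₂ N M) := isHamiltonianOperator_P₂ hN hM
  exact ⟨⟨exists_shift_sub_eq_res hN, fun _ _ hg => P₂_eq_P₂With hN hg⟩, isDifferential_gradOp,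
    h1, h2, compatible_P₁_P₂ hN hM,
    fun n _ m _ => ⟨coordBracket_P₁ N M n m, coordBracket_P₂ hN n m⟩,
    fun _ _ _ _ hf hg =>
      ⟨pairing_eq_kernelBracket hN hM h1 (fun n _ m _ => coordBracket_P₁ N M n m) hf hg,
        pairing_eq_kernelBracket hN hM h2 (fun n _ m _ => coordBracket_P₂ hN n m) hf hg⟩⟩
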